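/- **Setting.** Let $r,\mu$ be integers with $r\ge 3$, $1\le\mu\le r-2$. Write $(\cdot,\cdot)$, $\|\cdot\|$ for the inner product and norm of $L^2(0,1)$ and $\|\cdot\|_m$ for the norm of $H^m=H^m(0,1)$. Let $\mathcal T$ be a quasiuniform family of partitions of $[0,1]$ (the ratios of the cell lengths within a partition are bounded, uniformly over $\mathcal T$). For a partition in $\mathcal T$ let $h$ be its largest cell length, let $S_h\subset C^\mu[0,1]$ be the space of $C^\mu$ functions that are polynomials of degree $\le r-1$ on each cell, let $S_{h,0}=\{\phi\in S_h:\phi(0)=\phi(1)=0\}$, and let $P$, $P_0$ be the $L^2$-projections onto $S_h$, $S_{h,0}$. Assume: 1. There is a constant $C$, independent of the partition, such that for every integer $2\le s\le r$ and every $w\in H^s$ there is $\chi\in S_h$ with $\|w-\chi\|+h\|w'-\chi'\|\le Ch^s\|w^{(s)}\|$ and, if $s\ge 3$, also $\|w-\chi\|_2\le Ch^{s-2}\|w^{(s)}\|$; if moreover $w(0)=w(1)=0$, then there is also such a $\chi$ in $S_{h,0}$. 2. For every integer $s\ge3$ and every $v\in H^s$ there is a constant $C_s(v)$, independent of the partition,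 such that $Pv\in H^3$ and $\|Pv\|_3\le C_s(v)$; if moreover $v(0)=v(1)=0$, then the same holds for $P_0v$. Let $T>0$, and let $(\eta,u)$ be a sufficiently smooth solution on $[0,1]\times[0,T]$ (that is, of class $C^m$ on this rectangle up to its boundary, for some $m$ depending only on $r$ and $\mu$) of the shallow water problem $$\eta_t+u_x+(\eta u)_x=0,\qquad u_t+\eta_x+uu_x=0,\qquad \eta(x,0)=\eta_0(x),\quad u(x,0)=u_0(x),\qquad u(0,t)=u(1,t)=0,$$ with $1+\eta\ge\alpha$ on $[0,1]\times[0,T]$ for some constant $\alpha>0$. For a partition in $\mathcal T$ and an integer $M\ge1$ let $k=T/M$, $\lambda=k/h$, $t^n=nk$, $H^n=P\eta(\cdot,t^n)$, $U^n=P_0u(\cdot,t^n)$. For $0\le n\le M-1$ define the stages of one RK4 step by $V^{n,0}=H^n$, $W^{n,0}=U^n$ and $$V^{n,j}=H^n-ka_jP\Phi^{n,j-1}_x,\qquad W^{n,j}=U^n-ka_jP_0F^{n,j-1}\qquad(j=1,2,3),$$ where $\Phi^{n,j}=W^{n,j}+V^{n,j}W^{n,j}$, $F^{n,j}=V^{n,j}_x+W^{n,j}W^{n,j}_x$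 for $j=0,1,2,3$, with $a_1=a_2=\tfrac12$, $a_3=1$, $b_1=b_4=\tfrac16$, $b_2=b_3=\tfrac13$, and define the local errors $$\delta_1^n=H^{n+1}-H^n+kP\Big[\sum_{j=1}^4b_j\Phi^{n,j-1}\Big]_x,\qquad \delta_2^n=U^{n+1}-U^n+kP_0\Big[\sum_{j=1}^4b_jF^{n,j-1}\Big].$$ **Proposition 3.1.** There is a polynomial $\lambda\mapsto C_\lambda$ with nonnegative coefficients, independent of the partition in $\mathcal T$ and of $M$ (hence of $h$, $k$ and $n$), such that for all partitions in $\mathcal T$ and all $M\ge1$ $$\max_{0\le n\le M-1}\big(\|\delta_1^n\|+\|\delta_2^n\|\big)\le C_\lambda\,k\,(k^4+h^{r-1}).$$ -/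

import Mathlib

/- Functions on `[0,1]` are represented by functions `ℝ → ℝ`; only their values on `[0,1]` matter. -/

open scoped ContDiff

namespace ShallowWater

/-! ### `L²(0,1)` and the Sobolev spaces `H^m(0,1)` -/

/-- `v ∈ L²(0,1)`. -/
def MemL2 (v : ℝ → ℝ) : Prop :=
  MeasureTheory.MemLp v 2 (MeasureTheory.volume.restrict (Set.Icc (0 : ℝ) 1))

/-- The inner product of `L²(0,1)`. -/
noncomputable def l2Inner (v w : ℝ → ℝ) : ℝ := ∫ x in (0 : ℝ)..1, v x * w x

/-- The norm of `L²(0,1)`. -/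
noncomputable def l2Norm (v : ℝ → ℝ) : ℝ := Real.sqrt (l2Inner v v)

/-- `g` is the weak derivative of order `j` of `v` on the open interval `(0,1)`. -/
def IsWeakDeriv (j : ℕ) (v g : ℝ → ℝ) : Prop :=
  ∀ φ : ℝ → ℝ, ContDiff ℝ ∞ φ → HasCompactSupport φ → tsupport φ ⊆ Set.Ioo (0 : ℝ) 1 →
    l2Inner v (iteratedDeriv j φ) = (-1) ^ j * l2Inner g φ

/-- `v ∈ H^m = H^m(0,1)`. -/
def MemH (m : ℕ) (v : ℝ → ℝ) : Prop :=
  MemL2 v ∧ ∀ j ≤ m, ∃ g, MemL2 g ∧ IsWeakDeriv j v g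

open Classical in
/-- The weak derivative `v^{(j)} ∈ L²(0,1)`, which is unique almost everywhere
(and the zero function if there is none in `L²(0,1)`). -/
noncomputable def weakDeriv (j : ℕ) (v : ℝ → ℝ) : ℝ → ℝ :=
  if h : ∃ g, MemL2 g ∧ IsWeakDeriv j v g then h.choose else 0

/-- The norm `‖v‖_m` of `H^m(0,1)`. -/
noncomputable def sobolevNorm (m : ℕ) (v : ℝ → ℝ) : ℝ :=
  Real.sqrt (∑ j ∈ Finset.range (m + 1), l2Norm (weakDeriv j v) ^ 2)

/-- `v` is continuous on `[0,1]` and `v(0) = v(1) = 0`. (Each element of `H^m(0,1)`, `m ≥ 1`, has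
a representative that is continuous on `[0,1]`.) -/
def VanishesAtEnds (v : ℝ → ℝ) : Prop :=
  ContinuousOn v (Set.Icc 0 1) ∧ v 0 = 0 ∧ v 1 = 0

/-- The classical derivative on `[0,1]`, one-sided at the end points. -/
noncomputable def dx (v : ℝ → ℝ) : ℝ → ℝ := fun x => derivWithin v (Set.Icc 0 1) x

/-! ### Partitions and finite element spaces -/

/-- A partition `0 = x_0 < x_1 < ⋯ < x_N = 1` of `[0,1]`. -/
structure Mesh where
  N : ℕ
  node : Fin (N + 1) → ℝ
  strictMono : StrictMono node
  node_zero : node 0 = 0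
  node_last : node (Fin.last N) = 1

/-- The length of the `i`-th cell of the partition. -/
def Mesh.len (τ : Mesh) (i : Fin τ.N) : ℝ := τ.node i.succ - τ.node i.castSucc

/-- The maximal mesh length `h`. -/
noncomputable def Mesh.h (τ : Mesh) : ℝ := ⨆ i, τ.len i

/-- The family `𝒯` of partitions is quasiuniform: the ratios of cell lengths within one partition
are bounded, uniformly over the family. -/
def QuasiUniform (𝒯 : Set Mesh) : Prop :=
  ∃ c : ℝ, ∀ τ ∈ 𝒯, ∀ i j, τ.len i ≤ c * τ.len j

/-- The space `S_h = S_h^{r,μ}` of functions in `C^μ[0,1]` that coincide with a polynomial of degree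
at most `r - 1` on each cell of the partition. As normalization outside of `[0,1]`,
the functions are extended by zero. -/
def Sh (r μ : ℕ) (τ : Mesh) : Submodule ℝ (ℝ → ℝ) where
  carrier := {φ | ContDiffOn ℝ μ φ (Set.Icc 0 1) ∧
    (∀ i : Fin τ.N, ∃ p : Polynomial ℝ, p.degree < r ∧
      ∀ x ∈ Set.Icc (τ.node i.castSucc) (τ.node i.succ), φ x = p.eval x) ∧
    ∀ x ∉ Set.Icc (0 : ℝ) 1, φ x = 0}
  add_mem' := by
    rintro f g ⟨hf, hf', hf0⟩ ⟨hg, hg', hg0⟩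
    refine ⟨hf.add hg, fun i => ?_, fun x hx => by simp [hf0 x hx, hg0 x hx]⟩
    obtain ⟨p, hp, hpf⟩ := hf' i
    obtain ⟨q, hq, hqg⟩ := hg' i
    exact ⟨p + q, (Polynomial.degree_add_le p q).trans_lt (max_lt hp hq),
      fun x hx => by simp [hpf x hx, hqg x hx]⟩
  zero_mem' := ⟨contDiffOn_const, fun i => ⟨0, by simp, by simp⟩, by simp⟩
  smul_mem' := by
    rintro c f ⟨hf, hf', hf0⟩
    refine ⟨hf.const_smul c, fun i => ?_, fun x hx => by simp [hf0 x hx]⟩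
    obtain ⟨p, hp, hpf⟩ := hf' i
    exact ⟨c • p, (Polynomial.degree_smul_le c p).trans_lt hp, fun x hx => by simp [hpf x hx]⟩

/-- The space `S_{h,0}` of the functions in `S_h` that vanish at `0` and `1`. -/
def Sh0 (r μ : ℕ) (τ : Mesh) : Submodule ℝ (ℝ → ℝ) :=
  Sh r μ τ ⊓
    { carrier := {φ | φ 0 = 0 ∧ φ 1 = 0}
      add_mem' := by
        rintro f g ⟨h1, h2⟩ ⟨h3, h4⟩
        exact ⟨by simp [h1, h3], by simp [h2, h4]⟩
      zero_mem' := ⟨rfl, rfl⟩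
      smul_mem' := by
        rintro c f ⟨h1, h2⟩
        exact ⟨by simp [h1], by simp [h2]⟩ }

/-! ### `L²`-projections -/

/-- `w` is the `L²(0,1)`-projection of `v` onto `S`. -/
def IsL2Proj (S : Submodule ℝ (ℝ → ℝ)) (v w : ℝ → ℝ) : Prop :=
  w ∈ S ∧ ∀ φ ∈ S, l2Inner w φ = l2Inner v φ

open Classical in
/-- The `L²(0,1)`-projection operator onto `S`. For `S` one of the spaces `S_h`, `S_{h,0}`
and `v ∈ L²(0,1)` the projection exists and is unique, see `isL2Proj_l2Proj_Sh`,
`isL2Proj_l2Proj_Sh0`, `IsL2Proj.unique`. -/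
noncomputable def l2Proj (S : Submodule ℝ (ℝ → ℝ)) (v : ℝ → ℝ) : ℝ → ℝ :=
  if h : ∃ w, IsL2Proj S v w then h.choose else 0

theorem Mesh.exists_cell (τ : Mesh) {x : ℝ} (hx : x ∈ Set.Icc (0 : ℝ) 1) :
    ∃ i : Fin τ.N, x ∈ Set.Icc (τ.node i.castSucc) (τ.node i.succ) := by
  by_contra! hcon
  have key : ∀ i : Fin (τ.N + 1), τ.node i ≤ x := by
    intro i
    induction i using Fin.induction with
    | zero => rw [τ.node_zero]; exact hx.1
    | succ i ih =>
      by_contra! hlt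
      exact hcon i ⟨ih, hlt.le⟩
  have hN : 0 < τ.N := by
    rcases Nat.eq_zero_or_pos τ.N with h0 | h0
    · exfalso
      have h1 : Fin.last τ.N = 0 := by ext; simp [h0]
      have h2 := τ.node_last
      rw [h1, τ.node_zero] at h2
      exact zero_ne_one h2
    · exact h0
  let i : Fin τ.N := ⟨τ.N - 1, by omega⟩
  have hi : i.succ = Fin.last τ.N := by ext; simp [i]; omega
  refine hcon i ⟨key _, ?_⟩
  rw [hi, τ.node_last]
  exact hx.2

theorem finiteDimensional_Sh (r μ : ℕ) (τ : Mesh) : FiniteDimensional ℝ (Sh r μ τ) := by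
  let pt : Fin τ.N → Fin r → ℝ := fun i j =>
    τ.node i.castSucc + (j : ℝ) / r * (τ.node i.succ - τ.node i.castSucc)
  let E : Sh r μ τ →ₗ[ℝ] (Fin τ.N × Fin r → ℝ) :=
    { toFun := fun φ ij => φ.1 (pt ij.1 ij.2)
      map_add' := fun _ _ => rfl
      map_smul' := fun _ _ => rfl }
  refine FiniteDimensional.of_injective E ?_
  rw [← LinearMap.ker_eq_bot, LinearMap.ker_eq_bot']
  rintro ⟨φ, hφ, hφ', hφ0⟩ hE
  ext x
  by_cases hx : x ∈ Set.Icc (0 : ℝ) 1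
  swap
  · exact hφ0 x hx
  obtain ⟨i, hi⟩ := τ.exists_cell hx
  obtain ⟨p, hp, hpφ⟩ := hφ' i
  have hlen : 0 < τ.node i.succ - τ.node i.castSucc :=
    sub_pos.2 (τ.strictMono (Fin.castSucc_lt_succ))
  have hp0 : p = 0 := by
    refine Polynomial.eq_zero_of_degree_lt_of_eval_index_eq_zero (s := Finset.univ) (v := pt i) ?_
      (by simpa using hp) ?_
    · intro a _ b _ hab
      have hr : (0 : ℝ) < r := by exact_mod_cast a.pos
      have h1 : (a : ℝ) / r = (b : ℝ) / r := by
        have h2 := add_left_cancel hab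
        exact mul_right_cancel₀ hlen.ne' h2
      have h3 : (a : ℝ) = b := by field_simp at h1; exact h1
      exact Fin.ext (by exact_mod_cast h3)
    · intro j _
      have hr : (0 : ℝ) < r := by exact_mod_cast j.pos
      have hj : (j : ℝ) / r ≤ 1 := by
        rw [div_le_one hr]; exact_mod_cast j.2.le
      have hj0 : 0 ≤ (j : ℝ) / r := by positivity
      rw [← hpφ]
      · exact congrFun hE (i, j)
      · constructor
        · simp only [pt]; nlinarith
        · simp only [pt]; nlinarith
  simp [hpφ x hi, hp0]

theorem continuousOn_of_mem_Sh {r μ : ℕ} {τ : Mesh} {φ : ℝ → ℝ} (h : φ ∈ Sh r μ τ) :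
    ContinuousOn φ (Set.Icc 0 1) := h.1.continuousOn

theorem eq_zero_of_l2Inner_self {r μ : ℕ} {τ : Mesh} {φ : ℝ → ℝ} (h : φ ∈ Sh r μ τ)
    (h0 : l2Inner φ φ = 0) : φ = 0 := by
  have hc := continuousOn_of_mem_Sh h
  by_contra hne
  obtain ⟨x, hx⟩ : ∃ x, φ x ≠ 0 := by
    by_contra! hall
    exact hne (funext hall)
  have hx01 : x ∈ Set.Icc (0 : ℝ) 1 := by
    by_contra hn
    exact hx (h.2.2 x hn)
  have := intervalIntegral.integral_pos (f := fun x => φ x * φ x) zero_lt_one (hc.mul hc)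
    (fun y _ => mul_self_nonneg _) ⟨x, hx01, mul_self_pos.2 hx⟩
  exact this.ne' h0

theorem MemL2.intervalIntegrable_mul {v φ : ℝ → ℝ} (hv : MemL2 v)
    (hφ : ContinuousOn φ (Set.Icc 0 1)) :
    IntervalIntegrable (fun x => v x * φ x) MeasureTheory.volume 0 1 := by
  rw [intervalIntegrable_iff_integrableOn_Icc_of_le zero_le_one]
  have h1 : MeasureTheory.IntegrableOn v (Set.Icc 0 1) :=
    MeasureTheory.MemLp.integrable (by norm_num) hv
  exact h1.mul_continuousOn hφ isCompact_Icc

theorem memL2_of_continuousOn {v : ℝ → ℝ} (hv : ContinuousOn v (Set.Icc 0 1)) : MemL2 v := by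
  obtain ⟨c, hc⟩ := isCompact_Icc.exists_bound_of_continuousOn hv
  refine MeasureTheory.MemLp.of_bound (hv.aestronglyMeasurable measurableSet_Icc) c ?_
  exact (MeasureTheory.ae_restrict_iff' measurableSet_Icc).2 (Filter.Eventually.of_forall hc)

theorem exists_isL2Proj {r μ : ℕ} {τ : Mesh} {S : Submodule ℝ (ℝ → ℝ)} (hS : S ≤ Sh r μ τ)
    {v : ℝ → ℝ} (hv : MemL2 v) : ∃ w, IsL2Proj S v w := by
  have hfin := finiteDimensional_Sh r μ τ
  have : FiniteDimensional ℝ S := Submodule.finiteDimensional_of_le hS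
  have hint : ∀ w, MemL2 w → ∀ φ : S,
      IntervalIntegrable (fun x => w x * φ.1 x) MeasureTheory.volume 0 1 :=
    fun w hw φ => hw.intervalIntegrable_mul (continuousOn_of_mem_Sh (hS φ.2))
  have hmem : ∀ φ : S, MemL2 φ.1 := fun φ =>
    memL2_of_continuousOn (continuousOn_of_mem_Sh (hS φ.2))
  let ℓ : ∀ w, MemL2 w → Module.Dual ℝ S := fun w hw =>
    { toFun := fun φ => l2Inner w φ.1
      map_add' := fun φ ψ => by
        simp only [l2Inner, Submodule.coe_add, Pi.add_apply, mul_add]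
        exact intervalIntegral.integral_add (hint w hw φ) (hint w hw ψ)
      map_smul' := fun c φ => by
        simp only [l2Inner, Submodule.coe_smul, Pi.smul_apply, smul_eq_mul, RingHom.id_apply,
          mul_left_comm _ c]
        exact intervalIntegral.integral_const_mul _ _ }
  let B : S →ₗ[ℝ] Module.Dual ℝ S :=
    { toFun := fun φ => ℓ φ.1 (hmem φ)
      map_add' := fun φ ψ => by
        ext χ
        simp only [ℓ, l2Inner, Submodule.coe_add, Pi.add_apply, add_mul, LinearMap.add_apply,
          LinearMap.coe_mk, AddHom.coe_mk]
        exact intervalIntegral.integral_add (hint _ (hmem φ) χ) (hint _ (hmem ψ) χ)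
      map_smul' := fun c φ => by
        ext χ
        simp only [ℓ, l2Inner, Submodule.coe_smul, Pi.smul_apply, smul_eq_mul, RingHom.id_apply,
          mul_assoc, LinearMap.smul_apply, LinearMap.coe_mk, AddHom.coe_mk]
        exact intervalIntegral.integral_const_mul _ _ }
  have hinj : Function.Injective B := by
    rw [← LinearMap.ker_eq_bot, LinearMap.ker_eq_bot']
    intro φ hφ
    have h1 : l2Inner φ.1 φ.1 = 0 := LinearMap.congr_fun hφ φ
    exact Subtype.ext (eq_zero_of_l2Inner_self (hS φ.2) h1)
  have hsurj : Function.Surjective B :=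
    (LinearMap.injective_iff_surjective_of_finrank_eq_finrank
      Subspace.dual_finrank_eq.symm).1 hinj
  obtain ⟨w, hw⟩ := hsurj (ℓ v hv)
  exact ⟨w.1, w.2, fun φ hφ => LinearMap.congr_fun hw ⟨φ, hφ⟩⟩

theorem isL2Proj_l2Proj {r μ : ℕ} {τ : Mesh} {S : Submodule ℝ (ℝ → ℝ)} (hS : S ≤ Sh r μ τ)
    {v : ℝ → ℝ} (hv : MemL2 v) : IsL2Proj S v (l2Proj S v) := by
  have h := exists_isL2Proj hS hv
  rw [l2Proj, dif_pos h]
  exact h.choose_spec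

theorem isL2Proj_l2Proj_Sh (r μ : ℕ) (τ : Mesh) {v : ℝ → ℝ} (hv : MemL2 v) :
    IsL2Proj (Sh r μ τ) v (l2Proj (Sh r μ τ) v) := isL2Proj_l2Proj le_rfl hv

theorem isL2Proj_l2Proj_Sh0 (r μ : ℕ) (τ : Mesh) {v : ℝ → ℝ} (hv : MemL2 v) :
    IsL2Proj (Sh0 r μ τ) v (l2Proj (Sh0 r μ τ) v) := isL2Proj_l2Proj inf_le_left hv

theorem IsL2Proj.unique {r μ : ℕ} {τ : Mesh} {S : Submodule ℝ (ℝ → ℝ)} (hS : S ≤ Sh r μ τ)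
    {v w w' : ℝ → ℝ} (h : IsL2Proj S v w) (h' : IsL2Proj S v w') : w = w' := by
  have hd : w - w' ∈ S := S.sub_mem h.1 h'.1
  have hc := continuousOn_of_mem_Sh (hS hd)
  have h1 := memL2_of_continuousOn (continuousOn_of_mem_Sh (hS h.1))
  have h2 := memL2_of_continuousOn (continuousOn_of_mem_Sh (hS h'.1))
  refine sub_eq_zero.1 (eq_zero_of_l2Inner_self (hS hd) ?_)
  have h3 : l2Inner (w - w') (w - w') = l2Inner w (w - w') - l2Inner w' (w - w') := by
    unfold l2Inner
    rw [← intervalIntegral.integral_sub (h1.intervalIntegrable_mul hc)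
      (h2.intervalIntegrable_mul hc)]
    simp [sub_mul]
  rw [h3, h.2 _ hd, h'.2 _ hd, sub_self]

/-! ### The assumptions on the finite element spaces -/

/-- The approximation estimates for one function `w ∈ H^s` by elements of the space `S`, with
mesh length `h` and constant `C`. -/
def HasApprox (S : Submodule ℝ (ℝ → ℝ)) (h C : ℝ) (s : ℕ) (w : ℝ → ℝ) : Prop :=
  ∃ χ ∈ S, l2Norm (w - χ) + h * l2Norm (weakDeriv 1 (w - χ)) ≤ C * h ^ s * l2Norm (weakDeriv s w) ∧
    (3 ≤ s → sobolevNorm 2 (w - χ) ≤ C * h ^ (s - 2) * l2Norm (weakDeriv s w))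

/-- The approximation property of the spaces `S_h` and `S_{h,0}`, uniformly over the family `𝒯`. -/
def ApproximationProperty (r μ : ℕ) (𝒯 : Set Mesh) : Prop :=
  ∃ C : ℝ, ∀ τ ∈ 𝒯, ∀ s, 2 ≤ s → s ≤ r → ∀ w, MemH s w →
    HasApprox (Sh r μ τ) τ.h C s w ∧ (VanishesAtEnds w → HasApprox (Sh0 r μ τ) τ.h C s w)

/-- For each fixed `v ∈ H^s`, `s ≥ 3`, the projections of `v` are bounded in `H^3`,
uniformly over the family `𝒯`; likewise for the projections onto `S_{h,0}` if `v(0) = v(1) = 0`. -/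
def H3Bounded (r μ : ℕ) (𝒯 : Set Mesh) : Prop :=
  ∀ s, 3 ≤ s → ∀ v, MemH s v →
    (∃ C : ℝ, ∀ τ ∈ 𝒯,
      MemH 3 (l2Proj (Sh r μ τ) v) ∧ sobolevNorm 3 (l2Proj (Sh r μ τ) v) ≤ C) ∧
    (VanishesAtEnds v → ∃ C : ℝ, ∀ τ ∈ 𝒯,
      MemH 3 (l2Proj (Sh0 r μ τ) v) ∧ sobolevNorm 3 (l2Proj (Sh0 r μ τ) v) ≤ C)

/-! ### The shallow water equations -/

/-- `(η, u)`, as functions of `(x, t)`, is a classical solution of class `C^m` on `[0,1] × [0,T]` of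
the initial-boundary-value problem for the shallow water equations with initial values `η₀`, `u₀`. -/
structure IsSolution (m : ℕ) (T : ℝ) (η₀ u₀ : ℝ → ℝ) (η u : ℝ → ℝ → ℝ) : Prop where
  smooth_η : ContDiffOn ℝ m (fun p : ℝ × ℝ => η p.1 p.2) (Set.Icc 0 1 ×ˢ Set.Icc 0 T)
  smooth_u : ContDiffOn ℝ m (fun p : ℝ × ℝ => u p.1 p.2) (Set.Icc 0 1 ×ˢ Set.Icc 0 T)
  mass : ∀ x ∈ Set.Icc (0 : ℝ) 1, ∀ t ∈ Set.Icc 0 T,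
    derivWithin (fun t' => η x t') (Set.Icc 0 T) t + dx (fun x' => u x' t) x
      + dx (fun x' => η x' t * u x' t) x = 0
  momentum : ∀ x ∈ Set.Icc (0 : ℝ) 1, ∀ t ∈ Set.Icc 0 T,
    derivWithin (fun t' => u x t') (Set.Icc 0 T) t + dx (fun x' => η x' t) x
      + u x t * dx (fun x' => u x' t) x = 0
  init_η : ∀ x ∈ Set.Icc (0 : ℝ) 1, η x 0 = η₀ x
  init_u : ∀ x ∈ Set.Icc (0 : ℝ) 1, u x 0 = u₀ x
  boundary : ∀ t ∈ Set.Icc 0 T, u 0 t = 0 ∧ u 1 t = 0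

/-! ### One step of the RK4 scheme and its local errors -/

/-- The coefficients `a_1, a_2, a_3` of the classical fourth-order Runge-Kutta scheme. -/
noncomputable def rkA : ℕ → ℝ
  | 1 => 1 / 2
  | 2 => 1 / 2
  | 3 => 1
  | _ => 0

/-- The coefficients `b_1, b_2, b_3, b_4` of the classical fourth-order Runge-Kutta scheme. -/
noncomputable def rkB : ℕ → ℝ
  | 1 => 1 / 6
  | 2 => 1 / 3
  | 3 => 1 / 3
  | 4 => 1 / 6
  | _ => 0

/-- `Φ = W + V W`. -/
def flux (VW : (ℝ → ℝ) × (ℝ → ℝ)) : ℝ → ℝ := VW.2 + VW.1 * VW.2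

/-- `F = V_x + W W_x`. -/
noncomputable def force (VW : (ℝ → ℝ) × (ℝ → ℝ)) : ℝ → ℝ := dx VW.1 + VW.2 * dx VW.2

/-- The stages `(V^{n,j}, W^{n,j})`, `j = 0, 1, 2, 3`, of one step of size `k` of the scheme, with
starting values `V^{n,0} = H`, `W^{n,0} = U`. -/
noncomputable def stage (r μ : ℕ) (τ : Mesh) (k : ℝ) (H U : ℝ → ℝ) : ℕ → (ℝ → ℝ) × (ℝ → ℝ)
  | 0 => (H, U)
  | j + 1 =>
    (H - (k * rkA (j + 1)) • l2Proj (Sh r μ τ) (dx (flux (stage r μ τ k H U j))),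
      U - (k * rkA (j + 1)) • l2Proj (Sh0 r μ τ) (force (stage r μ τ k H U j)))

/-- `H^n = P η(t^n)`, where `t^n = n k`. -/
noncomputable def projη (r μ : ℕ) (τ : Mesh) (η : ℝ → ℝ → ℝ) (k : ℝ) (n : ℕ) : ℝ → ℝ :=
  l2Proj (Sh r μ τ) (fun x => η x (n * k))

/-- `U^n = P₀ u(t^n)`, where `t^n = n k`. -/
noncomputable def projU (r μ : ℕ) (τ : Mesh) (u : ℝ → ℝ → ℝ) (k : ℝ) (n : ℕ) : ℝ → ℝ :=
  l2Proj (Sh0 r μ τ) (fun x => u x (n * k))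

/-- The local error `δ₁^n`. -/
noncomputable def localError₁ (r μ : ℕ) (τ : Mesh) (η u : ℝ → ℝ → ℝ) (k : ℝ) (n : ℕ) : ℝ → ℝ :=
  projη r μ τ η k (n + 1) - projη r μ τ η k n
    + k • l2Proj (Sh r μ τ) (dx (∑ j ∈ Finset.Icc 1 4,
        rkB j • flux (stage r μ τ k (projη r μ τ η k n) (projU r μ τ u k n) (j - 1))))

/-- The local error `δ₂^n`. -/
noncomputable def localError₂ (r μ : ℕ) (τ : Mesh) (η u : ℝ → ℝ → ℝ) (k : ℝ) (n : ℕ) : ℝ → ℝ :=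
  projU r μ τ u k (n + 1) - projU r μ τ u k n
    + k • l2Proj (Sh0 r μ τ) (∑ j ∈ Finset.Icc 1 4,
        rkB j • force (stage r μ τ k (projη r μ τ η k n) (projU r μ τ u k n) (j - 1)))

end ShallowWater

/-!
The stages `V^j`, `W^j` of the scheme, started from the projections of the exact solution, are
compared with the stages `v^j`, `w^j` of the same Runge-Kutta step without discretization in space
(`exactStage`).

*Space.* Let `E_j` be the `H¹` norm of `(V^j - v^j, W^j - w^j)`. The fluxes are quadratic and `H¹` is
an algebra in one dimension, so the projected fluxes at stage `j` differ in `L²` by `O(E_j + E_j²)`.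
The inverse inequality in `S_h` (`exists_inverse_inequality`; a compactness argument for polynomials
on the unit interval, scaled to the cells of a quasiuniform mesh) turns this into an `H¹` bound at
the price of a factor `h⁻¹`, which combines with the step size `k` to `λ = k / h`. Together with the
approximation error of the projections of `v^{j+1}`, `w^{j+1}` (`h1Norm_l2Proj_sub_le`) this gives
`E_{j+1} ≤ C h^{r-1} + C λ (E_j + E_j²)`, hence `E_j ≤ p_j(λ) h^{r-1}` for polynomials `p_j`
(`stage_error_le`). As the projections are contractions of `L²`, the local errors are bounded by the
consistency error of the step without discretization in space plus `k (E_j + E_j²)`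
(`l2Norm_localError_le`).

*Boundary values.* Approximation in `S_{h,0}` needs `w^j(0) = w^j(1) = 0`. At an end point the
equations and `1 + η > 0` force `u = u_xx = 0` and `η_x = η_xxx = 0` (`TimeDerivatives.parity`): to
third order, `η` is even and `u` is odd there. The flux of the mass equation is then odd and that of
the momentum equation even, so the stages inherit this parity, at the loss of one derivative each
(`parity_exactStage`), and three derivatives are enough for the stages `j ≤ 3`.

*Time.* With `y = (η, u)`, the problem is `y_t = -G(y)_x` with `G` quadratic. The stages are expanded
in powers of `k`, with remainders bounded in `C^n[0,1]` (`Jet`); the coefficients up to `k³` of the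
weighted sum of the fluxes are those of the Taylor expansion of the time derivative
(`TimeDerivatives.jet_sum_flux`), which gives a consistency error `O(k⁵)`
(`exists_consistency_bound`).

All constants must be uniform in `t` and `k`. The objects depending on them are treated as families
of functions on `[0,1]` indexed by `(t, k)`, bounded in `C^n[0,1]` (`Bd`); for the time derivatives of
the solution this bound comes from compactness of the space-time rectangle.
-/

namespace ShallowWater
open Set MeasureTheory

/-! ### The `L²` norm and functions of class `C¹` on `[0,1]` -/

theorem l2Norm_nonneg (f : ℝ → ℝ) : 0 ≤ l2Norm f := Real.sqrt_nonneg _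

theorem l2Norm_sq (f : ℝ → ℝ) : l2Norm f ^ 2 = l2Inner f f :=
  Real.sq_sqrt (intervalIntegral.integral_nonneg zero_le_one fun _ _ => mul_self_nonneg _)

theorem l2Norm_congr_ae {f g : ℝ → ℝ} (h : f =ᵐ[volume.restrict (Icc (0 : ℝ) 1)] g) :
    l2Norm f = l2Norm g := by
  have : l2Inner f f = l2Inner g g := by
    unfold l2Inner
    simp only [intervalIntegral.integral_of_le zero_le_one, ← integral_Icc_eq_integral_Ioc]
    refine integral_congr_ae ?_
    filter_upwards [h] with x hx
    rw [hx]
  rw [l2Norm, l2Norm, this]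

theorem l2Norm_congr {f g : ℝ → ℝ} (h : EqOn f g (Icc 0 1)) : l2Norm f = l2Norm g :=
  l2Norm_congr_ae ((ae_restrict_iff' measurableSet_Icc).2 (Filter.Eventually.of_forall h))

theorem l2Norm_eq_eLpNorm {f : ℝ → ℝ} (hf : MemL2 f) :
    l2Norm f = (eLpNorm f 2 (volume.restrict (Icc (0 : ℝ) 1))).toReal := by
  rw [MemLp.eLpNorm_eq_integral_rpow_norm (by norm_num) (by norm_num) hf,
    ENNReal.toReal_ofReal (by positivity)]
  simp only [ENNReal.toReal_ofNat, Real.rpow_two, Real.norm_eq_abs, sq_abs]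
  rw [l2Norm, Real.sqrt_eq_rpow, l2Inner, intervalIntegral.integral_of_le zero_le_one,
    ← integral_Icc_eq_integral_Ioc]
  simp only [sq, one_div]

theorem l2Norm_add_le {f g : ℝ → ℝ} (hf : MemL2 f) (hg : MemL2 g) :
    l2Norm (f + g) ≤ l2Norm f + l2Norm g := by
  rw [l2Norm_eq_eLpNorm hf, l2Norm_eq_eLpNorm hg, l2Norm_eq_eLpNorm (hf.add hg),
    ← ENNReal.toReal_add hf.eLpNorm_ne_top hg.eLpNorm_ne_top]
  exact ENNReal.toReal_mono (ENNReal.add_ne_top.2 ⟨hf.eLpNorm_ne_top, hg.eLpNorm_ne_top⟩)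
    (eLpNorm_add_le hf.1 hg.1 (by norm_num))

theorem l2Norm_smul (c : ℝ) (f : ℝ → ℝ) : l2Norm (c • f) = |c| * l2Norm f := by
  have : l2Inner (c • f) (c • f) = c ^ 2 * l2Inner f f := by
    unfold l2Inner
    rw [← intervalIntegral.integral_const_mul]
    congr 1; ext x; simp; ring
  rw [l2Norm, this, Real.sqrt_mul (sq_nonneg c), Real.sqrt_sq_eq_abs, l2Norm]

theorem l2Norm_mul_le {f g : ℝ → ℝ} {K : ℝ} (hg : MemL2 g) (hfg : MemL2 (f * g))
    (hf : ∀ x ∈ Icc (0 : ℝ) 1, |f x| ≤ K) : l2Norm (f * g) ≤ K * l2Norm g := by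
  have hK : 0 ≤ K := (abs_nonneg _).trans (hf 0 (by simp))
  rw [l2Norm_eq_eLpNorm hg, l2Norm_eq_eLpNorm hfg]
  have h := eLpNorm_le_mul_eLpNorm_of_ae_le_mul (p := 2) (f := f * g) (g := g) (c := K)
    (μ := volume.restrict (Icc (0 : ℝ) 1))
    ((ae_restrict_iff' measurableSet_Icc).2 (Filter.Eventually.of_forall fun x hx => by
      simp only [Pi.mul_apply, norm_mul]
      exact mul_le_mul_of_nonneg_right (hf x hx) (norm_nonneg _)))
  calc _ ≤ (ENNReal.ofReal K * eLpNorm g 2 (volume.restrict (Icc (0 : ℝ) 1))).toReal :=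
        ENNReal.toReal_mono (ENNReal.mul_ne_top (by simp) hg.eLpNorm_ne_top) h
    _ = _ := by rw [ENNReal.toReal_mul, ENNReal.toReal_ofReal hK]

theorem l2Norm_le_of_abs_le {f : ℝ → ℝ} {K : ℝ} (hf : MemL2 f)
    (h : ∀ x ∈ Icc (0 : ℝ) 1, |f x| ≤ K) : l2Norm f ≤ K := by
  have h1 : l2Norm (1 : ℝ → ℝ) = 1 := by simp [l2Norm, l2Inner]
  have := l2Norm_mul_le (f := f) (g := 1) (K := K) (memL2_of_continuousOn continuousOn_const)
    (by simpa using hf) h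
  simpa [h1] using this

theorem integral_abs_le_l2Norm {f : ℝ → ℝ} (hf : MemL2 f) :
    ∫ x in (0 : ℝ)..1, |f x| ≤ l2Norm f := by
  have hi : Integrable f (volume.restrict (Icc (0 : ℝ) 1)) := MemLp.integrable (by norm_num) hf
  rw [l2Norm_eq_eLpNorm hf, intervalIntegral.integral_of_le zero_le_one,
    ← integral_Icc_eq_integral_Ioc]
  have h1 := eLpNorm_le_eLpNorm_mul_rpow_measure_univ (p := 1) (q := 2) (by norm_num) hf.1
  simp only [Measure.restrict_apply MeasurableSet.univ, univ_inter, Real.volume_Icc, sub_zero,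
    ENNReal.ofReal_one, ENNReal.one_rpow, mul_one] at h1
  have h2 := ENNReal.toReal_mono hf.eLpNorm_ne_top h1
  rw [eLpNorm_one_eq_lintegral_enorm] at h2
  rwa [← integral_norm_eq_lintegral_enorm hi.1] at h2

/-- The norm `‖f‖ + ‖f'‖` of `H¹(0,1)`, for functions that are continuously differentiable on
`[0,1]`, so that the classical derivative can be used. -/
noncomputable def h1Norm (f : ℝ → ℝ) : ℝ := l2Norm f + l2Norm (dx f)

theorem h1Norm_nonneg (f : ℝ → ℝ) : 0 ≤ h1Norm f := add_nonneg (l2Norm_nonneg _) (l2Norm_nonneg _)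

section dx

theorem uniqueDiff : UniqueDiffOn ℝ (Icc (0 : ℝ) 1) := uniqueDiffOn_Icc zero_lt_one

variable {f g : ℝ → ℝ} {x : ℝ}

theorem dx_congr (h : EqOn f g (Icc 0 1)) : EqOn (dx f) (dx g) (Icc 0 1) :=
  fun _ hx => derivWithin_congr h (h hx)

theorem dx_eq {f' : ℝ} (hx : x ∈ Icc (0 : ℝ) 1) (h : HasDerivWithinAt f f' (Icc 0 1) x) :
    dx f x = f' := h.derivWithin (uniqueDiff x hx)

theorem hasDerivWithinAt_dx (hf : DifferentiableOn ℝ f (Icc 0 1)) (hx : x ∈ Icc (0 : ℝ) 1) :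
    HasDerivWithinAt f (dx f x) (Icc 0 1) x := (hf x hx).hasDerivWithinAt

theorem dx_add (hf : DifferentiableOn ℝ f (Icc 0 1)) (hg : DifferentiableOn ℝ g (Icc 0 1))
    (hx : x ∈ Icc (0 : ℝ) 1) : dx (f + g) x = dx f x + dx g x :=
  dx_eq hx ((hasDerivWithinAt_dx hf hx).add (hasDerivWithinAt_dx hg hx))

theorem dx_sub (hf : DifferentiableOn ℝ f (Icc 0 1)) (hg : DifferentiableOn ℝ g (Icc 0 1))
    (hx : x ∈ Icc (0 : ℝ) 1) : dx (f - g) x = dx f x - dx g x :=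
  dx_eq hx ((hasDerivWithinAt_dx hf hx).sub (hasDerivWithinAt_dx hg hx))

theorem dx_smul (c : ℝ) (hf : DifferentiableOn ℝ f (Icc 0 1)) (hx : x ∈ Icc (0 : ℝ) 1) :
    dx (c • f) x = c * dx f x :=
  dx_eq hx ((hasDerivWithinAt_dx hf hx).const_smul c)

theorem dx_mul (hf : DifferentiableOn ℝ f (Icc 0 1)) (hg : DifferentiableOn ℝ g (Icc 0 1))
    (hx : x ∈ Icc (0 : ℝ) 1) : dx (f * g) x = dx f x * g x + f x * dx g x :=
  dx_eq hx ((hasDerivWithinAt_dx hf hx).mul (hasDerivWithinAt_dx hg hx))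

end dx

/-- Continuous differentiability on `[0,1]`. -/
def C1 (f : ℝ → ℝ) : Prop := ContDiffOn ℝ 1 f (Icc 0 1)

theorem C1.diff {f : ℝ → ℝ} (h : C1 f) : DifferentiableOn ℝ f (Icc 0 1) :=
  h.differentiableOn one_ne_zero
theorem C1.cont {f : ℝ → ℝ} (h : C1 f) : ContinuousOn f (Icc 0 1) := h.continuousOn
theorem C1.cont_dx {f : ℝ → ℝ} (h : C1 f) : ContinuousOn (dx f) (Icc 0 1) :=
  h.continuousOn_derivWithin uniqueDiff le_rfl
theorem C1.memL2 {f : ℝ → ℝ} (h : C1 f) : MemL2 f := memL2_of_continuousOn h.cont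
theorem C1.memL2_dx {f : ℝ → ℝ} (h : C1 f) : MemL2 (dx f) := memL2_of_continuousOn h.cont_dx

theorem C1.add {f g : ℝ → ℝ} (hf : C1 f) (hg : C1 g) : C1 (f + g) := ContDiffOn.add hf hg
theorem C1.sub {f g : ℝ → ℝ} (hf : C1 f) (hg : C1 g) : C1 (f - g) := ContDiffOn.sub hf hg
theorem C1.mul {f g : ℝ → ℝ} (hf : C1 f) (hg : C1 g) : C1 (f * g) := ContDiffOn.mul hf hg
theorem C1.smul {f : ℝ → ℝ} (c : ℝ) (hf : C1 f) : C1 (c • f) := ContDiffOn.const_smul c hf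

theorem h1Norm_add_le {f g : ℝ → ℝ} (hf : C1 f) (hg : C1 g) :
    h1Norm (f + g) ≤ h1Norm f + h1Norm g := by
  have h1 := l2Norm_add_le hf.memL2 hg.memL2
  have h2 := l2Norm_add_le hf.memL2_dx hg.memL2_dx
  have h3 : l2Norm (dx (f + g)) = l2Norm (dx f + dx g) :=
    l2Norm_congr fun x hx => dx_add hf.diff hg.diff hx
  unfold h1Norm
  linarith

theorem h1Norm_smul (c : ℝ) {f : ℝ → ℝ} (hf : C1 f) : h1Norm (c • f) = |c| * h1Norm f := by
  have h3 : l2Norm (dx (c • f)) = l2Norm (c • dx f) :=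
    l2Norm_congr fun x hx => dx_smul c hf.diff hx
  rw [h1Norm, h3, l2Norm_smul, l2Norm_smul, h1Norm, mul_add]

/-- The Sobolev inequality `‖f‖_∞ ≤ ‖f‖ + ‖f'‖` on the unit interval. -/
theorem abs_le_h1Norm {f : ℝ → ℝ} (hf : C1 f) {x : ℝ} (hx : x ∈ Icc (0 : ℝ) 1) :
    |f x| ≤ h1Norm f := by
  have hci : ∀ {g : ℝ → ℝ}, ContinuousOn g (Icc 0 1) → IntervalIntegrable g volume 0 1 :=
    fun hg => (by simpa [uIcc_of_le zero_le_one] using hg :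
      ContinuousOn _ (uIcc (0 : ℝ) 1)).intervalIntegrable
  have key : ∀ y ∈ Icc (0 : ℝ) 1, |f x| ≤ |f y| + ∫ s in (0 : ℝ)..1, |dx f s| := by
    intro y hy
    have hsub : uIcc y x ⊆ Icc (0 : ℝ) 1 := by
      rw [← uIcc_of_le zero_le_one] at *
      exact uIcc_subset_uIcc hy hx
    have hftc : ∫ s in y..x, dx f s = f x - f y := by
      refine intervalIntegral.integral_eq_sub_of_hasDeriv_right (hf.cont.mono hsub) ?_
        (hf.cont_dx.mono hsub).intervalIntegrable
      intro s hs
      have h0 : 0 < s := (le_min hy.1 hx.1).trans_lt hs.1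
      have h1 : s < 1 := hs.2.trans_le (max_le hy.2 hx.2)
      exact ((hasDerivWithinAt_dx hf.diff ⟨h0.le, h1.le⟩).hasDerivAt
        (Icc_mem_nhds h0 h1)).hasDerivWithinAt
    have h2 : |∫ s in y..x, dx f s| ≤ ∫ s in (0 : ℝ)..1, |dx f s| := by
      have h3 := intervalIntegral.norm_integral_le_abs_integral_norm
        (f := dx f) (a := y) (b := x) (μ := volume)
      have h4 := intervalIntegral.abs_integral_mono_interval (f := fun s => |dx f s|) (a := y)
        (b := x) (c := 0) (d := 1) (μ := volume)
        (by
          rw [uIoc, uIoc_of_le zero_le_one]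
          exact Ioc_subset_Ioc (le_min hy.1 hx.1) (max_le hy.2 hx.2))
        (Filter.Eventually.of_forall fun _ => abs_nonneg _) (hci hf.cont_dx.abs)
      rw [abs_of_nonneg (a := ∫ s in (0 : ℝ)..1, |dx f s|)
        (intervalIntegral.integral_nonneg zero_le_one fun _ _ => abs_nonneg _)] at h4
      exact h3.trans h4
    have h3 : f x = f y + ∫ s in y..x, dx f s := by rw [hftc]; ring
    rw [h3]
    exact (abs_add_le _ _).trans (by linarith)
  have h1 : ∫ y in (0 : ℝ)..1, |f x| ≤ ∫ y in (0 : ℝ)..1, (|f y| + ∫ s in (0 : ℝ)..1, |dx f s|) :=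
    intervalIntegral.integral_mono_on zero_le_one (by simp)
      ((hci hf.cont.abs).add (by simp)) key
  rw [intervalIntegral.integral_add (hci hf.cont.abs) (by simp)] at h1
  simp only [intervalIntegral.integral_const, sub_zero, one_smul] at h1
  have h2 := integral_abs_le_l2Norm hf.memL2
  have h3 := integral_abs_le_l2Norm hf.memL2_dx
  unfold h1Norm
  linarith

/-! ### Weak derivatives of smooth functions -/

/-- Weak derivatives in `L²` are unique almost everywhere. -/
theorem IsWeakDeriv.ae_unique {j : ℕ} {v g₁ g₂ : ℝ → ℝ} (h₁ : IsWeakDeriv j v g₁)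
    (h₂ : IsWeakDeriv j v g₂) (hg₁ : MemL2 g₁) (hg₂ : MemL2 g₂) :
    g₁ =ᵐ[volume.restrict (Icc (0 : ℝ) 1)] g₂ := by
  have hint : ∀ {g : ℝ → ℝ}, MemL2 g → Integrable g (volume.restrict (Icc (0 : ℝ) 1)) :=
    fun hg => MemLp.integrable (by norm_num) hg
  have key := isOpen_Ioo.ae_eq_zero_of_integral_contDiff_smul_eq_zero (U := Ioo (0 : ℝ) 1)
    (f := g₁ - g₂) (μ := volume.restrict (Icc (0 : ℝ) 1))
    ((hint (hg₁.sub hg₂)).locallyIntegrable.locallyIntegrableOn _) (by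
      intro φ hφ hc hs
      have h := (h₁ φ hφ hc hs).symm.trans (h₂ φ hφ hc hs)
      have h' := mul_left_cancel₀ (pow_ne_zero j (by norm_num)) h
      have hcφ : ContinuousOn φ (Icc 0 1) := hφ.continuous.continuousOn
      rw [l2Inner, l2Inner, ← sub_eq_zero, ← intervalIntegral.integral_sub
        (hg₁.intervalIntegrable_mul hcφ) (hg₂.intervalIntegrable_mul hcφ),
        intervalIntegral.integral_of_le zero_le_one, ← integral_Icc_eq_integral_Ioc] at h'
      refine Eq.trans ?_ h'
      refine integral_congr_ae (Filter.Eventually.of_forall fun x => ?_)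
      change φ x * (g₁ x - g₂ x) = g₁ x * φ x - g₂ x * φ x
      ring)
  have hmem : ∀ᵐ x ∂(volume.restrict (Icc (0 : ℝ) 1)), x ∈ Ioo (0 : ℝ) 1 := by
    rw [← Measure.restrict_congr_set (Ioo_ae_eq_Icc (a := (0 : ℝ)) (b := 1) (μ := volume))]
    exact ae_restrict_mem measurableSet_Ioo
  filter_upwards [key, hmem] with x hx hx'
  exact sub_eq_zero.1 (hx hx')

theorem isWeakDeriv_iterate_dx {f : ℝ → ℝ} {j : ℕ} (hf : ∀ i < j, C1 (dx^[i] f)) :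
    IsWeakDeriv j f (dx^[j] f) := by
  induction j with
  | zero => intro φ _ _ _; simp
  | succ j ih =>
    intro φ hφ hc hs
    have hφ' : ContDiff ℝ ∞ (deriv φ) := (contDiff_infty_iff_deriv.1 hφ).2
    have h := ih (fun i hi => hf i (by omega)) (deriv φ) hφ' hc.deriv
      (tsupport_deriv_subset.trans hs)
    have hzero : ∀ x ∉ Ioo (0 : ℝ) 1, φ x = 0 := fun x hx =>
      image_eq_zero_of_notMem_tsupport fun hx' => hx (hs hx')
    have hg := hf j (by omega)
    have hib := intervalIntegral.integral_mul_deriv_eq_deriv_mul_of_hasDerivWithinAt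
      (a := 0) (b := 1) (u := dx^[j] f) (u' := dx (dx^[j] f)) (v := φ) (v' := deriv φ)
      (fun x hx => by
        rw [uIcc_of_le zero_le_one] at hx ⊢
        exact hasDerivWithinAt_dx hg.diff hx)
      (fun x _ => ((hφ.differentiable (by simp)) x).hasDerivAt.hasDerivWithinAt)
      (by
        apply ContinuousOn.intervalIntegrable
        rw [uIcc_of_le zero_le_one]
        exact hg.cont_dx)
      (hφ'.continuous.intervalIntegrable _ _)
    rw [hzero 0 (by simp), hzero 1 (by simp)] at hib
    rw [iteratedDeriv_succ', h, Function.iterate_succ_apply', l2Inner, hib, l2Inner, pow_succ]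
    ring

theorem l2Norm_weakDeriv {f : ℝ → ℝ} {j : ℕ} (hf : ∀ i < j, C1 (dx^[i] f))
    (hL : MemL2 (dx^[j] f)) : l2Norm (weakDeriv j f) = l2Norm (dx^[j] f) := by
  have hw := isWeakDeriv_iterate_dx hf
  have hex : ∃ g, MemL2 g ∧ IsWeakDeriv j f g := ⟨_, hL, hw⟩
  rw [weakDeriv, dif_pos hex]
  exact l2Norm_congr_ae (hex.choose_spec.2.ae_unique hw hex.choose_spec.1 hL)

theorem l2Norm_weakDeriv_one {f : ℝ → ℝ} (hf : C1 f) : l2Norm (weakDeriv 1 f) = l2Norm (dx f) :=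
  l2Norm_weakDeriv (j := 1) (fun i hi => by simpa [Nat.lt_one_iff.1 hi] using hf) hf.memL2_dx

/-! ### Uniform bounds on the derivatives of a function -/

/-- `f` is `n` times continuously differentiable on `[0,1]`, and `f, f', …, f^{(n)}` are bounded by
`K` there. -/
def CBound : ℕ → ℝ → (ℝ → ℝ) → Prop
  | 0, K, f => ContinuousOn f (Icc 0 1) ∧ ∀ x ∈ Icc (0 : ℝ) 1, |f x| ≤ K
  | n + 1, K, f => DifferentiableOn ℝ f (Icc 0 1) ∧ (∀ x ∈ Icc (0 : ℝ) 1, |f x| ≤ K) ∧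
      CBound n K (dx f)

namespace CBound
variable {n : ℕ} {K L : ℝ} {f g : ℝ → ℝ}

theorem abs_le (h : CBound n K f) : ∀ x ∈ Icc (0 : ℝ) 1, |f x| ≤ K := by
  cases n with
  | zero => exact h.2
  | succ n => exact h.2.1

theorem continuousOn (h : CBound n K f) : ContinuousOn f (Icc 0 1) := by
  cases n with
  | zero => exact h.1
  | succ n => exact h.1.continuousOn

theorem nonneg (h : CBound n K f) : 0 ≤ K := (abs_nonneg _).trans (h.abs_le 0 (by simp))

theorem diff (h : CBound (n + 1) K f) : DifferentiableOn ℝ f (Icc 0 1) := h.1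

theorem dx (h : CBound (n + 1) K f) : CBound n K (dx f) := h.2.2

theorem c1 (h : CBound (n + 1) K f) : C1 f :=
  (contDiffOn_succ_iff_derivWithin (n := 0) uniqueDiff).2
    ⟨h.1, by simp, contDiffOn_zero.2 h.dx.continuousOn⟩

theorem mono_right (h : CBound n K f) (hKL : K ≤ L) : CBound n L f := by
  induction n generalizing f with
  | zero => exact ⟨h.1, fun x hx => (h.2 x hx).trans hKL⟩
  | succ n ih => exact ⟨h.1, fun x hx => (h.2.1 x hx).trans hKL, ih h.2.2⟩

theorem of_succ (h : CBound (n + 1) K f) : CBound n K f := by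
  induction n generalizing f with
  | zero => exact ⟨h.continuousOn, h.abs_le⟩
  | succ n ih => exact ⟨h.1, h.2.1, ih h.2.2⟩

theorem of_le {m : ℕ} (h : CBound n K f) (hm : m ≤ n) : CBound m K f := by
  induction n, hm using Nat.le_induction with
  | base => exact h
  | succ n _ ih => exact ih h.of_succ

theorem congr (h : CBound n K f) (hfg : EqOn f g (Icc 0 1)) : CBound n K g := by
  induction n generalizing f g with
  | zero => exact ⟨h.1.congr hfg.symm, fun x hx => hfg hx ▸ h.2 x hx⟩
  | succ n ih =>
    exact ⟨h.1.congr hfg.symm, fun x hx => hfg hx ▸ h.2.1 x hx, ih h.2.2 (dx_congr hfg)⟩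

theorem add (hf : CBound n K f) (hg : CBound n L g) : CBound n (K + L) (f + g) := by
  have hb : ∀ x ∈ Icc (0 : ℝ) 1, |(f + g) x| ≤ K + L := fun x hx =>
    (abs_add_le _ _).trans (add_le_add (hf.abs_le x hx) (hg.abs_le x hx))
  induction n generalizing f g with
  | zero => exact ⟨hf.1.add hg.1, hb⟩
  | succ n ih =>
    refine ⟨hf.1.add hg.1, hb, ?_⟩
    refine (ih hf.dx hg.dx fun x hx =>
      (abs_add_le _ _).trans (add_le_add (hf.dx.abs_le x hx) (hg.dx.abs_le x hx))).congr ?_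
    exact fun x hx => (dx_add hf.1 hg.1 hx).symm

theorem const_smul {c : ℝ} (hf : CBound n K f) (hc : |c| ≤ L) : CBound n (L * K) (c • f) := by
  have hL : 0 ≤ L := (abs_nonneg _).trans hc
  have hb : ∀ {f : ℝ → ℝ} {n : ℕ}, CBound n K f → ∀ x ∈ Icc (0 : ℝ) 1, |(c • f) x| ≤ L * K :=
    fun hf x hx => by
      simp only [Pi.smul_apply, smul_eq_mul, abs_mul]
      exact mul_le_mul hc (hf.abs_le x hx) (abs_nonneg _) hL
  induction n generalizing f with
  | zero => exact ⟨hf.1.const_smul c, hb hf⟩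
  | succ n ih =>
    exact ⟨hf.1.const_smul c, hb hf, (ih hf.dx).congr fun x hx => (dx_smul c hf.1 hx).symm⟩

/-- A Leibniz estimate; the constant is not sharp. -/
theorem mul (hf : CBound n K f) (hg : CBound n L g) : CBound n (2 ^ n * (K * L)) (f * g) := by
  have hKL : 0 ≤ K * L := mul_nonneg hf.nonneg hg.nonneg
  have hb : ∀ x ∈ Icc (0 : ℝ) 1, |(f * g) x| ≤ K * L := fun x hx => by
    simp only [Pi.mul_apply, abs_mul]
    exact mul_le_mul (hf.abs_le x hx) (hg.abs_le x hx) (abs_nonneg _) hf.nonneg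
  induction n generalizing f g with
  | zero => exact ⟨hf.1.mul hg.1, by simpa using hb⟩
  | succ n ih =>
    refine ⟨hf.1.mul hg.1, fun x hx => (hb x hx).trans
      (le_mul_of_one_le_left hKL (one_le_pow₀ (by norm_num))), ?_⟩
    have hb' : ∀ {f g : ℝ → ℝ}, CBound n K f → CBound n L g →
        ∀ x ∈ Icc (0 : ℝ) 1, |(f * g) x| ≤ K * L := fun hf hg x hx => by
      simp only [Pi.mul_apply, abs_mul]
      exact mul_le_mul (hf.abs_le x hx) (hg.abs_le x hx) (abs_nonneg _) hf.nonneg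
    have h := (ih hf.dx hg.of_succ (hb' hf.dx hg.of_succ)).add
      (ih hf.of_succ hg.dx (hb' hf.of_succ hg.dx))
    refine (h.mono_right (by rw [pow_succ]; linarith)).congr fun x hx => ?_
    exact (dx_mul hf.1 hg.1 hx).symm

theorem iterate_dx {i : ℕ} (h : CBound (n + i) K f) : CBound n K (ShallowWater.dx^[i] f) := by
  induction i generalizing f with
  | zero => exact h
  | succ i ih => exact ih h.dx

theorem memH (h : CBound n K f) : MemH n f := by
  refine ⟨memL2_of_continuousOn h.continuousOn, fun j hj => ⟨ShallowWater.dx^[j] f, ?_, ?_⟩⟩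
  · exact memL2_of_continuousOn (iterate_dx (n := 0) (h.of_le (by omega))).continuousOn
  · exact isWeakDeriv_iterate_dx fun i hi => (iterate_dx (n := 0 + 1) (h.of_le (by omega))).c1

theorem l2Norm_weakDeriv_le (h : CBound n K f) : l2Norm (weakDeriv n f) ≤ K := by
  have hn : CBound 0 K (ShallowWater.dx^[n] f) := iterate_dx (h.of_le (by omega))
  rw [l2Norm_weakDeriv (fun i hi => (iterate_dx (n := 0 + 1) (h.of_le (by omega))).c1)
    (memL2_of_continuousOn hn.continuousOn)]
  exact l2Norm_le_of_abs_le (memL2_of_continuousOn hn.continuousOn) hn.abs_le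

end CBound

/-! ### The inverse inequality -/

/-- On polynomials of degree less than `r`, differentiation is bounded in `L²(0,1)`: this follows
from compactness of the unit sphere in the space of coefficients. -/
theorem exists_integral_derivative_sq_le (r : ℕ) :
    ∃ K : ℝ, 0 ≤ K ∧ ∀ p : Polynomial ℝ, p.degree < r →
      ∫ x in (0 : ℝ)..1, p.derivative.eval x ^ 2 ≤ K * ∫ x in (0 : ℝ)..1, p.eval x ^ 2 := by
  let P : (Fin r → ℝ) → Polynomial ℝ := fun c => ∑ i, Polynomial.C (c i) * Polynomial.X ^ (i : ℕ)
  have hPsmul : ∀ (a : ℝ) c, P (a • c) = Polynomial.C a * P c := fun a c => by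
    simp only [P, Pi.smul_apply, smul_eq_mul, map_mul, Finset.mul_sum, mul_assoc]
  have hPcoeff : ∀ c (i : Fin r), (P c).coeff i = c i := fun c i => by
    simp [P, Polynomial.coeff_X_pow, Fin.val_inj]
  let q : (Fin r → ℝ) → ℝ := fun c => ∫ x in (0 : ℝ)..1, (P c).eval x ^ 2
  let d : (Fin r → ℝ) → ℝ := fun c => ∫ x in (0 : ℝ)..1, (P c).derivative.eval x ^ 2
  have hq : Continuous q := by
    refine intervalIntegral.continuous_parametric_intervalIntegral_of_continuous' ?_ _ _
    simp only [Function.uncurry_def, P, Polynomial.eval_finsetSum, Polynomial.eval_mul,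
      Polynomial.eval_C, Polynomial.eval_pow, Polynomial.eval_X]
    fun_prop
  have hd : Continuous d := by
    refine intervalIntegral.continuous_parametric_intervalIntegral_of_continuous' ?_ _ _
    simp only [Function.uncurry_def, P, Polynomial.derivative_sum, Polynomial.eval_finsetSum,
      Polynomial.derivative_C_mul, Polynomial.derivative_X_pow, Polynomial.eval_mul,
      Polynomial.eval_C, Polynomial.eval_pow, Polynomial.eval_X]
    fun_prop
  have hqpos : ∀ c, c ≠ 0 → 0 < q c := by
    intro c hc
    have hP : P c ≠ 0 := fun h => hc (funext fun i => by rw [← hPcoeff c i, h]; simp)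
    obtain ⟨x, hx, hx0⟩ : ∃ x ∈ Icc (0 : ℝ) 1, (P c).eval x ≠ 0 := by
      by_contra! hcon
      exact hP (Polynomial.eq_zero_of_infinite_isRoot _
        ((Icc_infinite (zero_lt_one (α := ℝ))).mono fun x hx => hcon x hx))
    exact intervalIntegral.integral_pos zero_lt_one (by fun_prop) (fun y _ => sq_nonneg _)
      ⟨x, hx, by positivity⟩
  obtain ⟨K, hK⟩ := (isCompact_sphere (0 : Fin r → ℝ) 1).exists_bound_of_continuousOn
    (f := fun c => d c / q c) (hd.continuousOn.div hq.continuousOn fun c hc =>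
      (hqpos c (Metric.ne_of_mem_sphere hc one_ne_zero)).ne')
  refine ⟨|K|, abs_nonneg _, fun p hp => ?_⟩
  rcases eq_or_ne p 0 with rfl | hp0
  · simp
  have hpP : p = P (fun i => p.coeff i) := by
    conv_lhs => rw [p.as_sum_range' r ((Polynomial.natDegree_lt_iff_degree_lt hp0).2 hp),
      Finset.sum_range]
    simp [P, Polynomial.C_mul_X_pow_eq_monomial]
  rw [hpP]
  set c : Fin r → ℝ := fun i => p.coeff i
  have hc : c ≠ 0 := fun h => hp0 (by rw [hpP, h]; simp [P])
  have hc' : ‖c‖ ≠ 0 := norm_ne_zero_iff.2 hc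
  set e : Fin r → ℝ := ‖c‖⁻¹ • c
  have he : e ∈ Metric.sphere (0 : Fin r → ℝ) 1 := by
    simp [e, norm_smul, inv_mul_cancel₀ hc']
  have hce : c = ‖c‖ • e := by simp [e, smul_smul, mul_inv_cancel₀ hc']
  have h1 : d e ≤ |K| * q e := by
    have h2 := ((le_abs_self _).trans (hK e he)).trans (le_abs_self K)
    rwa [div_le_iff₀ (hqpos e (Metric.ne_of_mem_sphere he one_ne_zero))] at h2
  rw [hce, hPsmul]
  simp only [Polynomial.derivative_C_mul, Polynomial.eval_mul, Polynomial.eval_C, mul_pow,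
    intervalIntegral.integral_const_mul]
  calc _ ≤ ‖c‖ ^ 2 * (|K| * q e) := mul_le_mul_of_nonneg_left h1 (sq_nonneg _)
    _ = _ := by ring

/-- The scaled version on an interval of length `b - a`. -/
theorem exists_integral_derivative_sq_le_div (r : ℕ) :
    ∃ K : ℝ, 0 ≤ K ∧ ∀ p : Polynomial ℝ, p.degree < r → ∀ a b : ℝ, a < b →
      ∫ x in a..b, p.derivative.eval x ^ 2 ≤ K / (b - a) ^ 2 * ∫ x in a..b, p.eval x ^ 2 := by
  obtain ⟨K, hK0, hK⟩ := exists_integral_derivative_sq_le r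
  refine ⟨K, hK0, fun p hp a b hab => ?_⟩
  have hL : 0 < b - a := sub_pos.2 hab
  set q : Polynomial ℝ := p.comp (Polynomial.C (b - a) * Polynomial.X + Polynomial.C a)
  have hq : q.degree < r := by
    rcases eq_or_ne p 0 with rfl | hp0
    · simp [q]
    have h1 : q.natDegree ≤ p.natDegree := by
      have := Polynomial.natDegree_comp_le (p := p)
        (q := Polynomial.C (b - a) * Polynomial.X + Polynomial.C a)
      rwa [Polynomial.natDegree_linear hL.ne', mul_one] at this
    exact Polynomial.degree_le_natDegree.trans_lt
      (by exact_mod_cast h1.trans_lt ((Polynomial.natDegree_lt_iff_degree_lt hp0).2 hp))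
  have h := hK q hq
  have e1 : ∫ x in (0 : ℝ)..1, q.eval x ^ 2 = (b - a)⁻¹ * ∫ x in a..b, p.eval x ^ 2 := by
    have := intervalIntegral.integral_comp_mul_add (a := 0) (b := 1) (fun x => p.eval x ^ 2)
      hL.ne' a
    simpa [q] using this
  have e2 : ∫ x in (0 : ℝ)..1, q.derivative.eval x ^ 2
      = (b - a) * ∫ x in a..b, p.derivative.eval x ^ 2 := by
    have := intervalIntegral.integral_comp_mul_add (a := 0) (b := 1)
      (fun x => p.derivative.eval x ^ 2) hL.ne' a
    simp only [q, Polynomial.derivative_comp, Polynomial.eval_mul, Polynomial.eval_comp, mul_pow]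
    simp only [Polynomial.derivative_add, Polynomial.derivative_C_mul, Polynomial.derivative_X,
      Polynomial.derivative_C, Polynomial.eval_add, Polynomial.eval_mul, Polynomial.eval_C,
      Polynomial.eval_X, mul_one, add_zero,
      intervalIntegral.integral_const_mul]
    rw [this]
    simp only [smul_eq_mul, mul_zero, zero_add, mul_one, sub_add_cancel]
    field_simp
  rw [e1, e2] at h
  rw [div_mul_eq_mul_div, le_div_iff₀ (by positivity)]
  have h' := mul_le_mul_of_nonneg_left h hL.le
  calc _ = (b - a) * ((b - a) * ∫ x in a..b, p.derivative.eval x ^ 2) := by ring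
    _ ≤ _ := h'
    _ = _ := by field_simp

namespace Mesh
variable (τ : Mesh)

theorem N_pos : 0 < τ.N := by
  obtain ⟨i, -⟩ := τ.exists_cell (x := 0) (by simp)
  exact i.pos

theorem len_pos (i : Fin τ.N) : 0 < τ.len i := sub_pos.2 (τ.strictMono Fin.castSucc_lt_succ)

theorem node_mem (i : Fin (τ.N + 1)) : τ.node i ∈ Icc (0 : ℝ) 1 :=
  ⟨τ.node_zero ▸ τ.strictMono.monotone (Fin.zero_le i),
    τ.node_last ▸ τ.strictMono.monotone (Fin.le_last i)⟩

theorem len_le_h (i : Fin τ.N) : τ.len i ≤ τ.h := le_ciSup (Finite.bddAbove_range _) i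

theorem h_pos : 0 < τ.h := (τ.len_pos ⟨0, τ.N_pos⟩).trans_le (τ.len_le_h _)

theorem h_le_one : τ.h ≤ 1 := by
  have : Nonempty (Fin τ.N) := ⟨⟨0, τ.N_pos⟩⟩
  refine ciSup_le fun i => ?_
  have h1 := (τ.node_mem i.castSucc).1
  have h2 := (τ.node_mem i.succ).2
  unfold Mesh.len
  linarith

theorem cell_subset (i : Fin τ.N) : Icc (τ.node i.castSucc) (τ.node i.succ) ⊆ Icc 0 1 :=
  Icc_subset_Icc (τ.node_mem _).1 (τ.node_mem _).2

theorem integral_eq_sum {f : ℝ → ℝ} (hf : ContinuousOn f (Icc 0 1)) :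
    ∫ x in (0 : ℝ)..1, f x = ∑ i : Fin τ.N, ∫ x in τ.node i.castSucc..τ.node i.succ, f x := by
  let a : ℕ → ℝ := fun k => if hk : k < τ.N + 1 then τ.node ⟨k, hk⟩ else 0
  have ha : ∀ k (hk : k < τ.N + 1), a k = τ.node ⟨k, hk⟩ := fun k hk => by simp only [a, dif_pos hk]
  have h := intervalIntegral.sum_integral_adjacent_intervals (f := f) (μ := volume) (a := a)
    (n := τ.N) (fun k hk => by
      rw [ha k (by omega), ha (k + 1) (by omega)]
      apply ContinuousOn.intervalIntegrable
      refine hf.mono ?_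
      rw [← uIcc_of_le zero_le_one]
      refine uIcc_subset_uIcc ?_ ?_ <;> rw [uIcc_of_le zero_le_one] <;> exact τ.node_mem _)
  rw [ha 0 (by omega), ha τ.N (by omega)] at h
  have h0 : τ.node ⟨0, by omega⟩ = 0 := τ.node_zero
  have h1 : τ.node ⟨τ.N, by omega⟩ = 1 := τ.node_last
  rw [h0, h1] at h
  rw [← h, Finset.sum_range]
  refine Finset.sum_congr rfl fun i _ => ?_
  rw [ha i (by omega), ha (i + 1) (by omega)]
  rfl

end Mesh

theorem C1.of_mem_Sh {r μ : ℕ} {τ : Mesh} {φ : ℝ → ℝ} (hμ : 1 ≤ μ) (h : φ ∈ Sh r μ τ) : C1 φ :=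
  h.1.of_le (by exact_mod_cast hμ)

/-- The inverse inequality `‖φ'‖ ≤ K h⁻¹ ‖φ‖` on the spaces `S_h`, uniformly over a quasiuniform
family of partitions. -/
theorem exists_inverse_inequality (r : ℕ) {μ : ℕ} (hμ : 1 ≤ μ) {𝒯 : Set Mesh}
    (h𝒯 : QuasiUniform 𝒯) :
    ∃ K : ℝ, 0 ≤ K ∧ ∀ τ ∈ 𝒯, ∀ φ ∈ Sh r μ τ, l2Norm (dx φ) ≤ K / τ.h * l2Norm φ := by
  obtain ⟨K, hK0, hK⟩ := exists_integral_derivative_sq_le_div r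
  obtain ⟨c, hc⟩ := h𝒯
  refine ⟨Real.sqrt K * |c|, by positivity, fun τ hτ φ hφ => ?_⟩
  have hC1 := C1.of_mem_Sh hμ hφ
  have hh := τ.h_pos
  refine abs_le_of_sq_le_sq' ?_ (mul_nonneg (by positivity) (l2Norm_nonneg _)) |>.2
  have i1 := τ.integral_eq_sum (hC1.cont_dx.mul hC1.cont_dx)
  have i2 := τ.integral_eq_sum (hC1.cont.mul hC1.cont)
  simp only [Pi.mul_apply] at i1 i2
  rw [mul_pow, div_pow, mul_pow, sq_abs, Real.sq_sqrt hK0, l2Norm_sq, l2Norm_sq, l2Inner, l2Inner,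
    i1, i2, Finset.mul_sum]
  refine Finset.sum_le_sum fun i _ => ?_
  obtain ⟨p, hp, hpφ⟩ := hφ.2.1 i
  have hlt : τ.node i.castSucc < τ.node i.succ := τ.strictMono Fin.castSucc_lt_succ
  have hdp : ∀ x ∈ Icc (τ.node i.castSucc) (τ.node i.succ), dx φ x = p.derivative.eval x := by
    intro x hx
    have h1 := (hasDerivWithinAt_dx hC1.diff (τ.cell_subset i hx)).mono (τ.cell_subset i)
    have h2 := (p.hasDerivAt x).hasDerivWithinAt.congr hpφ (hpφ x hx)
    exact (uniqueDiffOn_Icc hlt x hx).eq_deriv _ h1 h2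
  have e1 : ∫ x in τ.node i.castSucc..τ.node i.succ, dx φ x * dx φ x
      = ∫ x in τ.node i.castSucc..τ.node i.succ, p.derivative.eval x ^ 2 :=
    intervalIntegral.integral_congr fun x hx => by
      rw [uIcc_of_le hlt.le] at hx
      simp only [hdp x hx, sq]
  have e2 : ∫ x in τ.node i.castSucc..τ.node i.succ, φ x * φ x
      = ∫ x in τ.node i.castSucc..τ.node i.succ, p.eval x ^ 2 :=
    intervalIntegral.integral_congr fun x hx => by
      rw [uIcc_of_le hlt.le] at hx
      simp only [hpφ x hx, sq]
  rw [e1, e2]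
  refine (hK p hp _ _ hlt).trans (mul_le_mul_of_nonneg_right ?_
    (intervalIntegral.integral_nonneg hlt.le fun _ _ => sq_nonneg _))
  have hlen : 0 < τ.len i := τ.len_pos i
  have : Nonempty (Fin τ.N) := ⟨i⟩
  have hhc : τ.h ≤ c * τ.len i := ciSup_le fun j => hc τ hτ j i
  have hsq : τ.h ^ 2 ≤ c ^ 2 * τ.len i ^ 2 := by
    rw [← mul_pow]; exact pow_le_pow_left₀ hh.le hhc 2
  change K / τ.len i ^ 2 ≤ _
  rw [div_le_div_iff₀ (by positivity) (by positivity)]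
  calc K * τ.h ^ 2 ≤ K * (c ^ 2 * τ.len i ^ 2) := mul_le_mul_of_nonneg_left hsq hK0
    _ = _ := by ring

/-! ### `L²`-projections -/

section proj
variable {r μ : ℕ} {τ : Mesh} {S : Submodule ℝ (ℝ → ℝ)} {f g : ℝ → ℝ}

theorem l2Proj_mem (hS : S ≤ Sh r μ τ) (hf : MemL2 f) : l2Proj S f ∈ S :=
  (isL2Proj_l2Proj hS hf).1

theorem l2Proj_eq (hS : S ≤ Sh r μ τ) (hf : MemL2 f) (h : IsL2Proj S f g) : l2Proj S f = g :=
  (isL2Proj_l2Proj hS hf).unique hS h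

theorem l2Proj_of_mem (hS : S ≤ Sh r μ τ) (hf : f ∈ S) : l2Proj S f = f :=
  l2Proj_eq hS (memL2_of_continuousOn (continuousOn_of_mem_Sh (hS hf))) ⟨hf, fun _ _ => rfl⟩

theorem l2Proj_congr (h : EqOn f g (Icc 0 1)) : l2Proj S f = l2Proj S g := by
  have : IsL2Proj S f = IsL2Proj S g := by
    ext w
    have : ∀ φ, l2Inner f φ = l2Inner g φ := fun φ => intervalIntegral.integral_congr fun x hx => by
      rw [uIcc_of_le zero_le_one] at hx
      simp only [h hx]
    simp only [IsL2Proj, this]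
  have key : ∀ P Q : (ℝ → ℝ) → Prop, P = Q → (open Classical in
      (if h : ∃ w, P w then h.choose else 0) = if h : ∃ w, Q w then h.choose else 0) := by
    rintro P _ rfl
    rfl
  exact key _ _ this

theorem l2Proj_add (hS : S ≤ Sh r μ τ) (hf : MemL2 f) (hg : MemL2 g) :
    l2Proj S (f + g) = l2Proj S f + l2Proj S g := by
  have h1 := isL2Proj_l2Proj hS hf
  have h2 := isL2Proj_l2Proj hS hg
  have hadd : ∀ {f g φ : ℝ → ℝ}, MemL2 f → MemL2 g → φ ∈ S →
      l2Inner (f + g) φ = l2Inner f φ + l2Inner g φ := fun {f g φ} hf hg hφ => by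
    have hc := continuousOn_of_mem_Sh (hS hφ)
    unfold l2Inner
    rw [← intervalIntegral.integral_add (hf.intervalIntegrable_mul hc)
      (hg.intervalIntegrable_mul hc)]
    simp only [Pi.add_apply, add_mul]
  have hm : ∀ {φ}, φ ∈ S → MemL2 φ := fun hφ =>
    memL2_of_continuousOn (continuousOn_of_mem_Sh (hS hφ))
  refine l2Proj_eq hS (hf.add hg) ⟨S.add_mem h1.1 h2.1, fun φ hφ => ?_⟩
  rw [hadd hf hg hφ, hadd (hm h1.1) (hm h2.1) hφ, h1.2 φ hφ, h2.2 φ hφ]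

theorem l2Proj_smul (hS : S ≤ Sh r μ τ) (c : ℝ) (hf : MemL2 f) :
    l2Proj S (c • f) = c • l2Proj S f := by
  have h1 := isL2Proj_l2Proj hS hf
  have hsmul : ∀ f φ : ℝ → ℝ, l2Inner (c • f) φ = c * l2Inner f φ := fun f φ => by
    unfold l2Inner
    rw [← intervalIntegral.integral_const_mul]
    simp only [Pi.smul_apply, smul_eq_mul, mul_assoc]
  refine l2Proj_eq hS (hf.const_smul c) ⟨S.smul_mem c h1.1, fun φ hφ => ?_⟩
  rw [hsmul, hsmul, h1.2 φ hφ]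

theorem l2Proj_sub (hS : S ≤ Sh r μ τ) (hf : MemL2 f) (hg : MemL2 g) :
    l2Proj S (f - g) = l2Proj S f - l2Proj S g := by
  have h := l2Proj_add hS hf (hg.const_smul (-1 : ℝ))
  rw [l2Proj_smul hS _ hg] at h
  simpa [sub_eq_add_neg] using h

theorem l2Norm_l2Proj_le (hS : S ≤ Sh r μ τ) (hf : MemL2 f) : l2Norm (l2Proj S f) ≤ l2Norm f := by
  obtain ⟨hmem, horth⟩ := isL2Proj_l2Proj hS hf
  set w := l2Proj S f
  have hc : ContinuousOn w (Icc 0 1) := continuousOn_of_mem_Sh (hS hmem)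
  have hw : MemL2 w := memL2_of_continuousOn hc
  have horth' : l2Inner w w = l2Inner f w := horth w hmem
  have hff : IntervalIntegrable (fun x => f x * f x) volume 0 1 := by
    rw [intervalIntegrable_iff_integrableOn_Icc_of_le zero_le_one]
    exact hf.integrable_mul hf
  have h1 : 0 ≤ ∫ x in (0 : ℝ)..1, (f x * f x - f x * w x - (f x * w x - w x * w x)) :=
    intervalIntegral.integral_nonneg zero_le_one fun x _ => by nlinarith [sq_nonneg (f x - w x)]
  rw [intervalIntegral.integral_sub (hff.sub (hf.intervalIntegrable_mul hc))
      ((hf.intervalIntegrable_mul hc).sub (hw.intervalIntegrable_mul hc)),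
    intervalIntegral.integral_sub hff (hf.intervalIntegrable_mul hc),
    intervalIntegral.integral_sub (hf.intervalIntegrable_mul hc) (hw.intervalIntegrable_mul hc)]
    at h1
  refine Real.sqrt_le_sqrt ?_
  unfold l2Inner at *
  linarith

/-- Approximation by the projection in the norm of `H¹`, from the best approximation in `S` and an
inverse inequality in `S`. -/
theorem h1Norm_l2Proj_sub_le {K C B : ℝ} (hμ : 1 ≤ μ) (hS : S ≤ Sh r μ τ) (hr : 1 ≤ r)
    (hK : 0 ≤ K) (hinv : ∀ φ ∈ Sh r μ τ, l2Norm (dx φ) ≤ K / τ.h * l2Norm φ)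
    (happ : HasApprox S τ.h C r f) (hf : CBound r B f) :
    h1Norm (l2Proj S f - f) ≤ (3 + K) * (|C| * B) * τ.h ^ (r - 1) := by
  obtain ⟨χ, hχ, h1, -⟩ := happ
  obtain ⟨s, rfl⟩ : ∃ s, r = s + 1 := ⟨r - 1, by omega⟩
  have hh := τ.h_pos
  have hC1 : C1 f := hf.of_le (m := s + 1) le_rfl |>.c1
  have hχ1 : C1 χ := C1.of_mem_Sh hμ (hS hχ)
  have hd : C1 (f - χ) := hC1.sub hχ1
  have hB := hf.nonneg
  set A := |C| * B
  have hA : 0 ≤ A := mul_nonneg (abs_nonneg _) hB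
  have hle : C * τ.h ^ (s + 1) * l2Norm (weakDeriv (s + 1) f) ≤ A * τ.h ^ (s + 1) := by
    calc _ ≤ |C| * τ.h ^ (s + 1) * l2Norm (weakDeriv (s + 1) f) :=
          mul_le_mul_of_nonneg_right (mul_le_mul_of_nonneg_right (le_abs_self C) (by positivity))
            (l2Norm_nonneg _)
      _ ≤ |C| * τ.h ^ (s + 1) * B :=
          mul_le_mul_of_nonneg_left hf.l2Norm_weakDeriv_le (by positivity)
      _ = _ := by simp only [A]; ring
  rw [l2Norm_weakDeriv_one hd] at h1
  have h0 : 0 ≤ l2Norm (f - χ) := l2Norm_nonneg _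
  have h0' : 0 ≤ l2Norm (dx (f - χ)) := l2Norm_nonneg _
  have h0'' := mul_nonneg hh.le h0'
  have hL2 : l2Norm (f - χ) ≤ A * τ.h ^ (s + 1) := by linarith
  have hdx : l2Norm (dx (f - χ)) ≤ A * τ.h ^ s := by
    have : τ.h * l2Norm (dx (f - χ)) ≤ τ.h * (A * τ.h ^ s) := by
      rw [show τ.h * (A * τ.h ^ s) = A * τ.h ^ (s + 1) by ring]; linarith
    exact le_of_mul_le_mul_left this hh
  have hhs : τ.h ^ (s + 1) ≤ τ.h ^ s := pow_le_pow_of_le_one hh.le τ.h_le_one (by omega)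
  have hAs := mul_le_mul_of_nonneg_left hhs hA
  have hP : l2Proj S (f - χ) = l2Proj S f - χ := by
    rw [l2Proj_sub hS hC1.memL2 hχ1.memL2, l2Proj_of_mem hS hχ]
  have hPm : l2Proj S (f - χ) ∈ Sh (s + 1) μ τ := hS (l2Proj_mem hS hd.memL2)
  have hP0 := (l2Norm_l2Proj_le hS hd.memL2).trans hL2
  have hP1 : l2Norm (dx (l2Proj S (f - χ))) ≤ K * (A * τ.h ^ s) := by
    refine (hinv _ hPm).trans ((mul_le_mul_of_nonneg_left hP0 (by positivity)).trans ?_)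
    rw [pow_succ]
    apply le_of_eq
    field_simp
  have hsplit : l2Proj S f - f = l2Proj S (f - χ) + (-1 : ℝ) • (f - χ) := by
    rw [hP]; ext x; simp
  have hfin := h1Norm_add_le (C1.of_mem_Sh hμ hPm) (hd.smul (-1))
  rw [h1Norm_smul _ hd, abs_neg, abs_one, one_mul, ← hsplit] at hfin
  simp only [h1Norm] at hfin ⊢
  simp only [Nat.add_sub_cancel]
  linarith

end proj

/-! ### Differences of the nonlinear terms -/

theorem h1Norm_mul_le {f g : ℝ → ℝ} (hf : C1 f) (hg : C1 g) :
    h1Norm (f * g) ≤ 2 * (h1Norm f * h1Norm g) := by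
  have hm : ∀ {f g : ℝ → ℝ}, ContinuousOn f (Icc 0 1) → ContinuousOn g (Icc 0 1) → MemL2 (f * g) :=
    fun hf hg => memL2_of_continuousOn (hf.mul hg)
  have h1 := l2Norm_mul_le hg.memL2 (hm hf.cont hg.cont) fun x hx => abs_le_h1Norm hf hx
  have h2 := l2Norm_mul_le hg.memL2_dx (hm hf.cont hg.cont_dx) fun x hx => abs_le_h1Norm hf hx
  have h3 := l2Norm_mul_le hf.memL2_dx (hm hg.cont hf.cont_dx) fun x hx => abs_le_h1Norm hg hx
  have h4 : l2Norm (dx (f * g)) = l2Norm (g * dx f + f * dx g) := l2Norm_congr fun x hx => by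
    rw [dx_mul hf.diff hg.diff hx]
    simp [mul_comm]
  have h5 := l2Norm_add_le (hm hg.cont hf.cont_dx) (hm hf.cont hg.cont_dx)
  have h6 : h1Norm g * l2Norm (dx f) ≤ h1Norm g * h1Norm f :=
    mul_le_mul_of_nonneg_left (le_add_of_nonneg_left (l2Norm_nonneg f)) (h1Norm_nonneg g)
  have h7 : h1Norm f * h1Norm g = h1Norm f * l2Norm g + h1Norm f * l2Norm (dx g) := by
    rw [← mul_add]; rfl
  rw [h1Norm, h4]
  linarith

theorem CBound.h1Norm_le {K : ℝ} {f : ℝ → ℝ} {n : ℕ} (h : CBound (n + 1) K f) :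
    h1Norm f ≤ 2 * K := by
  have h1 := l2Norm_le_of_abs_le h.c1.memL2 h.abs_le
  have h2 := l2Norm_le_of_abs_le h.c1.memL2_dx h.dx.abs_le
  unfold h1Norm
  linarith

/-- The function `V + W² / 2`, whose derivative is the term `F = V_x + W W_x` of the momentum
equation. -/
noncomputable def potential (VW : (ℝ → ℝ) × (ℝ → ℝ)) : ℝ → ℝ :=
  VW.1 + (1 / 2 : ℝ) • (VW.2 * VW.2)

theorem force_eqOn {V W : ℝ → ℝ} (hV : C1 V) (hW : C1 W) :
    EqOn (force (V, W)) (dx (potential (V, W))) (Icc 0 1) := fun x hx => by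
  have hW2 := hW.mul hW
  simp only [force, potential, Pi.add_apply, Pi.mul_apply]
  rw [dx_add hV.diff (hW2.smul _).diff hx, dx_smul _ hW2.diff hx, dx_mul hW.diff hW.diff hx]
  ring

theorem C1.flux {V W : ℝ → ℝ} (hV : C1 V) (hW : C1 W) : C1 (flux (V, W)) := hW.add (hV.mul hW)

theorem C1.potential {V W : ℝ → ℝ} (hV : C1 V) (hW : C1 W) : C1 (potential (V, W)) :=
  hV.add ((hW.mul hW).smul _)

section difference
variable {v w V W : ℝ → ℝ} {B E : ℝ}

theorem h1Norm_flux_sub_le (hv : CBound 1 B v) (hw : CBound 1 B w) (hV : C1 V) (hW : C1 W)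
    (hE : h1Norm (V - v) + h1Norm (W - w) ≤ E) :
    h1Norm (flux (V, W) - flux (v, w)) ≤ (1 + 4 * B) * (E + E ^ 2) := by
  have ha : C1 (W - w) := hW.sub hw.c1
  have hb : C1 (V - v) := hV.sub hv.c1
  have hB := hv.nonneg
  have key : flux (V, W) - flux (v, w)
      = (W - w) + (v * (W - w) + ((V - v) * w + (V - v) * (W - w))) := by
    simp only [flux]; ring
  rw [key]
  have h1 := h1Norm_add_le ha ((hv.c1.mul ha).add ((hb.mul hw.c1).add (hb.mul ha)))
  have h2 := h1Norm_add_le (hv.c1.mul ha) ((hb.mul hw.c1).add (hb.mul ha))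
  have h3 := h1Norm_add_le (hb.mul hw.c1) (hb.mul ha)
  have h4 := h1Norm_mul_le hv.c1 ha
  have h5 := h1Norm_mul_le hb hw.c1
  have h6 := h1Norm_mul_le hb ha
  have h7 := mul_le_mul_of_nonneg_right hv.h1Norm_le (h1Norm_nonneg (W - w))
  have h8 := mul_le_mul_of_nonneg_left hw.h1Norm_le (h1Norm_nonneg (V - v))
  have a0 := h1Norm_nonneg (W - w)
  have b0 := h1Norm_nonneg (V - v)
  set a := h1Norm (W - w)
  set b := h1Norm (V - v)
  have h9 : (b + a) ^ 2 ≤ E ^ 2 := pow_le_pow_left₀ (by positivity) hE 2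
  have h10 : B * (b + a) ≤ B * E := mul_le_mul_of_nonneg_left hE hB
  nlinarith [mul_nonneg hB (sq_nonneg E), sq_nonneg a, sq_nonneg b]

theorem h1Norm_potential_sub_le (hv : CBound 1 B v) (hw : CBound 1 B w) (hV : C1 V) (hW : C1 W)
    (hE : h1Norm (V - v) + h1Norm (W - w) ≤ E) :
    h1Norm (potential (V, W) - potential (v, w)) ≤ (1 + 4 * B) * (E + E ^ 2) := by
  have ha : C1 (W - w) := hW.sub hw.c1
  have hb : C1 (V - v) := hV.sub hv.c1
  have hB := hv.nonneg
  have key : potential (V, W) - potential (v, w)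
      = (V - v) + (w * (W - w) + (1 / 2 : ℝ) • ((W - w) * (W - w))) := by
    ext x
    simp only [potential, Pi.add_apply, Pi.sub_apply, Pi.mul_apply, Pi.smul_apply, smul_eq_mul]
    ring
  rw [key]
  have h1 := h1Norm_add_le hb ((hw.c1.mul ha).add ((ha.mul ha).smul (1 / 2)))
  have h2 := h1Norm_add_le (hw.c1.mul ha) ((ha.mul ha).smul (1 / 2))
  have h3 := h1Norm_smul (1 / 2) (ha.mul ha)
  rw [abs_of_nonneg (by norm_num)] at h3
  have h4 := h1Norm_mul_le hw.c1 ha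
  have h6 := h1Norm_mul_le ha ha
  have h7 := mul_le_mul_of_nonneg_right hw.h1Norm_le (h1Norm_nonneg (W - w))
  have a0 := h1Norm_nonneg (W - w)
  have b0 := h1Norm_nonneg (V - v)
  set a := h1Norm (W - w)
  set b := h1Norm (V - v)
  have h9 : (b + a) ^ 2 ≤ E ^ 2 := pow_le_pow_left₀ (by positivity) hE 2
  have h10 : B * (b + a) ≤ B * E := mul_le_mul_of_nonneg_left hE hB
  nlinarith [mul_nonneg hB (sq_nonneg E), mul_nonneg a0 b0, sq_nonneg b, mul_nonneg hB b0]

end difference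

/-! ### Error propagation through the stages -/

/-- The stages of one step of size `k` of the Runge-Kutta scheme without discretization in space,
with starting values `v`, `w`. -/
noncomputable def exactStage (k : ℝ) (v w : ℝ → ℝ) : ℕ → (ℝ → ℝ) × (ℝ → ℝ)
  | 0 => (v, w)
  | j + 1 =>
    (v - (k * rkA (j + 1)) • dx (flux (exactStage k v w j)),
      w - (k * rkA (j + 1)) • dx (potential (exactStage k v w j)))

/-- Polynomials in `λ` that bound the error of the stages relative to `h^{r-1}`. -/
noncomputable def stagePoly (A L : ℝ) : ℕ → Polynomial ℝ
  | 0 => Polynomial.C (2 * A)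
  | j + 1 => Polynomial.C (2 * A) +
      Polynomial.C L * Polynomial.X * (stagePoly A L j + stagePoly A L j ^ 2)

/-- All coefficients of `p` are nonnegative. -/
def NonnegCoeff (p : Polynomial ℝ) : Prop := ∀ i, 0 ≤ p.coeff i

namespace NonnegCoeff
variable {p q : Polynomial ℝ}

theorem add (hp : NonnegCoeff p) (hq : NonnegCoeff q) : NonnegCoeff (p + q) := fun i => by
  rw [Polynomial.coeff_add]; exact add_nonneg (hp i) (hq i)

theorem mul (hp : NonnegCoeff p) (hq : NonnegCoeff q) : NonnegCoeff (p * q) := fun i => by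
  rw [Polynomial.coeff_mul]; exact Finset.sum_nonneg fun x _ => mul_nonneg (hp _) (hq _)

theorem C {a : ℝ} (ha : 0 ≤ a) : NonnegCoeff (Polynomial.C a) := fun i => by
  rw [Polynomial.coeff_C]; split_ifs <;> simp [ha]

theorem X : NonnegCoeff Polynomial.X := fun i => by
  rw [Polynomial.coeff_X]; split_ifs <;> simp

theorem eval_nonneg (hp : NonnegCoeff p) {x : ℝ} (hx : 0 ≤ x) : 0 ≤ p.eval x := by
  rw [Polynomial.eval_eq_sum]
  exact Finset.sum_nonneg fun i _ => mul_nonneg (hp i) (pow_nonneg hx i)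

end NonnegCoeff

theorem nonnegCoeff_stagePoly {A L : ℝ} (hA : 0 ≤ A) (hL : 0 ≤ L) (j : ℕ) :
    NonnegCoeff (stagePoly A L j) := by
  induction j with
  | zero => exact .C (by positivity)
  | succ j ih =>
    rw [stagePoly, sq]
    exact (NonnegCoeff.C (by positivity)).add (((NonnegCoeff.C hL).mul .X).mul (ih.add (ih.mul ih)))

theorem Sh0_le (r μ : ℕ) (τ : Mesh) : Sh0 r μ τ ≤ Sh r μ τ := inf_le_left

section stages
variable {r μ : ℕ} {τ : Mesh} {K A B k : ℝ} {v w : ℝ → ℝ}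

/-- One component of a stage: the difference to the exact stage `f - c g'` is the sum of the
error of the projection and of the projected difference of the nonlinear terms `G`, `g'`, which is
controlled in `H¹` by the inverse inequality at the price of a factor `c / h`. -/
theorem h1Norm_stage_sub_le {S : Submodule ℝ (ℝ → ℝ)} (hμ : 1 ≤ μ) (hS : S ≤ Sh r μ τ)
    (hK : 0 ≤ K) (hinv : ∀ φ ∈ Sh r μ τ, l2Norm (dx φ) ≤ K / τ.h * l2Norm φ)
    {f g G Q : ℝ → ℝ} {c : ℝ} (hc0 : 0 ≤ c) (hck : c ≤ k) (hf : C1 f) (hg : C1 g) (hQ : C1 Q)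
    (hfg : C1 (f - c • dx g)) (hGQ : EqOn G (dx Q) (Icc 0 1)) :
    h1Norm ((l2Proj S f - c • l2Proj S G) - (f - c • dx g))
      ≤ (1 + K) * (k / τ.h) * h1Norm (Q - g)
        + h1Norm (l2Proj S (f - c • dx g) - (f - c • dx g)) := by
  have hh := τ.h_pos
  have hd : MemL2 (dx Q - dx g) := hQ.memL2_dx.sub hg.memL2_dx
  set ψ := l2Proj S (dx Q - dx g)
  have hψ : ψ ∈ Sh r μ τ := hS (l2Proj_mem hS hd)
  have hPm : C1 (l2Proj S (f - c • dx g)) := C1.of_mem_Sh hμ (hS (l2Proj_mem hS hfg.memL2))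
  have e1 : (l2Proj S f - c • l2Proj S G) - (f - c • dx g)
      = (-c) • ψ + (l2Proj S (f - c • dx g) - (f - c • dx g)) := by
    rw [l2Proj_sub hS hf.memL2 (hg.memL2_dx.const_smul c), l2Proj_smul hS c hg.memL2_dx,
      l2Proj_congr hGQ]
    simp only [ψ]
    rw [l2Proj_sub hS hQ.memL2_dx hg.memL2_dx]
    module
  have hψ1 := C1.of_mem_Sh hμ hψ
  rw [e1]
  refine (h1Norm_add_le (hψ1.smul _) (hPm.sub hfg)).trans (add_le_add_left ?_ _)
  rw [h1Norm_smul _ hψ1, abs_neg, abs_of_nonneg hc0]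
  have h1 : l2Norm ψ ≤ h1Norm (Q - g) := by
    refine (l2Norm_l2Proj_le hS hd).trans ?_
    have h0 : l2Norm (dx (Q - g)) = l2Norm (dx Q - dx g) :=
      l2Norm_congr fun x hx => dx_sub hQ.diff hg.diff hx
    rw [← h0]
    exact le_add_of_nonneg_left (l2Norm_nonneg _)
  have h2 : h1Norm ψ ≤ (1 + K / τ.h) * h1Norm (Q - g) := by
    have := hinv ψ hψ
    calc h1Norm ψ ≤ l2Norm ψ + K / τ.h * l2Norm ψ := by unfold h1Norm; linarith
      _ = (1 + K / τ.h) * l2Norm ψ := by ring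
      _ ≤ _ := mul_le_mul_of_nonneg_left h1 (by positivity)
  have h3 : c * (1 + K / τ.h) ≤ (1 + K) * (k / τ.h) := by
    have hk : k ≤ k / τ.h := by
      rw [le_div_iff₀ hh]
      exact mul_le_of_le_one_right (hc0.trans hck) τ.h_le_one
    calc c * (1 + K / τ.h) ≤ k * (1 + K / τ.h) :=
          mul_le_mul_of_nonneg_right hck (by positivity)
      _ = k + K * (k / τ.h) := by ring
      _ ≤ _ := by linarith
  calc c * h1Norm ψ ≤ c * ((1 + K / τ.h) * h1Norm (Q - g)) := mul_le_mul_of_nonneg_left h2 hc0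
    _ = c * (1 + K / τ.h) * h1Norm (Q - g) := by ring
    _ ≤ _ := mul_le_mul_of_nonneg_right h3 (h1Norm_nonneg _)

theorem rkA_nonneg (j : ℕ) : 0 ≤ rkA j := by unfold rkA; split <;> norm_num

theorem rkA_le_one (j : ℕ) : rkA j ≤ 1 := by unfold rkA; split <;> norm_num

theorem stage_mem (r μ : ℕ) (hμ : 1 ≤ μ) (τ : Mesh) (k : ℝ) {H U : ℝ → ℝ} (hH : H ∈ Sh r μ τ)
    (hU : U ∈ Sh0 r μ τ) (j : ℕ) :
    (stage r μ τ k H U j).1 ∈ Sh r μ τ ∧ (stage r μ τ k H U j).2 ∈ Sh0 r μ τ := by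
  induction j with
  | zero => exact ⟨hH, hU⟩
  | succ j ih =>
    have h1 := C1.of_mem_Sh hμ ih.1
    have h2 := C1.of_mem_Sh hμ (Sh0_le _ _ _ ih.2)
    have hf : MemL2 (force (stage r μ τ k H U j)) :=
      memL2_of_continuousOn ((h1.potential h2).cont_dx.congr (force_eqOn h1 h2))
    exact ⟨Submodule.sub_mem _ hH (Submodule.smul_mem _ _
        (l2Proj_mem le_rfl (h1.flux h2).memL2_dx)),
      Submodule.sub_mem _ hU (Submodule.smul_mem _ _ (l2Proj_mem (Sh0_le _ _ _) hf))⟩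

theorem stage_error_le (hμ : 1 ≤ μ)
    (hK : 0 ≤ K) (hinv : ∀ φ ∈ Sh r μ τ, l2Norm (dx φ) ≤ K / τ.h * l2Norm φ) (hk : 0 ≤ k)
    {m : ℕ}
    (hB : ∀ j ≤ m, CBound 1 B (exactStage k v w j).1 ∧ CBound 1 B (exactStage k v w j).2)
    (hA : ∀ j ≤ m,
      h1Norm (l2Proj (Sh r μ τ) (exactStage k v w j).1 - (exactStage k v w j).1)
        ≤ A * τ.h ^ (r - 1) ∧
      h1Norm (l2Proj (Sh0 r μ τ) (exactStage k v w j).2 - (exactStage k v w j).2)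
        ≤ A * τ.h ^ (r - 1)) :
    ∀ j ≤ m,
      h1Norm ((stage r μ τ k (l2Proj (Sh r μ τ) v) (l2Proj (Sh0 r μ τ) w) j).1
          - (exactStage k v w j).1)
        + h1Norm ((stage r μ τ k (l2Proj (Sh r μ τ) v) (l2Proj (Sh0 r μ τ) w) j).2
          - (exactStage k v w j).2)
      ≤ (stagePoly A (2 * (1 + K) * (1 + 4 * B)) j).eval (k / τ.h) * τ.h ^ (r - 1) := by
  have hh := τ.h_pos
  have hv : C1 v := (hB 0 (by omega)).1.c1
  have hw : C1 w := (hB 0 (by omega)).2.c1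
  have hB0 : 0 ≤ B := (hB 0 (by omega)).1.nonneg
  have hA0 : 0 ≤ A := by
    have h := (h1Norm_nonneg _).trans (hA 0 (by omega)).1
    exact nonneg_of_mul_nonneg_left h (by positivity)
  intro j
  induction j with
  | zero =>
    intro hj
    have := hA 0 hj
    simp only [exactStage] at this
    simp only [exactStage, stage, stagePoly, Polynomial.eval_C]
    linarith
  | succ j ih =>
    intro hj
    have ihj := ih (by omega)
    obtain ⟨hb1, hb2⟩ := hB j (by omega)
    obtain ⟨hs1, hs2⟩ := hB (j + 1) hj
    obtain ⟨ha1, ha2⟩ := hA (j + 1) hj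
    have hmem := stage_mem r μ hμ τ k (l2Proj_mem (S := Sh r μ τ) le_rfl hv.memL2)
      (l2Proj_mem (Sh0_le r μ τ) hw.memL2) j
    set E := (stagePoly A (2 * (1 + K) * (1 + 4 * B)) j).eval (k / τ.h)
    have hV := C1.of_mem_Sh hμ hmem.1
    have hW := C1.of_mem_Sh hμ (Sh0_le _ _ _ hmem.2)
    have hc0 : 0 ≤ k * rkA (j + 1) := mul_nonneg hk (rkA_nonneg _)
    have hck : k * rkA (j + 1) ≤ k := mul_le_of_le_one_right hk (rkA_le_one _)
    have f1 := h1Norm_flux_sub_le hb1 hb2 hV hW ihj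
    have f2 := h1Norm_potential_sub_le hb1 hb2 hV hW ihj
    have g1 := h1Norm_stage_sub_le hμ le_rfl hK hinv hc0 hck hv (hb1.c1.flux hb2.c1)
      (hV.flux hW) hs1.c1 fun _ _ => rfl
    have g2 := h1Norm_stage_sub_le hμ (Sh0_le r μ τ) hK hinv hc0 hck hw (hb1.c1.potential hb2.c1)
      (hV.potential hW) hs2.c1 (force_eqOn hV hW)
    have hlam : 0 ≤ (1 + K) * (k / τ.h) := by positivity
    have k1 := mul_le_mul_of_nonneg_left f1 hlam
    have k2 := mul_le_mul_of_nonneg_left f2 hlam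
    have hEh : (E * τ.h ^ (r - 1)) ^ 2 ≤ E ^ 2 * τ.h ^ (r - 1) := by
      rw [mul_pow]
      refine mul_le_mul_of_nonneg_left ?_ (sq_nonneg E)
      exact pow_le_of_le_one (by positivity) (pow_le_one₀ hh.le τ.h_le_one) two_ne_zero
    have hfin := mul_le_mul_of_nonneg_left hEh
      (show 0 ≤ 2 * ((1 + K) * (k / τ.h)) * (1 + 4 * B) by positivity)
    simp only [stagePoly, Polynomial.eval_add, Polynomial.eval_mul, Polynomial.eval_C,
      Polynomial.eval_X, Polynomial.eval_pow]
    change _ ≤ (2 * A + 2 * (1 + K) * (1 + 4 * B) * (k / τ.h) * (E + E ^ 2)) * τ.h ^ (r - 1)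
    simp only [exactStage] at ha1 ha2
    simp only [stage, exactStage]
    refine (add_le_add (g1.trans (add_le_add k1 ha1)) (g2.trans (add_le_add k2 ha2))).trans ?_
    nlinarith [hfin]

/-! ### The local error in terms of the consistency error and the errors of the stages -/

theorem sum_rkB {M : Type*} [AddCommMonoid M] [Module ℝ M] (g : ℕ → M) :
    ∑ j ∈ Finset.Icc 1 4, rkB j • g (j - 1)
      = (1 / 6 : ℝ) • g 0 + ((1 / 3 : ℝ) • g 1 + ((1 / 3 : ℝ) • g 2 + (1 / 6 : ℝ) • g 3)) := by
  rw [show Finset.Icc 1 4 = {1, 2, 3, 4} by decide]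
  simp [rkB]

theorem C1.sum_rkB {g : ℕ → ℝ → ℝ} (hg : ∀ j < 4, C1 (g j)) :
    C1 (∑ j ∈ Finset.Icc 1 4, rkB j • g (j - 1)) := by
  rw [ShallowWater.sum_rkB]
  exact ((hg 0 (by norm_num)).smul _).add (((hg 1 (by norm_num)).smul _).add
    (((hg 2 (by norm_num)).smul _).add ((hg 3 (by norm_num)).smul _)))

theorem dx_sum_rkB {g : ℕ → ℝ → ℝ} (hg : ∀ j < 4, C1 (g j)) {x : ℝ} (hx : x ∈ Icc (0 : ℝ) 1) :
    dx (∑ j ∈ Finset.Icc 1 4, rkB j • g (j - 1)) x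
      = ∑ j ∈ Finset.Icc 1 4, rkB j • dx (g (j - 1)) x := by
  have h0 := hg 0 (by norm_num)
  have h1 := hg 1 (by norm_num)
  have h2 := hg 2 (by norm_num)
  have h3 := hg 3 (by norm_num)
  rw [sum_rkB, sum_rkB (fun j => dx (g j) x),
    dx_add (h0.smul _).diff ((h1.smul _).add ((h2.smul _).add (h3.smul _))).diff hx,
    dx_add (h1.smul _).diff ((h2.smul _).add (h3.smul _)).diff hx,
    dx_add (h2.smul _).diff (h3.smul _).diff hx, dx_smul _ h0.diff hx, dx_smul _ h1.diff hx,
    dx_smul _ h2.diff hx, dx_smul _ h3.diff hx]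
  rfl

theorem h1Norm_sum_rkB_le {g : ℕ → ℝ → ℝ} (hg : ∀ j < 4, C1 (g j)) :
    h1Norm (∑ j ∈ Finset.Icc 1 4, rkB j • g (j - 1)) ≤ ∑ j ∈ Finset.range 4, h1Norm (g j) := by
  have h0 := hg 0 (by norm_num)
  have h1 := hg 1 (by norm_num)
  have h2 := hg 2 (by norm_num)
  have h3 := hg 3 (by norm_num)
  rw [sum_rkB]
  have k1 := h1Norm_add_le (h0.smul (1 / 6)) ((h1.smul (1 / 3)).add ((h2.smul (1 / 3)).add
    (h3.smul (1 / 6))))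
  have k2 := h1Norm_add_le (h1.smul (1 / 3)) ((h2.smul (1 / 3)).add (h3.smul (1 / 6)))
  have k3 := h1Norm_add_le (h2.smul (1 / 3)) (h3.smul (1 / 6))
  have s0 := h1Norm_smul (1 / 6) h0
  have s1 := h1Norm_smul (1 / 3) h1
  have s2 := h1Norm_smul (1 / 3) h2
  have s3 := h1Norm_smul (1 / 6) h3
  rw [abs_of_nonneg (by norm_num)] at s0 s1 s2 s3
  simp only [Finset.sum_range_succ, Finset.sum_range_zero]
  linarith [h1Norm_nonneg (g 0), h1Norm_nonneg (g 1), h1Norm_nonneg (g 2), h1Norm_nonneg (g 3)]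

/-- The local error of one component: `f₀`, `f₁` are the exact solution at two consecutive times,
`q j` and `Q j` the exact and the discrete fluxes of the stages, and `G = (∑ b_j Q_j)_x`. -/
theorem l2Norm_localError_le {S : Submodule ℝ (ℝ → ℝ)} (hS : S ≤ Sh r μ τ) (hk : 0 ≤ k)
    {f₀ f₁ G : ℝ → ℝ} {q Q : ℕ → ℝ → ℝ} {ε : ℝ} (hf₀ : C1 f₀) (hf₁ : C1 f₁)
    (hq : ∀ j < 4, C1 (q j)) (hQ : ∀ j < 4, C1 (Q j))
    (hG : EqOn G (dx (∑ j ∈ Finset.Icc 1 4, rkB j • Q (j - 1))) (Icc 0 1))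
    (hε : ∀ x ∈ Icc (0 : ℝ) 1,
      |f₁ x - f₀ x + k * dx (∑ j ∈ Finset.Icc 1 4, rkB j • q (j - 1)) x| ≤ ε) :
    l2Norm (l2Proj S f₁ - l2Proj S f₀ + k • l2Proj S G)
      ≤ ε + k * ∑ j ∈ Finset.range 4, h1Norm (Q j - q j) := by
  set Qs := ∑ j ∈ Finset.Icc 1 4, rkB j • Q (j - 1) with hQs
  set qs := ∑ j ∈ Finset.Icc 1 4, rkB j • q (j - 1) with hqs
  have cQ : C1 Qs := C1.sum_rkB hQ
  have cq : C1 qs := C1.sum_rkB hq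
  have hsub : Qs - qs = ∑ j ∈ Finset.Icc 1 4, rkB j • (fun i => Q i - q i) (j - 1) := by
    simp only [hQs, hqs, smul_sub, Finset.sum_sub_distrib]
  have hdiff : h1Norm (Qs - qs) ≤ ∑ j ∈ Finset.range 4, h1Norm (Q j - q j) := by
    rw [hsub]
    exact h1Norm_sum_rkB_le (g := fun i => Q i - q i) fun j hj => (hQ j hj).sub (hq j hj)
  have hproj : l2Proj S f₁ - l2Proj S f₀ + k • l2Proj S G
      = l2Proj S (f₁ - f₀ + k • dx Qs) := by
    rw [l2Proj_add hS (hf₁.memL2.sub hf₀.memL2) (cQ.memL2_dx.const_smul k),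
      l2Proj_sub hS hf₁.memL2 hf₀.memL2, l2Proj_smul hS k cQ.memL2_dx, l2Proj_congr hG]
  have hm1 : MemL2 (f₁ - f₀ + k • dx qs) :=
    (hf₁.memL2.sub hf₀.memL2).add (cq.memL2_dx.const_smul k)
  have hm2 : MemL2 (k • dx (Qs - qs)) := (cQ.sub cq).memL2_dx.const_smul k
  have hsplit : EqOn (f₁ - f₀ + k • dx Qs) ((f₁ - f₀ + k • dx qs) + k • dx (Qs - qs))
      (Icc 0 1) := fun x hx => by
    simp only [Pi.add_apply, Pi.sub_apply, Pi.smul_apply, smul_eq_mul, dx_sub cQ.diff cq.diff hx]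
    ring
  rw [hproj]
  refine (l2Norm_l2Proj_le hS ((hf₁.memL2.sub hf₀.memL2).add (cQ.memL2_dx.const_smul k))).trans ?_
  rw [l2Norm_congr hsplit]
  refine (l2Norm_add_le hm1 hm2).trans (add_le_add (l2Norm_le_of_abs_le hm1 hε) ?_)
  rw [l2Norm_smul, abs_of_nonneg hk]
  exact mul_le_mul_of_nonneg_left ((le_add_of_nonneg_left (l2Norm_nonneg _)).trans hdiff) hk

end stages

/-! ### Families of functions with uniformly bounded derivatives -/

section families
variable {ι : Type*} {κ : ι → ℝ} {n : ℕ} {f g : ι → ℝ → ℝ}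

/-- The family `f` is bounded in `C^n[0,1]`. -/
def Bd (n : ℕ) (f : ι → ℝ → ℝ) : Prop := ∃ K, ∀ i, CBound n K (f i)

namespace Bd

theorem add (hf : Bd n f) (hg : Bd n g) : Bd n (f + g) :=
  hf.elim fun K hK => hg.elim fun L hL => ⟨K + L, fun i => (hK i).add (hL i)⟩

theorem mul (hf : Bd n f) (hg : Bd n g) : Bd n (f * g) :=
  hf.elim fun K hK => hg.elim fun L hL => ⟨2 ^ n * (K * L), fun i => (hK i).mul (hL i)⟩

theorem smul (c : ℝ) (hf : Bd n f) : Bd n (c • f) :=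
  hf.elim fun K hK => ⟨|c| * K, fun i => (hK i).const_smul le_rfl⟩

theorem step (hκ : ∃ T, ∀ i, |κ i| ≤ T) (hf : Bd n f) : Bd n (fun i => κ i • f i) :=
  hf.elim fun K hK => hκ.elim fun T hT => ⟨T * K, fun i => (hK i).const_smul (hT i)⟩

theorem sub (hf : Bd n f) (hg : Bd n g) : Bd n (f - g) := by
  have h := hf.add (hg.smul (-1))
  rwa [show f + (-1 : ℝ) • g = f - g by ext i x; simp [sub_eq_add_neg]] at h

theorem dx (hf : Bd (n + 1) f) : Bd n (fun i => dx (f i)) :=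
  hf.elim fun K hK => ⟨K, fun i => (hK i).dx⟩

theorem of_le {m : ℕ} (hf : Bd n f) (h : m ≤ n) : Bd m f :=
  hf.elim fun K hK => ⟨K, fun i => (hK i).of_le h⟩

theorem congr (hf : Bd n f) (h : ∀ i, EqOn (f i) (g i) (Icc 0 1)) : Bd n g :=
  hf.elim fun K hK => ⟨K, fun i => (hK i).congr (h i)⟩

theorem zero : Bd n (0 : ι → ℝ → ℝ) := by
  refine ⟨0, fun i => ?_⟩
  have h0 : ∀ x ∈ Icc (0 : ℝ) 1, |(0 : ℝ → ℝ) x| ≤ 0 := by simp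
  change CBound n 0 (0 : ℝ → ℝ)
  induction n with
  | zero => exact ⟨continuousOn_const, h0⟩
  | succ n ih =>
    exact ⟨differentiableOn_const 0, h0, ih.congr fun x hx => (dx_eq hx
      (hasDerivWithinAt_const x _ (0 : ℝ))).symm⟩

theorem diff (hf : Bd (n + 1) f) (i : ι) : DifferentiableOn ℝ (f i) (Icc 0 1) :=
  hf.elim fun _ hK => (hK i).diff

end Bd

theorem bd_exactStage (hκ : ∃ T, ∀ i, |κ i| ≤ T) {v w : ι → ℝ → ℝ} (j : ℕ)
    (hv : Bd (n + j) v) (hw : Bd (n + j) w) :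
    Bd n (fun i => (exactStage (κ i) (v i) (w i) j).1) ∧
      Bd n (fun i => (exactStage (κ i) (v i) (w i) j).2) := by
  induction j generalizing n with
  | zero => exact ⟨hv, hw⟩
  | succ j ih =>
    obtain ⟨h1, h2⟩ := ih (n := n + 1) (hv.of_le (by omega)) (hw.of_le (by omega))
    have hκ' : ∃ T, ∀ i, |κ i * rkA (j + 1)| ≤ T := hκ.imp fun T hT i => by
      rw [abs_mul, abs_of_nonneg (rkA_nonneg _)]
      exact (mul_le_of_le_one_right (abs_nonneg _) (rkA_le_one _)).trans (hT i)
    exact ⟨(hv.of_le (by omega)).sub ((h2.add (h1.mul h2)).dx.step hκ'),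
      (hw.of_le (by omega)).sub ((h1.add ((h2.mul h2).smul (1 / 2))).dx.step hκ')⟩

/-! ### Expansions in powers of the step size -/

/-- The family `g` has the expansion `g = c₀ + κ c₁ + κ² c₂ + κ³ c₃ + O(κ⁴)` in `C^n[0,1]`. -/
def Jet (κ : ι → ℝ) (n : ℕ) (c₀ c₁ c₂ c₃ g : ι → ℝ → ℝ) : Prop :=
  (Bd n c₀ ∧ Bd n c₁ ∧ Bd n c₂ ∧ Bd n c₃) ∧ ∃ R, Bd n R ∧ ∀ i, ∀ x ∈ Icc (0 : ℝ) 1,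
    g i x = c₀ i x + κ i * c₁ i x + κ i ^ 2 * c₂ i x + κ i ^ 3 * c₃ i x + κ i ^ 4 * R i x

namespace Jet
variable {a₀ a₁ a₂ a₃ b₀ b₁ b₂ b₃ : ι → ℝ → ℝ}

theorem of_bd (hf : Bd n f) : Jet κ n f 0 0 0 f :=
  ⟨⟨hf, .zero, .zero, .zero⟩, 0, .zero, fun i x _ => by simp⟩

theorem of_le {m : ℕ} (h : Jet κ n a₀ a₁ a₂ a₃ f) (hm : m ≤ n) : Jet κ m a₀ a₁ a₂ a₃ f := by
  obtain ⟨⟨h0, h1, h2, h3⟩, R, hR, he⟩ := h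
  exact ⟨⟨h0.of_le hm, h1.of_le hm, h2.of_le hm, h3.of_le hm⟩, R, hR.of_le hm, he⟩

theorem congr (h : Jet κ n a₀ a₁ a₂ a₃ f) (h0 : ∀ i, EqOn (a₀ i) (b₀ i) (Icc 0 1))
    (h1 : ∀ i, EqOn (a₁ i) (b₁ i) (Icc 0 1)) (h2 : ∀ i, EqOn (a₂ i) (b₂ i) (Icc 0 1))
    (h3 : ∀ i, EqOn (a₃ i) (b₃ i) (Icc 0 1)) (hf : ∀ i, EqOn (f i) (g i) (Icc 0 1)) :
    Jet κ n b₀ b₁ b₂ b₃ g := by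
  obtain ⟨⟨k0, k1, k2, k3⟩, R, hR, he⟩ := h
  refine ⟨⟨k0.congr h0, k1.congr h1, k2.congr h2, k3.congr h3⟩, R, hR, fun i x hx => ?_⟩
  rw [← hf i hx, ← h0 i hx, ← h1 i hx, ← h2 i hx, ← h3 i hx, he i x hx]

theorem add (hf : Jet κ n a₀ a₁ a₂ a₃ f) (hg : Jet κ n b₀ b₁ b₂ b₃ g) :
    Jet κ n (a₀ + b₀) (a₁ + b₁) (a₂ + b₂) (a₃ + b₃) (f + g) := by
  obtain ⟨⟨h0, h1, h2, h3⟩, R, hR, he⟩ := hf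
  obtain ⟨⟨k0, k1, k2, k3⟩, Q, hQ, he'⟩ := hg
  refine ⟨⟨h0.add k0, h1.add k1, h2.add k2, h3.add k3⟩, R + Q, hR.add hQ, fun i x hx => ?_⟩
  simp only [Pi.add_apply, he i x hx, he' i x hx]
  ring

theorem smul (c : ℝ) (hf : Jet κ n a₀ a₁ a₂ a₃ f) :
    Jet κ n (c • a₀) (c • a₁) (c • a₂) (c • a₃) (c • f) := by
  obtain ⟨⟨h0, h1, h2, h3⟩, R, hR, he⟩ := hf
  refine ⟨⟨h0.smul c, h1.smul c, h2.smul c, h3.smul c⟩, c • R, hR.smul c, fun i x hx => ?_⟩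
  simp only [Pi.smul_apply, smul_eq_mul, he i x hx]
  ring

theorem step (hκ : ∃ T, ∀ i, |κ i| ≤ T) (hf : Jet κ n a₀ a₁ a₂ a₃ f) :
    Jet κ n 0 a₀ a₁ a₂ (fun i => κ i • f i) := by
  obtain ⟨⟨h0, h1, h2, h3⟩, R, hR, he⟩ := hf
  refine ⟨⟨.zero, h0, h1, h2⟩, a₃ + fun i => κ i • R i, h3.add (hR.step hκ), fun i x hx => ?_⟩
  simp only [Pi.smul_apply, Pi.add_apply, Pi.zero_apply, smul_eq_mul, he i x hx]
  ring

theorem mul (hκ : ∃ T, ∀ i, |κ i| ≤ T) (hf : Jet κ n a₀ a₁ a₂ a₃ f)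
    (hg : Jet κ n b₀ b₁ b₂ b₃ g) :
    Jet κ n (a₀ * b₀) (a₀ * b₁ + a₁ * b₀) (a₀ * b₂ + a₁ * b₁ + a₂ * b₀)
      (a₀ * b₃ + a₁ * b₂ + a₂ * b₁ + a₃ * b₀) (f * g) := by
  obtain ⟨⟨h0, h1, h2, h3⟩, R, hR, he⟩ := hf
  obtain ⟨⟨k0, k1, k2, k3⟩, Q, hQ, he'⟩ := hg
  let s : (ι → ℝ → ℝ) → ι → ℝ → ℝ := fun f i => κ i • f i
  have hs : ∀ {f}, Bd n f → Bd n (s f) := fun hf => hf.step hκ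
  refine ⟨⟨h0.mul k0, (h0.mul k1).add (h1.mul k0),
    ((h0.mul k2).add (h1.mul k1)).add (h2.mul k0),
    (((h0.mul k3).add (h1.mul k2)).add (h2.mul k1)).add (h3.mul k0)⟩,
    (a₁ * b₃ + a₂ * b₂ + a₃ * b₁) + s (a₂ * b₃ + a₃ * b₂ + s (a₃ * b₃))
      + (a₀ + s (a₁ + s (a₂ + s a₃))) * Q + R * (b₀ + s (b₁ + s (b₂ + s (b₃ + s Q)))),
    ?_, fun i x hx => ?_⟩
  · exact (((((h1.mul k3).add (h2.mul k2)).add (h3.mul k1)).add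
      (hs (((h2.mul k3).add (h3.mul k2)).add (hs (h3.mul k3))))).add
      ((h0.add (hs (h1.add (hs (h2.add (hs h3)))))).mul hQ)).add
      (hR.mul (k0.add (hs (k1.add (hs (k2.add (hs (k3.add (hs hQ)))))))))
  · simp only [Pi.add_apply, Pi.mul_apply, Pi.smul_apply, smul_eq_mul, he i x hx, he' i x hx, s]
    ring

theorem dx (hf : Jet κ (n + 1) a₀ a₁ a₂ a₃ f) :
    Jet κ n (fun i => dx (a₀ i)) (fun i => dx (a₁ i)) (fun i => dx (a₂ i)) (fun i => dx (a₃ i))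
      (fun i => dx (f i)) := by
  obtain ⟨⟨h0, h1, h2, h3⟩, R, hR, he⟩ := hf
  refine ⟨⟨h0.dx, h1.dx, h2.dx, h3.dx⟩, fun i => ShallowWater.dx (R i), hR.dx, fun i x hx => ?_⟩
  have d := fun {f : ι → ℝ → ℝ} (hf : Bd (n + 1) f) => hasDerivWithinAt_dx (hf.diff i) hx
  exact dx_eq hx ((((((d h0).add ((d h1).const_mul (κ i))).add
    ((d h2).const_mul (κ i ^ 2))).add ((d h3).const_mul (κ i ^ 3))).add
    ((d hR).const_mul (κ i ^ 4))).congr (fun y hy => he i y hy) (he i x hx))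

end Jet

/-! ### Consistency of the Runge-Kutta scheme -/

/-- The functions `e j`, `w j` stand for the time derivatives of order `j ≤ 4` of `η` and `u`; the
fields are the equations obtained by differentiating the shallow water equations in time, and
bounds that are uniform in the family. -/
structure TimeDerivatives (n : ℕ) (e w : ℕ → ι → ℝ → ℝ) : Prop where
  bd_e : ∀ j ≤ 4, Bd n (e j)
  bd_w : ∀ j ≤ 4, Bd n (w j)
  e₁ : ∀ i, EqOn (e 1 i) (-dx (w 0 i + e 0 i * w 0 i)) (Icc 0 1)
  e₂ : ∀ i, EqOn (e 2 i) (-dx (w 1 i + e 0 i * w 1 i + e 1 i * w 0 i)) (Icc 0 1)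
  e₃ : ∀ i, EqOn (e 3 i)
    (-dx (w 2 i + e 0 i * w 2 i + (2 : ℝ) • (e 1 i * w 1 i) + e 2 i * w 0 i)) (Icc 0 1)
  e₄ : ∀ i, EqOn (e 4 i) (-dx (w 3 i + e 0 i * w 3 i + (3 : ℝ) • (e 1 i * w 2 i)
    + (3 : ℝ) • (e 2 i * w 1 i) + e 3 i * w 0 i)) (Icc 0 1)
  w₁ : ∀ i, EqOn (w 1 i) (-dx (e 0 i + (1 / 2 : ℝ) • (w 0 i * w 0 i))) (Icc 0 1)
  w₂ : ∀ i, EqOn (w 2 i) (-dx (e 1 i + w 0 i * w 1 i)) (Icc 0 1)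
  w₃ : ∀ i, EqOn (w 3 i) (-dx (e 2 i + w 0 i * w 2 i + w 1 i * w 1 i)) (Icc 0 1)
  w₄ : ∀ i, EqOn (w 4 i) (-dx (e 3 i + w 0 i * w 3 i + (3 : ℝ) • (w 1 i * w 2 i))) (Icc 0 1)

end families

section consistency
variable {ι : Type*} {κ : ι → ℝ} {n : ℕ}

theorem dx_of_eqOn_smul {f g : ℝ → ℝ} {x : ℝ} (hx : x ∈ Icc (0 : ℝ) 1) (c : ℝ)
    (h : ∀ y ∈ Icc (0 : ℝ) 1, f y = c * g y) : dx f x = c * dx g x := by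
  rw [dx_congr (g := c • g) h hx]
  exact derivWithin_const_smul_field c g

/-- The expansion of a stage from the expansion of the flux at the preceding stage. -/
theorem Jet.stage {a₀ a₁ a₂ a₃ b₁ b₂ b₃ f v : ι → ℝ → ℝ} (hκ : ∃ T, ∀ i, |κ i| ≤ T) (a : ℝ)
    (hf : Jet κ (n + 1) a₀ a₁ a₂ a₃ f) (hv : Bd n v)
    (h₁ : ∀ i, ∀ x ∈ Icc (0 : ℝ) 1, -a * ShallowWater.dx (a₀ i) x = b₁ i x)
    (h₂ : ∀ i, ∀ x ∈ Icc (0 : ℝ) 1, -a * ShallowWater.dx (a₁ i) x = b₂ i x)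
    (h₃ : ∀ i, ∀ x ∈ Icc (0 : ℝ) 1, -a * ShallowWater.dx (a₂ i) x = b₃ i x) :
    Jet κ n v b₁ b₂ b₃ (fun i => v i - (κ i * a) • ShallowWater.dx (f i)) := by
  refine ((Jet.of_bd hv).add ((hf.dx.step hκ).smul (-a))).congr (fun i x _ => ?_)
    (fun i x hx => ?_) (fun i x hx => ?_) (fun i x hx => ?_) (fun i x _ => ?_)
  · simp
  · simp [← h₁ i x hx]
  · simp [← h₂ i x hx]
  · simp [← h₃ i x hx]
  · simp; ring

/-- The fluxes of the four stages agree up to order four with the Taylor expansion of the time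
derivative: the order conditions of the scheme. -/
theorem TimeDerivatives.jet_sum_flux {e w : ℕ → ι → ℝ → ℝ} (hκ : ∃ T, ∀ i, |κ i| ≤ T)
    (H : TimeDerivatives (n + 4) e w) :
    (∃ R, Bd n R ∧ ∀ i, ∀ x ∈ Icc (0 : ℝ) 1,
      dx (∑ j ∈ Finset.Icc 1 4, rkB j • flux (exactStage (κ i) (e 0 i) (w 0 i) (j - 1))) x
        = -(e 1 i x + κ i / 2 * e 2 i x + κ i ^ 2 / 6 * e 3 i x + κ i ^ 3 / 24 * e 4 i x)
          + κ i ^ 4 * R i x) ∧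
    (∃ R, Bd n R ∧ ∀ i, ∀ x ∈ Icc (0 : ℝ) 1,
      dx (∑ j ∈ Finset.Icc 1 4, rkB j • potential (exactStage (κ i) (e 0 i) (w 0 i) (j - 1))) x
        = -(w 1 i x + κ i / 2 * w 2 i x + κ i ^ 2 / 6 * w 3 i x + κ i ^ 3 / 24 * w 4 i x)
          + κ i ^ 4 * R i x) := by
  let V : ℕ → ι → ℝ → ℝ := fun j i => (exactStage (κ i) (e 0 i) (w 0 i) j).1
  let W : ℕ → ι → ℝ → ℝ := fun j i => (exactStage (κ i) (e 0 i) (w 0 i) j).2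
  have bde := fun {j m : ℕ} (hj : j ≤ 4) (hm : m ≤ n + 4) => (H.bd_e j hj).of_le hm
  have bdw := fun {j m : ℕ} (hj : j ≤ 4) (hm : m ≤ n + 4) => (H.bd_w j hj).of_le hm
  -- `(b₁, b₂)` is the quadratic part of the nonlinearity, evaluated at the first time derivative.
  let b₁ : ι → ℝ → ℝ := fun i => -dx (e 1 i * w 1 i)
  let b₂ : ι → ℝ → ℝ := fun i => -dx ((1 / 2 : ℝ) • (w 1 i * w 1 i))
  let a₁ : ι → ℝ → ℝ := fun i => -dx (w 2 i + e 0 i * w 2 i + e 2 i * w 0 i + e 1 i * w 1 i)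
  let a₂ : ι → ℝ → ℝ := fun i => -dx (e 2 i + w 0 i * w 2 i + (1 / 2 : ℝ) • (w 1 i * w 1 i))
  have V0 : Jet κ (n + 4) (e 0) 0 0 0 (V 0) := .of_bd (H.bd_e 0 (by norm_num))
  have W0 : Jet κ (n + 4) (w 0) 0 0 0 (W 0) := .of_bd (H.bd_w 0 (by norm_num))
  have f0 := W0.add (V0.mul hκ W0)
  have p0 := V0.add ((W0.mul hκ W0).smul (1 / 2))
  have V1 : Jet κ (n + 3) (e 0) ((1 / 2 : ℝ) • e 1) 0 0 (V 1) := by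
    refine Jet.stage hκ (1 / 2) f0 (bde (by norm_num) (by omega)) (fun i x hx => ?_)
      (fun i x hx => ?_) (fun i x hx => ?_)
    · rw [Pi.smul_apply, Pi.smul_apply, smul_eq_mul, H.e₁ i hx, Pi.neg_apply,
        dx_of_eqOn_smul hx 1 (g := w 0 i + e 0 i * w 0 i) fun y _ => by simp]
      ring
    · rw [dx_of_eqOn_smul hx 0 (g := 0) fun y _ => by simp]; simp
    · rw [dx_of_eqOn_smul hx 0 (g := 0) fun y _ => by simp]; simp
  have W1 : Jet κ (n + 3) (w 0) ((1 / 2 : ℝ) • w 1) 0 0 (W 1) := by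
    refine Jet.stage hκ (1 / 2) p0 (bdw (by norm_num) (by omega)) (fun i x hx => ?_)
      (fun i x hx => ?_) (fun i x hx => ?_)
    · rw [Pi.smul_apply, Pi.smul_apply, smul_eq_mul, H.w₁ i hx, Pi.neg_apply,
        dx_of_eqOn_smul hx 1 (g := e 0 i + (1 / 2 : ℝ) • (w 0 i * w 0 i)) fun y _ => by simp]
      ring
    · rw [dx_of_eqOn_smul hx 0 (g := 0) fun y _ => by simp]; simp
    · rw [dx_of_eqOn_smul hx 0 (g := 0) fun y _ => by simp]; simp
  have f1 := W1.add (V1.mul hκ W1)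
  have p1 := V1.add ((W1.mul hκ W1).smul (1 / 2))
  have V2 : Jet κ (n + 2) (e 0) ((1 / 2 : ℝ) • e 1) ((1 / 4 : ℝ) • e 2) ((1 / 8 : ℝ) • b₁)
      (V 2) := by
    refine Jet.stage hκ (1 / 2) f1 (bde (by norm_num) (by omega)) (fun i x hx => ?_)
      (fun i x hx => ?_) (fun i x hx => ?_)
    · rw [Pi.smul_apply, Pi.smul_apply, smul_eq_mul, H.e₁ i hx, Pi.neg_apply,
        dx_of_eqOn_smul hx 1 (g := w 0 i + e 0 i * w 0 i) fun y _ => by simp]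
      ring
    · rw [Pi.smul_apply, Pi.smul_apply, smul_eq_mul, H.e₂ i hx, Pi.neg_apply,
        dx_of_eqOn_smul hx (1 / 2) (g := w 1 i + e 0 i * w 1 i + e 1 i * w 0 i)
          fun y _ => by simp; ring]
      ring
    · rw [dx_of_eqOn_smul hx (1 / 4) (g := e 1 i * w 1 i) fun y _ => by simp; ring]
      simp [b₁]; ring
  have W2 : Jet κ (n + 2) (w 0) ((1 / 2 : ℝ) • w 1) ((1 / 4 : ℝ) • w 2) ((1 / 8 : ℝ) • b₂)
      (W 2) := by
    refine Jet.stage hκ (1 / 2) p1 (bdw (by norm_num) (by omega)) (fun i x hx => ?_)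
      (fun i x hx => ?_) (fun i x hx => ?_)
    · rw [Pi.smul_apply, Pi.smul_apply, smul_eq_mul, H.w₁ i hx, Pi.neg_apply,
        dx_of_eqOn_smul hx 1 (g := e 0 i + (1 / 2 : ℝ) • (w 0 i * w 0 i)) fun y _ => by simp]
      ring
    · rw [Pi.smul_apply, Pi.smul_apply, smul_eq_mul, H.w₂ i hx, Pi.neg_apply,
        dx_of_eqOn_smul hx (1 / 2) (g := e 1 i + w 0 i * w 1 i) fun y _ => by simp; ring]
      ring
    · rw [dx_of_eqOn_smul hx (1 / 4) (g := (1 / 2 : ℝ) • (w 1 i * w 1 i))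
        fun y _ => by simp; ring]
      simp only [b₂, Pi.smul_apply, Pi.neg_apply, smul_eq_mul]; ring
  have f2 := W2.add (V2.mul hκ W2)
  have p2 := V2.add ((W2.mul hκ W2).smul (1 / 2))
  have V3 : Jet κ (n + 1) (e 0) (e 1) ((1 / 2 : ℝ) • e 2) ((1 / 4 : ℝ) • a₁) (V 3) := by
    refine Jet.stage hκ 1 f2 (bde (by norm_num) (by omega)) (fun i x hx => ?_)
      (fun i x hx => ?_) (fun i x hx => ?_)
    · rw [H.e₁ i hx, Pi.neg_apply,
        dx_of_eqOn_smul hx 1 (g := w 0 i + e 0 i * w 0 i) fun y _ => by simp]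
      ring
    · rw [Pi.smul_apply, Pi.smul_apply, smul_eq_mul, H.e₂ i hx, Pi.neg_apply,
        dx_of_eqOn_smul hx (1 / 2) (g := w 1 i + e 0 i * w 1 i + e 1 i * w 0 i)
          fun y _ => by simp; ring]
      ring
    · rw [dx_of_eqOn_smul hx (1 / 4) (g := w 2 i + e 0 i * w 2 i + e 2 i * w 0 i + e 1 i * w 1 i)
        fun y _ => by simp; ring]
      simp only [a₁, Pi.smul_apply, Pi.neg_apply, smul_eq_mul]; ring
  have W3 : Jet κ (n + 1) (w 0) (w 1) ((1 / 2 : ℝ) • w 2) ((1 / 4 : ℝ) • a₂) (W 3) := by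
    refine Jet.stage hκ 1 p2 (bdw (by norm_num) (by omega)) (fun i x hx => ?_)
      (fun i x hx => ?_) (fun i x hx => ?_)
    · rw [H.w₁ i hx, Pi.neg_apply,
        dx_of_eqOn_smul hx 1 (g := e 0 i + (1 / 2 : ℝ) • (w 0 i * w 0 i)) fun y _ => by simp]
      ring
    · rw [Pi.smul_apply, Pi.smul_apply, smul_eq_mul, H.w₂ i hx, Pi.neg_apply,
        dx_of_eqOn_smul hx (1 / 2) (g := e 1 i + w 0 i * w 1 i) fun y _ => by simp; ring]
      ring
    · rw [dx_of_eqOn_smul hx (1 / 4) (g := e 2 i + w 0 i * w 2 i + (1 / 2 : ℝ) • (w 1 i * w 1 i))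
        fun y _ => by simp; ring]
      simp only [a₂, Pi.smul_apply, Pi.neg_apply, smul_eq_mul]; ring
  have f3 := W3.add (V3.mul hκ W3)
  have p3 := V3.add ((W3.mul hκ W3).smul (1 / 2))
  -- Both fields of the third time derivative are recovered from the two quadratic terms.
  have ab₁ : ∀ i, ∀ x ∈ Icc (0 : ℝ) 1, a₁ i x + b₁ i x = e 3 i x := fun i x hx => by
    have d := fun {f : ι → ℝ → ℝ} (hf : Bd (n + 4) f) => hf.diff i
    have hw2 := H.bd_w 2 (by norm_num)
    have hA := ((hw2.add ((H.bd_e 0 (by norm_num)).mul hw2)).add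
      ((H.bd_e 2 (by norm_num)).mul (H.bd_w 0 (by norm_num))))
    have hB := (H.bd_e 1 (by norm_num)).mul (H.bd_w 1 (by norm_num))
    have h := dx_add (d (hA.add hB)) (d hB) hx
    rw [H.e₃ i hx, Pi.neg_apply, dx_of_eqOn_smul hx 1 (g := (w 2 + e 0 * w 2 + e 2 * w 0
      + e 1 * w 1) i + (e 1 * w 1) i) fun y _ => by simp; ring, h]
    simp only [a₁, b₁, Pi.neg_apply]
    change -dx (w 2 i + e 0 i * w 2 i + e 2 i * w 0 i + e 1 i * w 1 i) x + -dx (e 1 i * w 1 i) x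
      = -(1 * (dx (w 2 i + e 0 i * w 2 i + e 2 i * w 0 i + e 1 i * w 1 i) x
        + dx (e 1 i * w 1 i) x))
    ring
  have ab₂ : ∀ i, ∀ x ∈ Icc (0 : ℝ) 1, a₂ i x + b₂ i x = w 3 i x := fun i x hx => by
    have d := fun {f : ι → ℝ → ℝ} (hf : Bd (n + 4) f) => hf.diff i
    have hA := (H.bd_e 2 (by norm_num)).add
      ((H.bd_w 0 (by norm_num)).mul (H.bd_w 2 (by norm_num)))
    have hB := ((H.bd_w 1 (by norm_num)).mul (H.bd_w 1 (by norm_num))).smul (1 / 2)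
    have h := dx_add (d (hA.add hB)) (d hB) hx
    rw [H.w₃ i hx, Pi.neg_apply, dx_of_eqOn_smul hx 1 (g := (e 2 + w 0 * w 2
      + (1 / 2 : ℝ) • (w 1 * w 1)) i + ((1 / 2 : ℝ) • (w 1 * w 1)) i) fun y _ => by simp; ring, h]
    simp only [a₂, b₂, Pi.neg_apply]
    change -dx (e 2 i + w 0 i * w 2 i + (1 / 2 : ℝ) • (w 1 i * w 1 i)) x
        + -dx ((1 / 2 : ℝ) • (w 1 i * w 1 i)) x
      = -(1 * (dx (e 2 i + w 0 i * w 2 i + (1 / 2 : ℝ) • (w 1 i * w 1 i)) x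
        + dx ((1 / 2 : ℝ) • (w 1 i * w 1 i)) x))
    ring
  have Sf := ((f0.of_le (m := n + 1) (by omega)).smul (1 / 6)).add
    (((f1.of_le (m := n + 1) (by omega)).smul (1 / 3)).add
      (((f2.of_le (m := n + 1) (by omega)).smul (1 / 3)).add (f3.smul (1 / 6))))
  have Sp := ((p0.of_le (m := n + 1) (by omega)).smul (1 / 6)).add
    (((p1.of_le (m := n + 1) (by omega)).smul (1 / 3)).add
      (((p2.of_le (m := n + 1) (by omega)).smul (1 / 3)).add (p3.smul (1 / 6))))
  let F₀ := w 0 + e 0 * w 0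
  let F₁ := w 1 + e 0 * w 1 + e 1 * w 0
  let F₂ := w 2 + e 0 * w 2 + (2 : ℝ) • (e 1 * w 1) + e 2 * w 0
  let F₃ := w 3 + e 0 * w 3 + (3 : ℝ) • (e 1 * w 2) + (3 : ℝ) • (e 2 * w 1) + e 3 * w 0
  let P₀ := e 0 + (1 / 2 : ℝ) • (w 0 * w 0)
  let P₁ := e 1 + w 0 * w 1
  let P₂ := e 2 + w 0 * w 2 + w 1 * w 1
  let P₃ := e 3 + w 0 * w 3 + (3 : ℝ) • (w 1 * w 2)
  have Sf' := Sf.congr (b₀ := F₀) (b₁ := (1 / 2 : ℝ) • F₁) (b₂ := (1 / 6 : ℝ) • F₂)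
    (b₃ := (1 / 24 : ℝ) • F₃) (fun i y _ => by simp [F₀]; ring) (fun i y _ => by simp [F₁]; ring)
    (fun i y _ => by simp [F₂]; ring)
    (fun i y hy => by simp [F₃, ← ab₁ i y hy, ← ab₂ i y hy]; ring) (fun i y _ => rfl)
  have Sp' := Sp.congr (b₀ := P₀) (b₁ := (1 / 2 : ℝ) • P₁) (b₂ := (1 / 6 : ℝ) • P₂)
    (b₃ := (1 / 24 : ℝ) • P₃) (fun i y _ => by simp [P₀]; ring) (fun i y _ => by simp [P₁]; ring)
    (fun i y _ => by simp [P₂]; ring)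
    (fun i y hy => by simp [P₃, ← ab₁ i y hy, ← ab₂ i y hy]; ring) (fun i y _ => rfl)
  have scale : ∀ (c : ℝ) (F : ι → ℝ → ℝ) (i : ι) {x : ℝ}, x ∈ Icc (0 : ℝ) 1 →
      dx ((c • F) i) x = c * dx (F i) x :=
    fun c F i x hx => dx_of_eqOn_smul hx c fun _ _ => rfl
  constructor
  · obtain ⟨-, R, hR, hJ⟩ := Sf'.dx
    refine ⟨R, hR, fun i x hx => ?_⟩
    rw [sum_rkB (fun j => flux (exactStage (κ i) (e 0 i) (w 0 i) j))]
    refine (hJ i x hx).trans ?_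
    beta_reduce
    rw [scale _ _ _ hx, scale _ _ _ hx, scale _ _ _ hx, H.e₁ i hx, H.e₂ i hx, H.e₃ i hx, H.e₄ i hx]
    change dx (F₀ i) x + κ i * (1 / 2 * dx (F₁ i) x) + κ i ^ 2 * (1 / 6 * dx (F₂ i) x)
        + κ i ^ 3 * (1 / 24 * dx (F₃ i) x) + κ i ^ 4 * R i x
      = -(-dx (F₀ i) x + κ i / 2 * -dx (F₁ i) x + κ i ^ 2 / 6 * -dx (F₂ i) x
        + κ i ^ 3 / 24 * -dx (F₃ i) x) + κ i ^ 4 * R i x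
    ring
  · obtain ⟨-, R, hR, hJ⟩ := Sp'.dx
    refine ⟨R, hR, fun i x hx => ?_⟩
    rw [sum_rkB (fun j => potential (exactStage (κ i) (e 0 i) (w 0 i) j))]
    refine (hJ i x hx).trans ?_
    beta_reduce
    rw [scale _ _ _ hx, scale _ _ _ hx, scale _ _ _ hx, H.w₁ i hx, H.w₂ i hx, H.w₃ i hx, H.w₄ i hx]
    change dx (P₀ i) x + κ i * (1 / 2 * dx (P₁ i) x) + κ i ^ 2 * (1 / 6 * dx (P₂ i) x)
        + κ i ^ 3 * (1 / 24 * dx (P₃ i) x) + κ i ^ 4 * R i x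
      = -(-dx (P₀ i) x + κ i / 2 * -dx (P₁ i) x + κ i ^ 2 / 6 * -dx (P₂ i) x
        + κ i ^ 3 / 24 * -dx (P₃ i) x) + κ i ^ 4 * R i x
    ring

end consistency

/-! ### Parity at the end points -/

/-- For `odd = true` the derivatives of `f` of even order `≤ p` vanish at `x₀`, for `odd = false`
those of odd order: up to order `p`, `f` behaves like a function that is odd, respectively even,
with respect to reflection at `x₀`. -/
def Parity (x₀ : ℝ) : Bool → ℕ → (ℝ → ℝ) → Prop
  | odd, 0, f => odd = true → f x₀ = 0
  | odd, p + 1, f => (odd = true → f x₀ = 0) ∧ Parity x₀ (!odd) p (dx f)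

namespace Parity
variable {x₀ : ℝ} {b c : Bool} {p : ℕ} {f g : ℝ → ℝ} {K L : ℝ}

theorem apply (h : Parity x₀ b p f) (hb : b = true) : f x₀ = 0 := by
  cases p with
  | zero => exact h hb
  | succ p => exact h.1 hb

theorem of_succ (h : Parity x₀ b (p + 1) f) : Parity x₀ b p f := by
  induction p generalizing b f with
  | zero => exact h.1
  | succ p ih => exact ⟨h.1, ih h.2⟩

theorem of_le {q : ℕ} (h : Parity x₀ b p f) (hq : q ≤ p) : Parity x₀ b q f := by
  induction p, hq using Nat.le_induction with
  | base => exact h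
  | succ n _ ih => exact ih h.of_succ

theorem congr (hx : x₀ ∈ Icc (0 : ℝ) 1) (h : Parity x₀ b p f) (hfg : EqOn f g (Icc 0 1)) :
    Parity x₀ b p g := by
  induction p generalizing b f g with
  | zero => exact fun hb => hfg hx ▸ h hb
  | succ p ih => exact ⟨fun hb => hfg hx ▸ h.1 hb, ih h.2 (dx_congr hfg)⟩

theorem add (hx : x₀ ∈ Icc (0 : ℝ) 1) (hf : CBound p K f) (hg : CBound p L g)
    (pf : Parity x₀ b p f) (pg : Parity x₀ b p g) : Parity x₀ b p (f + g) := by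
  have h0 : b = true → (f + g) x₀ = 0 := fun hb => by
    rw [Pi.add_apply, pf.apply hb, pg.apply hb, add_zero]
  induction p generalizing b f g with
  | zero => exact h0
  | succ p ih =>
    refine ⟨h0, (ih hf.dx hg.dx pf.2 pg.2 fun hb => ?_).congr hx
      fun y hy => (dx_add hf.1 hg.1 hy).symm⟩
    rw [Pi.add_apply, pf.2.apply hb, pg.2.apply hb, add_zero]

theorem const_smul (hx : x₀ ∈ Icc (0 : ℝ) 1) (a : ℝ) (pf : Parity x₀ b p f) :
    Parity x₀ b p (a • f) := by
  induction p generalizing b f with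
  | zero => exact fun hb => by simp [pf.apply hb]
  | succ p ih =>
    exact ⟨fun hb => by simp [pf.apply hb], (ih pf.2).congr hx
      fun y hy => (dx_of_eqOn_smul hy a fun _ _ => rfl).symm⟩

theorem mul (hx : x₀ ∈ Icc (0 : ℝ) 1) (hf : CBound p K f) (hg : CBound p L g)
    (pf : Parity x₀ b p f) (pg : Parity x₀ c p g) : Parity x₀ (b ^^ c) p (f * g) := by
  have h0 : ∀ {b c : Bool} {p : ℕ} {f g : ℝ → ℝ}, Parity x₀ b p f → Parity x₀ c p g →
      (b ^^ c) = true → (f * g) x₀ = 0 := by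
    intro b c p f g pf pg hb
    cases b with
    | true => simp [pf.apply rfl]
    | false => simp [pg.apply (by simpa using hb)]
  induction p generalizing b c f g with
  | zero => exact h0 pf pg
  | succ p ih =>
    have h1 := ih hf.dx hg.of_succ pf.2 pg.of_succ
    have h2 := ih hf.of_succ hg.dx pf.of_succ pg.2
    rw [Bool.not_xor] at h1
    rw [Bool.xor_not] at h2
    exact ⟨h0 pf pg, (add hx (hf.dx.mul hg.of_succ) (hf.of_succ.mul hg.dx) h1 h2).congr hx
      fun y hy => (dx_mul hf.1 hg.1 hy).symm⟩

end Parity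

/-- In the exact stages the first component stays even and the second one odd; each stage costs one
derivative. -/
theorem parity_exactStage {x₀ : ℝ} (hx : x₀ ∈ Icc (0 : ℝ) 1) (k : ℝ) {v w : ℝ → ℝ} {p : ℕ} (j : ℕ)
    (hv : Bd (p + j) fun _ : Unit => v) (hw : Bd (p + j) fun _ : Unit => w)
    (pv : Parity x₀ false (p + j) v) (pw : Parity x₀ true (p + j) w) :
    Parity x₀ false p (exactStage k v w j).1 ∧ Parity x₀ true p (exactStage k v w j).2 := by
  induction j generalizing p with
  | zero => exact ⟨pv, pw⟩
  | succ j ih =>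
    have hle : p + 1 + j ≤ p + (j + 1) := by omega
    obtain ⟨p1, p2⟩ := ih (hv.of_le hle) (hw.of_le hle) (pv.of_le hle) (pw.of_le hle)
    have hb := bd_exactStage (κ := fun _ : Unit => k) ⟨|k|, fun _ => le_rfl⟩ j
      (hv.of_le hle) (hw.of_le hle)
    obtain ⟨⟨K, hK⟩, L, hL⟩ := hb
    have hK := hK ()
    have hL := hL ()
    obtain ⟨Kv, hKv⟩ := hv.of_le (m := p) (by omega)
    obtain ⟨Kw, hKw⟩ := hw.of_le (m := p) (by omega)
    have hflux : CBound (p + 1) _ (flux (exactStage k v w j)) := hL.add (hK.mul hL)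
    have hpot : CBound (p + 1) _ (potential (exactStage k v w j)) :=
      hK.add ((hL.mul hL).const_smul le_rfl)
    have pflux : Parity x₀ true (p + 1) (flux (exactStage k v w j)) :=
      p2.add hx hL (hK.mul hL) (p1.mul hx hK hL p2)
    have ppot : Parity x₀ false (p + 1) (potential (exactStage k v w j)) :=
      p1.add hx hK ((hL.mul hL).const_smul le_rfl) ((p2.mul hx hL hL p2).const_smul hx _)
    have e : ∀ (f g : ℝ → ℝ) (c : ℝ), f + (-c) • g = f - c • g := fun f g c => by module
    constructor
    · change Parity x₀ false p (v - _ • dx (flux (exactStage k v w j)))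
      rw [← e]
      exact (pv.of_le (by omega)).add hx (hKv ()) (hflux.dx.const_smul le_rfl)
        (pflux.2.const_smul hx _)
    · change Parity x₀ true p (w - _ • dx (potential (exactStage k v w j)))
      rw [← e]
      exact (pw.of_le (by omega)).add hx (hKw ()) (hpot.dx.const_smul le_rfl)
        (ppot.2.const_smul hx _)

theorem dx_dx_mul {f g : ℝ → ℝ} {K L x : ℝ} (hf : CBound 2 K f) (hg : CBound 2 L g)
    (hx : x ∈ Icc (0 : ℝ) 1) :
    dx (dx (f * g)) x = dx (dx f) x * g x + 2 * (dx f x * dx g x) + f x * dx (dx g) x := by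
  have h : EqOn (dx (f * g)) (dx f * g + f * dx g) (Icc 0 1) := fun y hy =>
    dx_mul hf.diff hg.diff hy
  rw [dx_congr h hx, dx_add (hf.dx.diff.mul hg.diff) (hf.diff.mul hg.dx.diff) hx,
    dx_mul hf.dx.diff hg.diff hx, dx_mul hf.diff hg.dx.diff hx]
  ring

/-- The compatibility conditions: where `u = 0` and `1 + η ≠ 0` at an end point, the equations force
`η_x = u_xx = η_xxx = 0` there. -/
theorem TimeDerivatives.parity {ι : Type*} {n : ℕ} {e w : ℕ → ι → ℝ → ℝ}
    (H : TimeDerivatives (n + 3) e w) {x₀ : ℝ} (hx : x₀ ∈ Icc (0 : ℝ) 1) (i : ι)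
    (hw : ∀ j ≤ 3, w j i x₀ = 0) (he : 1 + e 0 i x₀ ≠ 0) :
    Parity x₀ false 3 (e 0 i) ∧ Parity x₀ true 3 (w 0 i) := by
  have be := fun j (hj : j ≤ 4) => ((H.bd_e j hj).of_le (m := 3) (by omega)).imp fun _ h => h i
  have bw := fun j (hj : j ≤ 4) => ((H.bd_w j hj).of_le (m := 3) (by omega)).imp fun _ h => h i
  obtain ⟨_, e0⟩ := be 0 (by norm_num)
  obtain ⟨_, e1⟩ := be 1 (by norm_num)
  obtain ⟨_, e2⟩ := be 2 (by norm_num)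
  obtain ⟨_, w0⟩ := bw 0 (by norm_num)
  obtain ⟨_, w1⟩ := bw 1 (by norm_num)
  obtain ⟨_, w2⟩ := bw 2 (by norm_num)
  have z0 := hw 0 (by norm_num)
  have z1 := hw 1 (by norm_num)
  have z2 := hw 2 (by norm_num)
  have z3 := hw 3 (by norm_num)
  have q00 := (w0.mul w0).const_smul (c := (1 / 2 : ℝ)) le_rfl
  -- `η_x = η_xt = η_xtt = 0`, from the momentum equation differentiated in time.
  have d0 : dx (e 0 i) x₀ = 0 := by
    have h := H.w₁ i hx
    rw [Pi.neg_apply, dx_add e0.diff q00.diff hx, dx_smul _ (w0.mul w0).diff hx,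
      dx_mul w0.diff w0.diff hx, z0, z1] at h
    linarith
  have d1 : dx (e 1 i) x₀ = 0 := by
    have h := H.w₂ i hx
    rw [Pi.neg_apply, dx_add e1.diff (w0.mul w1).diff hx, dx_mul w0.diff w1.diff hx, z0, z1,
      z2] at h
    linarith
  have d2 : dx (e 2 i) x₀ = 0 := by
    have h := H.w₃ i hx
    rw [Pi.neg_apply, dx_add (e2.add (w0.mul w2)).diff (w1.mul w1).diff hx,
      dx_add e2.diff (w0.mul w2).diff hx, dx_mul w0.diff w2.diff hx,
      dx_mul w1.diff w1.diff hx, z0, z1, z2, z3] at h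
    linarith
  have neg_dx : ∀ f : ℝ → ℝ, dx (-f) x₀ = -dx f x₀ := fun f => by
    have := dx_of_eqOn_smul (f := -f) (g := f) hx (-1) fun y _ => by simp
    simpa using this
  -- `u_xx = u_xxt = 0`, from the mass equation differentiated in space.
  have ww0 : dx (dx (w 0 i)) x₀ = 0 := by
    have h := dx_congr (H.e₁ i) hx
    have e' : EqOn (dx (w 0 i + e 0 i * w 0 i)) (dx (w 0 i) + dx (e 0 i * w 0 i)) (Icc 0 1) :=
      fun y hy => dx_add w0.diff (e0.mul w0).diff hy
    rw [neg_dx, dx_congr e' hx, dx_add w0.dx.diff (e0.mul w0).dx.diff hx,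
      dx_dx_mul e0.of_succ w0.of_succ hx, z0, d0, d1] at h
    have h' : (1 + e 0 i x₀) * dx (dx (w 0 i)) x₀ = 0 := by linarith
    exact (mul_eq_zero.1 h').resolve_left he
  have ww1 : dx (dx (w 1 i)) x₀ = 0 := by
    have h := dx_congr (H.e₂ i) hx
    have e' : EqOn (dx (w 1 i + e 0 i * w 1 i + e 1 i * w 0 i))
        (dx (w 1 i) + dx (e 0 i * w 1 i) + dx (e 1 i * w 0 i)) (Icc 0 1) := fun y hy => by
      rw [dx_add (w1.add (e0.mul w1)).diff (e1.mul w0).diff hy,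
        dx_add w1.diff (e0.mul w1).diff hy]
      rfl
    rw [neg_dx, dx_congr e' hx,
      dx_add (w1.dx.add (e0.mul w1).dx).diff (e1.mul w0).dx.diff hx,
      dx_add w1.dx.diff (e0.mul w1).dx.diff hx,
      dx_dx_mul e0.of_succ w1.of_succ hx, dx_dx_mul e1.of_succ w0.of_succ hx, z0, z1, d0, d1, d2,
      ww0] at h
    have h' : (1 + e 0 i x₀) * dx (dx (w 1 i)) x₀ = 0 := by linarith
    exact (mul_eq_zero.1 h').resolve_left he
  have pw : Parity x₀ true 3 (w 0 i) :=
    ⟨fun _ => z0, nofun, fun _ => ww0, nofun⟩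
  -- `η_xxx = 0`, from the momentum equation differentiated twice in space.
  have e3 : dx (dx (dx (e 0 i))) x₀ = 0 := by
    have hodd : dx (dx (dx ((1 / 2 : ℝ) • (w 0 i * w 0 i)))) x₀ = 0 :=
      ((pw.mul hx w0 w0 pw).const_smul hx (1 / 2)).2.2.2 rfl
    have e' : EqOn (w 1 i) ((-1 : ℝ) • (dx (e 0 i) + dx ((1 / 2 : ℝ) • (w 0 i * w 0 i))))
        (Icc 0 1) := fun y hy => by
      rw [H.w₁ i hy, Pi.neg_apply, dx_add e0.diff q00.diff hy]
      simp
    have e'' : EqOn (dx (w 1 i))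
        ((-1 : ℝ) • (dx (dx (e 0 i)) + dx (dx ((1 / 2 : ℝ) • (w 0 i * w 0 i))))) (Icc 0 1) :=
      fun y hy => by
        rw [dx_congr e' hy, dx_smul _ (e0.dx.add q00.dx).diff hy,
          dx_add e0.dx.diff q00.dx.diff hy]
        rfl
    have h := dx_congr e'' hx
    rw [dx_smul _ (e0.dx.dx.add q00.dx.dx).diff hx, dx_add e0.dx.dx.diff q00.dx.dx.diff hx,
      hodd, ww1] at h
    linarith
  exact ⟨⟨nofun, fun _ => d0, nofun, fun _ => e3⟩, pw⟩

/-! ### Partial derivatives on the space-time rectangle -/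

/-- The closed space-time rectangle. -/
def rect (T : ℝ) : Set (ℝ × ℝ) := Icc 0 1 ×ˢ Icc 0 T

/-- The partial derivative in direction `v` on the rectangle, one-sided on its boundary. -/
noncomputable def pd (T : ℝ) (v : ℝ × ℝ) (f : ℝ × ℝ → ℝ) : ℝ × ℝ → ℝ :=
  fun p => fderivWithin ℝ f (rect T) p v

section pd
variable {T : ℝ} {v : ℝ × ℝ} {f g : ℝ × ℝ → ℝ} {p : ℝ × ℝ} {n : ℕ}

theorem uniqueDiffOn_rect (hT : 0 < T) : UniqueDiffOn ℝ (rect T) :=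
  uniqueDiff.prod (uniqueDiffOn_Icc hT)

theorem isCompact_rect (T : ℝ) : IsCompact (rect T) := isCompact_Icc.prod isCompact_Icc

theorem pd_congr (h : EqOn f g (rect T)) : EqOn (pd T v f) (pd T v g) (rect T) := fun p hp => by
  simp only [pd, fderivWithin_congr h (h hp)]

theorem pd_add (hT : 0 < T) (hf : DifferentiableOn ℝ f (rect T))
    (hg : DifferentiableOn ℝ g (rect T)) (hp : p ∈ rect T) :
    pd T v (f + g) p = pd T v f p + pd T v g p := by
  rw [pd, fderivWithin_add (uniqueDiffOn_rect hT p hp) (hf p hp) (hg p hp)]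
  rfl

theorem pd_mul (hT : 0 < T) (hf : DifferentiableOn ℝ f (rect T))
    (hg : DifferentiableOn ℝ g (rect T)) (hp : p ∈ rect T) :
    pd T v (f * g) p = pd T v f p * g p + f p * pd T v g p := by
  rw [pd, fderivWithin_mul (uniqueDiffOn_rect hT p hp) (hf p hp) (hg p hp)]
  simp [pd]
  ring

theorem pd_smul (hT : 0 < T) (c : ℝ) (hf : DifferentiableOn ℝ f (rect T)) (hp : p ∈ rect T) :
    pd T v (c • f) p = c * pd T v f p := by
  rw [pd, fderivWithin_const_smul (uniqueDiffOn_rect hT p hp) (hf p hp)]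
  rfl

theorem contDiffOn_pd (hT : 0 < T) (v : ℝ × ℝ) (hf : ContDiffOn ℝ (n + 1 : ℕ) f (rect T)) :
    ContDiffOn ℝ n (pd T v f) (rect T) :=
  (hf.fderivWithin (uniqueDiffOn_rect hT) (by norm_cast)).clm_apply contDiffOn_const

theorem contDiffOn_pd_iterate (hT : 0 < T) (v : ℝ × ℝ) (j : ℕ)
    (hf : ContDiffOn ℝ (n + j : ℕ) f (rect T)) : ContDiffOn ℝ n ((pd T v)^[j] f) (rect T) := by
  induction j generalizing f with
  | zero => exact hf
  | succ j ih => exact ih (contDiffOn_pd hT v hf)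

theorem pd_comm (hT : 0 < T) (v w : ℝ × ℝ) (hf : ContDiffOn ℝ (2 : ℕ) f (rect T))
    (hp : p ∈ rect T) : pd T v (pd T w f) p = pd T w (pd T v f) p := by
  have hd : DifferentiableOn ℝ (fderivWithin ℝ f (rect T)) (rect T) :=
    (hf.fderivWithin (m := 1) (uniqueDiffOn_rect hT) (by norm_cast)).differentiableOn one_ne_zero
  have hpd : ∀ v w, pd T v (pd T w f) p
      = fderivWithin ℝ (fderivWithin ℝ f (rect T)) (rect T) p v w := fun v w => by
    change fderivWithin ℝ (fun q => fderivWithin ℝ f (rect T) q w) (rect T) p v = _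
    rw [fderivWithin_clm_apply (uniqueDiffOn_rect hT p hp) (hd p hp)
      (differentiableWithinAt_const w)]
    simp
  have hcl : p ∈ closure (interior (rect T)) := by
    rw [rect, interior_prod_eq, closure_prod_eq, interior_Icc, interior_Icc,
      closure_Ioo zero_ne_one, closure_Ioo hT.ne]
    exact hp
  have hsymm := (hf p hp).isSymmSndFDerivWithinAt (by simp) (uniqueDiffOn_rect hT) hcl hp
  rw [hpd, hpd]
  exact hsymm v w

theorem hasDerivWithinAt_space (hf : DifferentiableOn ℝ f (rect T)) {x t : ℝ}
    (hx : x ∈ Icc (0 : ℝ) 1) (ht : t ∈ Icc 0 T) :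
    HasDerivWithinAt (fun y => f (y, t)) (pd T (1, 0) f (x, t)) (Icc 0 1) x :=
  (hf (x, t) ⟨hx, ht⟩).hasFDerivWithinAt.comp_hasDerivWithinAt x (t := rect T)
    ((hasDerivWithinAt_id x _).prodMk (hasDerivWithinAt_const x _ t)) fun _ hy => ⟨hy, ht⟩

theorem hasDerivWithinAt_time (hf : DifferentiableOn ℝ f (rect T)) {x t : ℝ}
    (hx : x ∈ Icc (0 : ℝ) 1) (ht : t ∈ Icc 0 T) :
    HasDerivWithinAt (fun s => f (x, s)) (pd T (0, 1) f (x, t)) (Icc 0 T) t :=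
  (hf (x, t) ⟨hx, ht⟩).hasFDerivWithinAt.comp_hasDerivWithinAt t (t := rect T)
    ((hasDerivWithinAt_const t _ x).prodMk (hasDerivWithinAt_id t _)) fun _ hs => ⟨hx, hs⟩

theorem dx_eq_pd (hf : DifferentiableOn ℝ f (rect T)) {x t : ℝ}
    (hx : x ∈ Icc (0 : ℝ) 1) (ht : t ∈ Icc 0 T) :
    dx (fun y => f (y, t)) x = pd T (1, 0) f (x, t) :=
  dx_eq hx (hasDerivWithinAt_space hf hx ht)

/-- Twice continuous differentiability on the rectangle. -/
def C2Rect (T : ℝ) (f : ℝ × ℝ → ℝ) : Prop := ContDiffOn ℝ (2 : ℕ) f (rect T)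

theorem C2Rect.add (hf : C2Rect T f) (hg : C2Rect T g) : C2Rect T (f + g) := ContDiffOn.add hf hg

theorem C2Rect.mul (hf : C2Rect T f) (hg : C2Rect T g) : C2Rect T (f * g) := ContDiffOn.mul hf hg

theorem C2Rect.const_smul (hf : C2Rect T f) (c : ℝ) : C2Rect T (c • f) :=
  ContDiffOn.const_smul c hf

theorem C2Rect.diff (hf : C2Rect T f) : DifferentiableOn ℝ f (rect T) :=
  hf.differentiableOn (by simp)

/-- Sections in space of a function that is smooth on the rectangle are bounded in `C^n[0,1]`,
uniformly in time. -/
theorem exists_cBound (hT : 0 < T) (hf : ContDiffOn ℝ n f (rect T)) :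
    ∃ K, ∀ t ∈ Icc 0 T, CBound n K (fun x => f (x, t)) := by
  induction n generalizing f with
  | zero =>
    obtain ⟨K, hK⟩ := (isCompact_rect T).exists_bound_of_continuousOn hf.continuousOn
    exact ⟨K, fun t ht => ⟨hf.continuousOn.comp (by fun_prop) fun x hx => ⟨hx, ht⟩,
      fun x hx => hK (x, t) ⟨hx, ht⟩⟩⟩
  | succ n ih =>
    obtain ⟨K, hK⟩ := (isCompact_rect T).exists_bound_of_continuousOn hf.continuousOn
    obtain ⟨L, hL⟩ := ih (contDiffOn_pd hT (1, 0) hf)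
    have hd : DifferentiableOn ℝ f (rect T) := hf.differentiableOn (by simp)
    refine ⟨max K L, fun t ht =>
      ⟨fun x hx => (hasDerivWithinAt_space hd hx ht).differentiableWithinAt,
      fun x hx => (hK (x, t) ⟨hx, ht⟩).trans (le_max_left _ _), ?_⟩⟩
    exact ((hL t ht).mono_right (le_max_right _ _)).congr fun x hx => (dx_eq_pd hd hx ht).symm

end pd

/-- Taylor's formula of order four for a function with known derivatives. -/
theorem abs_taylor_remainder_le {g : ℕ → ℝ → ℝ} {a b C : ℝ} (hab : a < b)
    (hg : ContDiffOn ℝ 5 (g 0) (Icc a b))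
    (hd : ∀ i < 5, ∀ y ∈ Icc a b, HasDerivWithinAt (g i) (g (i + 1) y) (Icc a b) y)
    (hC : ∀ y ∈ Icc a b, |g 5 y| ≤ C) :
    |g 0 b - (g 0 a + (b - a) * g 1 a + (b - a) ^ 2 / 2 * g 2 a + (b - a) ^ 3 / 6 * g 3 a
      + (b - a) ^ 4 / 24 * g 4 a)| ≤ C * (b - a) ^ 5 / 24 := by
  have hu := uniqueDiffOn_Icc hab
  have hit : ∀ i ≤ 5, ∀ y ∈ Icc a b, iteratedDerivWithin i (g 0) (Icc a b) y = g i y := by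
    intro i
    induction i with
    | zero => intro _ y _; simp
    | succ i ih =>
      intro hi y hy
      rw [iteratedDerivWithin_succ, derivWithin_congr (ih (by omega)) (ih (by omega) y hy)]
      exact (hd i (by omega) y hy).derivWithin (hu y hy)
  have ha : a ∈ Icc a b := ⟨le_rfl, hab.le⟩
  have h := taylor_mean_remainder_bound (n := 4) (C := C) hab.le (by exact_mod_cast hg)
    (show b ∈ Icc a b from ⟨hab.le, le_rfl⟩) (fun y hy => by
      rw [hit 5 le_rfl y hy]; exact hC y hy)
  have e : taylorWithinEval (g 0) 4 (Icc a b) a b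
      = g 0 a + (b - a) * g 1 a + (b - a) ^ 2 / 2 * g 2 a + (b - a) ^ 3 / 6 * g 3 a
        + (b - a) ^ 4 / 24 * g 4 a := by
    rw [taylor_within_apply]
    simp only [Finset.sum_range_succ, Finset.sum_range_zero, hit 0 (by norm_num) a ha,
      hit 1 (by norm_num) a ha, hit 2 (by norm_num) a ha, hit 3 (by norm_num) a ha,
      hit 4 (by norm_num) a ha, Nat.factorial, smul_eq_mul]
    norm_num
    ring
  rw [e] at h
  simpa [Nat.factorial] using h

/-! ### Time derivatives of the solution -/

/-- Times `t` and step sizes `k` with `0 ≤ t < t + k ≤ T`. -/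
abbrev StepIndex (T : ℝ) : Type := {q : ℝ × ℝ // 0 ≤ q.1 ∧ 0 < q.2 ∧ q.1 + q.2 ≤ T}

namespace StepIndex
variable {T : ℝ} (i : StepIndex T)

theorem time_mem : i.1.1 ∈ Icc 0 T := ⟨i.2.1, by linarith [i.2.2.1, i.2.2.2]⟩

theorem step_bounded : ∃ S, ∀ i : StepIndex T, |i.1.2| ≤ S :=
  ⟨T, fun i => by rw [abs_of_pos i.2.2.1]; linarith [i.2.1, i.2.2.2]⟩

end StepIndex

/-- The family of the functions `x ↦ ∂_t^j f(x, t)`. -/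
noncomputable def timeDeriv (T : ℝ) (f : ℝ → ℝ → ℝ) (j : ℕ) (i : StepIndex T) (x : ℝ) : ℝ :=
  (pd T (0, 1))^[j] (fun p => f p.1 p.2) (x, i.1.1)

section timeDeriv
variable {T : ℝ} {f : ℝ → ℝ → ℝ}

theorem bd_timeDeriv (hT : 0 < T) {n j : ℕ}
    (hf : ContDiffOn ℝ (n + j : ℕ) (fun p : ℝ × ℝ => f p.1 p.2) (rect T)) :
    Bd n (timeDeriv T f j) := by
  obtain ⟨K, hK⟩ := exists_cBound hT (contDiffOn_pd_iterate hT (0, 1) j hf)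
  exact ⟨K, fun i => hK _ i.time_mem⟩

theorem exists_taylor_bound (hT : 0 < T)
    (hf : ContDiffOn ℝ (5 : ℕ) (fun p : ℝ × ℝ => f p.1 p.2) (rect T)) :
    ∃ C, ∀ i : StepIndex T, ∀ x ∈ Icc (0 : ℝ) 1,
      |f x (i.1.1 + i.1.2) - (timeDeriv T f 0 i x + i.1.2 * timeDeriv T f 1 i x
        + i.1.2 ^ 2 / 2 * timeDeriv T f 2 i x + i.1.2 ^ 3 / 6 * timeDeriv T f 3 i x
        + i.1.2 ^ 4 / 24 * timeDeriv T f 4 i x)| ≤ C * i.1.2 ^ 5 := by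
  have hj : ∀ j ≤ 5, ContDiffOn ℝ (5 - j : ℕ) ((pd T (0, 1))^[j] fun p => f p.1 p.2) (rect T) :=
    fun j hj => contDiffOn_pd_iterate hT (0, 1) j (by rwa [Nat.sub_add_cancel hj])
  obtain ⟨C, hC⟩ := (isCompact_rect T).exists_bound_of_continuousOn (hj 5 le_rfl).continuousOn
  refine ⟨C / 24, fun i x hx => ?_⟩
  obtain ⟨⟨t, k⟩, ht, hk, htk⟩ := i
  simp only at ht hk htk
  have hsub : Icc t (t + k) ⊆ Icc 0 T := Icc_subset_Icc ht htk
  have h := abs_taylor_remainder_le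
    (g := fun j s => (pd T (0, 1))^[j] (fun p => f p.1 p.2) (x, s)) (C := C)
    (show t < t + k by linarith)
    (hf.comp (by fun_prop) fun s hs => ⟨hx, hsub hs⟩)
    (fun j h5 s hs => by
      rw [Function.iterate_succ_apply']
      exact (hasDerivWithinAt_time ((hj j h5.le).differentiableOn
        (by exact_mod_cast (by omega : 5 - j ≠ 0))) hx (hsub hs)).mono hsub)
    (fun s hs => hC (x, s) ⟨hx, hsub hs⟩)
  simp only [add_sub_cancel_left] at h
  refine h.trans (le_of_eq (by ring))

theorem timeDeriv_eq_zero (hT : 0 < T) {n : ℕ} {x : ℝ} (hx : x ∈ Icc (0 : ℝ) 1)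
    (hf : ContDiffOn ℝ n (fun p : ℝ × ℝ => f p.1 p.2) (rect T))
    (h0 : ∀ t ∈ Icc 0 T, f x t = 0) {j : ℕ} (hj : j ≤ n) (i : StepIndex T) :
    timeDeriv T f j i x = 0 := by
  have key : ∀ j ≤ n, ∀ t ∈ Icc 0 T, (pd T (0, 1))^[j] (fun p => f p.1 p.2) (x, t) = 0 := by
    intro j
    induction j with
    | zero => exact fun _ => h0
    | succ j ih =>
      intro hj t ht
      have hd : DifferentiableOn ℝ ((pd T (0, 1))^[j] fun p => f p.1 p.2) (rect T) :=
        (contDiffOn_pd_iterate (n := 1) hT (0, 1) j (hf.of_le (by exact_mod_cast (by omega)))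
          ).differentiableOn (by simp)
      rw [Function.iterate_succ_apply']
      have h1 := hasDerivWithinAt_time hd hx ht
      have h2 : HasDerivWithinAt (fun s => (pd T (0, 1))^[j] (fun p => f p.1 p.2) (x, s)) 0
          (Icc 0 T) t :=
        (hasDerivWithinAt_const t _ (0 : ℝ)).congr (ih (by omega)) (ih (by omega) t ht)
      exact (uniqueDiffOn_Icc hT t ht).eq_deriv _ h1 h2
  exact key j hj _ i.time_mem

end timeDeriv

theorem IsSolution.timeDerivatives {m n : ℕ} {T : ℝ} {η₀ u₀ : ℝ → ℝ} {η u : ℝ → ℝ → ℝ}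
    (hT : 0 < T) (hs : IsSolution m T η₀ u₀ η u) (hm : n + 5 ≤ m) :
    TimeDerivatives (ι := StepIndex T) n (timeDeriv T η) (timeDeriv T u) := by
  have sη : ∀ j, j ≤ m → ContDiffOn ℝ j (fun p : ℝ × ℝ => η p.1 p.2) (rect T) := fun j hj =>
    hs.smooth_η.of_le (by exact_mod_cast hj)
  have su : ∀ j, j ≤ m → ContDiffOn ℝ j (fun p : ℝ × ℝ => u p.1 p.2) (rect T) := fun j hj =>
    hs.smooth_u.of_le (by exact_mod_cast hj)
  let E : ℕ → ℝ × ℝ → ℝ := fun j => (pd T (0, 1))^[j] fun p => η p.1 p.2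
  let U : ℕ → ℝ × ℝ → ℝ := fun j => (pd T (0, 1))^[j] fun p => u p.1 p.2
  have E_succ : ∀ j, pd T (0, 1) (E j) = E (j + 1) := fun j =>
    (Function.iterate_succ_apply' _ _ _).symm
  have U_succ : ∀ j, pd T (0, 1) (U j) = U (j + 1) := fun j =>
    (Function.iterate_succ_apply' _ _ _).symm
  have cE : ∀ j ≤ 3, C2Rect T (E j) := fun j hj =>
    contDiffOn_pd_iterate hT (0, 1) j (sη _ (by omega))
  have cU : ∀ j ≤ 3, C2Rect T (U j) := fun j hj =>
    contDiffOn_pd_iterate hT (0, 1) j (su _ (by omega))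
  have diff : ∀ {f : ℝ × ℝ → ℝ}, C2Rect T f → DifferentiableOn ℝ f (rect T) := C2Rect.diff
  -- Differentiation of an equation `f = -g_x` in time.
  have step : ∀ {f g g' : ℝ × ℝ → ℝ}, EqOn f (-pd T (1, 0) g) (rect T) →
      C2Rect T g → EqOn (pd T (0, 1) g) g' (rect T) →
      EqOn (pd T (0, 1) f) (-pd T (1, 0) g') (rect T) := by
    intro f g g' h hg hg' p hp
    have hd : DifferentiableOn ℝ (pd T (1, 0) g) (rect T) :=
      (contDiffOn_pd (n := 1) hT (1, 0) hg).differentiableOn (by simp)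
    have e : -pd T (1, 0) g = (-1 : ℝ) • pd T (1, 0) g := by ext; simp
    rw [pd_congr h hp, e, pd_smul hT _ hd hp, pd_comm hT _ _ hg hp, Pi.neg_apply,
      pd_congr hg' hp]
    ring
  have e0 := cE 0 (by norm_num)
  have e1 := cE 1 (by norm_num)
  have e2 := cE 2 (by norm_num)
  have e3 := cE 3 (by norm_num)
  have u0 := cU 0 (by norm_num)
  have u1 := cU 1 (by norm_num)
  have u2 := cU 2 (by norm_num)
  have u3 := cU 3 (by norm_num)
  have E1 : EqOn (E 1) (-pd T (1, 0) (U 0 + E 0 * U 0)) (rect T) := by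
    rintro ⟨x, t⟩ ⟨hx, ht⟩
    have h := hs.mass x hx t ht
    have h1 := (hasDerivWithinAt_time (diff e0) hx ht).derivWithin (uniqueDiffOn_Icc hT t ht)
    have h2 := dx_eq_pd (diff u0) hx ht
    have h3 := dx_eq_pd (diff (e0.mul u0)) hx ht
    rw [E_succ] at h1
    rw [Pi.neg_apply, pd_add hT (diff u0) (diff (e0.mul u0)) ⟨hx, ht⟩]
    simp only [E, U, Function.iterate_zero, id] at h1 h2 h3 ⊢
    rw [h1, h2] at h
    have h3' : dx (fun x' => η x' t * u x' t) x = _ := h3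
    rw [h3'] at h
    exact eq_neg_of_add_eq_zero_left (by rw [← add_assoc]; exact h)
  have U1 : EqOn (U 1) (-pd T (1, 0) (E 0 + (1 / 2 : ℝ) • (U 0 * U 0))) (rect T) := by
    rintro ⟨x, t⟩ ⟨hx, ht⟩
    have h := hs.momentum x hx t ht
    have h1 := (hasDerivWithinAt_time (diff u0) hx ht).derivWithin (uniqueDiffOn_Icc hT t ht)
    have h2 := dx_eq_pd (diff e0) hx ht
    have h3 := dx_eq_pd (diff u0) hx ht
    rw [U_succ] at h1
    rw [Pi.neg_apply, pd_add hT (diff e0) (diff ((u0.mul u0).const_smul _)) ⟨hx, ht⟩,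
      pd_smul hT _ (diff (u0.mul u0)) ⟨hx, ht⟩, pd_mul hT (diff u0) (diff u0) ⟨hx, ht⟩]
    simp only [E, U, Function.iterate_zero, id] at h1 h2 h3 ⊢
    rw [h1, h2, h3] at h
    linarith
  have E2 : EqOn (E 2) (-pd T (1, 0) (U 1 + E 0 * U 1 + E 1 * U 0)) (rect T) := by
    have := step E1 (u0.add (e0.mul u0)) (g' := U 1 + E 0 * U 1 + E 1 * U 0) fun p hp => by
      rw [pd_add hT (diff u0) (diff (e0.mul u0)) hp, pd_mul hT (diff e0) (diff u0) hp, E_succ,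
        U_succ]
      simp only [Pi.add_apply, Pi.mul_apply]
      ring
    rwa [E_succ] at this
  have U2 : EqOn (U 2) (-pd T (1, 0) (E 1 + U 0 * U 1)) (rect T) := by
    have := step U1 (e0.add ((u0.mul u0).const_smul _)) (g' := E 1 + U 0 * U 1) fun p hp => by
      rw [pd_add hT (diff e0) (diff ((u0.mul u0).const_smul _)) hp,
        pd_smul hT _ (diff (u0.mul u0)) hp, pd_mul hT (diff u0) (diff u0) hp, E_succ, U_succ]
      simp only [Pi.add_apply, Pi.mul_apply]
      ring
    rwa [U_succ] at this
  have E3 : EqOn (E 3)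
      (-pd T (1, 0) (U 2 + E 0 * U 2 + (2 : ℝ) • (E 1 * U 1) + E 2 * U 0)) (rect T) := by
    have := step E2 ((u1.add (e0.mul u1)).add (e1.mul u0))
      (g' := U 2 + E 0 * U 2 + (2 : ℝ) • (E 1 * U 1) + E 2 * U 0) fun p hp => by
        rw [pd_add hT (diff (u1.add (e0.mul u1))) (diff (e1.mul u0)) hp,
          pd_add hT (diff u1) (diff (e0.mul u1)) hp, pd_mul hT (diff e0) (diff u1) hp,
          pd_mul hT (diff e1) (diff u0) hp, E_succ, U_succ, E_succ, U_succ]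
        simp only [Pi.add_apply, Pi.mul_apply, Pi.smul_apply, smul_eq_mul]
        ring
    rwa [E_succ] at this
  have U3 : EqOn (U 3) (-pd T (1, 0) (E 2 + U 0 * U 2 + U 1 * U 1)) (rect T) := by
    have := step U2 (e1.add (u0.mul u1)) (g' := E 2 + U 0 * U 2 + U 1 * U 1) fun p hp => by
      rw [pd_add hT (diff e1) (diff (u0.mul u1)) hp, pd_mul hT (diff u0) (diff u1) hp, E_succ,
        U_succ, U_succ]
      simp only [Pi.add_apply, Pi.mul_apply]
      ring
    rwa [U_succ] at this
  have E4 : EqOn (E 4) (-pd T (1, 0) (U 3 + E 0 * U 3 + (3 : ℝ) • (E 1 * U 2)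
      + (3 : ℝ) • (E 2 * U 1) + E 3 * U 0)) (rect T) := by
    have s11 := (e1.mul u1).const_smul (2 : ℝ)
    have := step E3 (((u2.add (e0.mul u2)).add s11).add (e2.mul u0))
      (g' := U 3 + E 0 * U 3 + (3 : ℝ) • (E 1 * U 2) + (3 : ℝ) • (E 2 * U 1) + E 3 * U 0)
      fun p hp => by
        rw [pd_add hT (diff ((u2.add (e0.mul u2)).add s11)) (diff (e2.mul u0)) hp,
          pd_add hT (diff (u2.add (e0.mul u2))) (diff s11) hp,
          pd_add hT (diff u2) (diff (e0.mul u2)) hp, pd_mul hT (diff e0) (diff u2) hp,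
          pd_smul hT _ (diff (e1.mul u1)) hp, pd_mul hT (diff e1) (diff u1) hp,
          pd_mul hT (diff e2) (diff u0) hp, E_succ, U_succ, E_succ, U_succ, E_succ, U_succ]
        simp only [Pi.add_apply, Pi.mul_apply, Pi.smul_apply, smul_eq_mul]
        ring
    rwa [E_succ] at this
  have U4 : EqOn (U 4) (-pd T (1, 0) (E 3 + U 0 * U 3 + (3 : ℝ) • (U 1 * U 2))) (rect T) := by
    have := step U3 ((e2.add (u0.mul u2)).add (u1.mul u1))
      (g' := E 3 + U 0 * U 3 + (3 : ℝ) • (U 1 * U 2)) fun p hp => by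
        rw [pd_add hT (diff (e2.add (u0.mul u2))) (diff (u1.mul u1)) hp,
          pd_add hT (diff e2) (diff (u0.mul u2)) hp, pd_mul hT (diff u0) (diff u2) hp,
          pd_mul hT (diff u1) (diff u1) hp, E_succ, U_succ, U_succ, U_succ]
        simp only [Pi.add_apply, Pi.mul_apply, Pi.smul_apply, smul_eq_mul]
        ring
    rwa [U_succ] at this
  -- Restriction of an equation on the rectangle to a fixed time.
  have slice : ∀ {f g : ℝ × ℝ → ℝ}, EqOn f (-pd T (1, 0) g) (rect T) →
      C2Rect T g → ∀ i : StepIndex T,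
      EqOn (fun x => f (x, i.1.1)) (-dx fun x => g (x, i.1.1)) (Icc 0 1) := by
    intro f g h hg i x hx
    rw [Pi.neg_apply, dx_eq_pd (diff hg) hx i.time_mem]
    exact h ⟨hx, i.time_mem⟩
  exact
    { bd_e := fun j hj => bd_timeDeriv hT (sη _ (by omega))
      bd_w := fun j hj => bd_timeDeriv hT (su _ (by omega))
      e₁ := slice E1 (u0.add (e0.mul u0))
      e₂ := slice E2 ((u1.add (e0.mul u1)).add (e1.mul u0))
      e₃ := slice E3 (((u2.add (e0.mul u2)).add ((e1.mul u1).const_smul _)).add (e2.mul u0))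
      e₄ := slice E4 ((((u3.add (e0.mul u3)).add ((e1.mul u2).const_smul _)).add
        ((e2.mul u1).const_smul _)).add (e3.mul u0))
      w₁ := slice U1 (e0.add ((u0.mul u0).const_smul _))
      w₂ := slice U2 (e1.add (u0.mul u1))
      w₃ := slice U3 ((e2.add (u0.mul u2)).add (u1.mul u1))
      w₄ := slice U4 ((e3.add (u0.mul u3)).add ((u1.mul u2).const_smul _)) }

/-! ### The local error estimate -/

/-- The exact stages are bounded in `C^n[0,1]`, with one constant for all four stages. -/
theorem exists_cBound_exactStage {ι : Type*} {κ : ι → ℝ} {n : ℕ} {v w : ι → ℝ → ℝ}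
    (hκ : ∃ T, ∀ i, |κ i| ≤ T) (hv : Bd (n + 3) v) (hw : Bd (n + 3) w) :
    ∃ B, 0 ≤ B ∧ ∀ j ≤ 3, ∀ i, CBound n B (exactStage (κ i) (v i) (w i) j).1 ∧
      CBound n B (exactStage (κ i) (v i) (w i) j).2 := by
  have h : ∀ j : ℕ, ∃ K, j ≤ 3 → ∀ i, CBound n K (exactStage (κ i) (v i) (w i) j).1 ∧
      CBound n K (exactStage (κ i) (v i) (w i) j).2 := by
    intro j
    by_cases hj : j ≤ 3
    · obtain ⟨⟨K, hK⟩, L, hL⟩ := bd_exactStage (n := n) hκ j (hv.of_le (by omega))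
        (hw.of_le (by omega))
      exact ⟨max K L, fun _ i => ⟨(hK i).mono_right (le_max_left _ _),
        (hL i).mono_right (le_max_right _ _)⟩⟩
    · exact ⟨0, fun h => absurd h hj⟩
  choose K hK using h
  refine ⟨∑ j ∈ Finset.range 4, |K j|, Finset.sum_nonneg fun _ _ => abs_nonneg _,
    fun j hj i => ?_⟩
  have hle : K j ≤ ∑ j ∈ Finset.range 4, |K j| := (le_abs_self _).trans
    (Finset.single_le_sum (f := fun j => |K j|) (fun _ _ => abs_nonneg _)
      (Finset.mem_range.2 (by omega)))
  exact ⟨(hK j hj i).1.mono_right hle, (hK j hj i).2.mono_right hle⟩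

/-- The second component of the exact stages satisfies the boundary conditions. -/
theorem vanishesAtEnds_exactStage {m n : ℕ} {T α : ℝ} {η₀ u₀ : ℝ → ℝ} {η u : ℝ → ℝ → ℝ}
    (hT : 0 < T) (hα : 0 < α) (hs : IsSolution m T η₀ u₀ η u) (hm : 3 ≤ m)
    (hη : ∀ x ∈ Icc (0 : ℝ) 1, ∀ t ∈ Icc 0 T, α ≤ 1 + η x t)
    (H : TimeDerivatives (ι := StepIndex T) (n + 3) (timeDeriv T η) (timeDeriv T u))
    (i : StepIndex T) {j : ℕ} (hj : j ≤ 3) :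
    VanishesAtEnds (exactStage i.1.2 (timeDeriv T η 0 i) (timeDeriv T u 0 i) j).2 := by
  have hv : Bd j fun _ : Unit => timeDeriv T η 0 i :=
    ((H.bd_e 0 (by norm_num)).of_le (by omega)).imp fun _ h _ => h i
  have hw : Bd j fun _ : Unit => timeDeriv T u 0 i :=
    ((H.bd_w 0 (by norm_num)).of_le (by omega)).imp fun _ h _ => h i
  have key : ∀ x₀ ∈ Icc (0 : ℝ) 1, (∀ t ∈ Icc 0 T, u x₀ t = 0) →
      (exactStage i.1.2 (timeDeriv T η 0 i) (timeDeriv T u 0 i) j).2 x₀ = 0 := by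
    intro x₀ hx h0
    have hpos := hη x₀ hx _ i.time_mem
    obtain ⟨p1, p2⟩ := H.parity hx i
      (fun l hl => timeDeriv_eq_zero hT hx hs.smooth_u h0 (hl.trans hm) i)
      (show 1 + η x₀ i.1.1 ≠ 0 by linarith)
    exact (parity_exactStage (p := 0) hx _ j (by rwa [Nat.zero_add]) (by rwa [Nat.zero_add])
      (p1.of_le (by omega)) (p2.of_le (by omega))).2.apply rfl
  obtain ⟨-, K, hK⟩ := bd_exactStage (n := 0) (κ := fun _ : Unit => i.1.2)
    (v := fun _ => timeDeriv T η 0 i) (w := fun _ => timeDeriv T u 0 i) ⟨|i.1.2|, fun _ => le_rfl⟩ j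
    (by rwa [Nat.zero_add]) (by rwa [Nat.zero_add])
  exact ⟨(hK ()).continuousOn, key 0 (by simp) fun t ht => (hs.boundary t ht).1,
    key 1 (by simp) fun t ht => (hs.boundary t ht).2⟩

/-- Consistency of the Runge-Kutta scheme without discretization in space. -/
theorem exists_consistency_bound {m : ℕ} {T : ℝ} {η₀ u₀ : ℝ → ℝ} {η u : ℝ → ℝ → ℝ}
    (hT : 0 < T) (hs : IsSolution m T η₀ u₀ η u) (hm : 9 ≤ m) :
    ∃ C, 0 ≤ C ∧ ∀ i : StepIndex T, ∀ x ∈ Icc (0 : ℝ) 1,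
      |η x (i.1.1 + i.1.2) - η x i.1.1 + i.1.2 * dx (∑ j ∈ Finset.Icc 1 4, rkB j •
        flux (exactStage i.1.2 (timeDeriv T η 0 i) (timeDeriv T u 0 i) (j - 1))) x|
          ≤ C * i.1.2 ^ 5 ∧
      |u x (i.1.1 + i.1.2) - u x i.1.1 + i.1.2 * dx (∑ j ∈ Finset.Icc 1 4, rkB j •
        potential (exactStage i.1.2 (timeDeriv T η 0 i) (timeDeriv T u 0 i) (j - 1))) x|
          ≤ C * i.1.2 ^ 5 := by
  have H := hs.timeDerivatives (n := 0 + 4) hT (by omega)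
  obtain ⟨⟨R, ⟨K, hK⟩, hR⟩, Q, ⟨L, hL⟩, hQ⟩ := H.jet_sum_flux (n := 0) StepIndex.step_bounded
  obtain ⟨C₁, hC₁⟩ := exists_taylor_bound hT (hs.smooth_η.of_le (by exact_mod_cast (by omega)))
  obtain ⟨C₂, hC₂⟩ := exists_taylor_bound hT (hs.smooth_u.of_le (by exact_mod_cast (by omega)))
  have aux : ∀ {A r₁ C D k S : ℝ}, 0 < k → |A| ≤ C * k ^ 5 → |r₁| ≤ D →
      S = A + k ^ 5 * r₁ → C + D ≤ |C₁ + K| + |C₂ + L| →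
      |S| ≤ (|C₁ + K| + |C₂ + L|) * k ^ 5 := by
    intro A r₁ C D k S hk hA hr hS hCD
    have h5 : 0 < k ^ 5 := by positivity
    rw [hS]
    refine (abs_add_le _ _).trans ?_
    rw [abs_mul, abs_of_pos h5]
    calc |A| + k ^ 5 * |r₁| ≤ C * k ^ 5 + k ^ 5 * D :=
          add_le_add hA (mul_le_mul_of_nonneg_left hr h5.le)
      _ = (C + D) * k ^ 5 := by ring
      _ ≤ _ := mul_le_mul_of_nonneg_right hCD h5.le
  refine ⟨|C₁ + K| + |C₂ + L|, by positivity, fun i x hx => ⟨?_, ?_⟩⟩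
  · refine aux i.2.2.1 (hC₁ i x hx) ((hK i).abs_le x hx) ?_
      (by linarith [le_abs_self (C₁ + K), abs_nonneg (C₂ + L)])
    rw [hR i x hx]
    change _ - η x i.1.1 + _ = _ - (η x i.1.1 + _ + _ + _ + _) + _
    ring
  · refine aux i.2.2.1 (hC₂ i x hx) ((hL i).abs_le x hx) ?_
      (by linarith [le_abs_self (C₂ + L), abs_nonneg (C₁ + K)])
    rw [hQ i x hx]
    change _ - u x i.1.1 + _ = _ - (u x i.1.1 + _ + _ + _ + _) + _
    ring

end ShallowWater

open ShallowWater in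
theorem proposition3p1 (r μ : ℕ) (hr : 3 ≤ r) (hμ : 1 ≤ μ) (hμr : μ + 2 ≤ r) :
    ∃ m : ℕ, ∀ 𝒯 : Set ShallowWater.Mesh,
      ShallowWater.QuasiUniform 𝒯 →
      ShallowWater.ApproximationProperty r μ 𝒯 →
      ShallowWater.H3Bounded r μ 𝒯 →
      ∀ (T α : ℝ) (η₀ u₀ : ℝ → ℝ) (η u : ℝ → ℝ → ℝ), 0 < T → 0 < α →
        ShallowWater.IsSolution m T η₀ u₀ η u →
        (∀ x ∈ Set.Icc (0 : ℝ) 1, ∀ t ∈ Set.Icc 0 T, α ≤ 1 + η x t) →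
        ∃ C : Polynomial ℝ, (∀ i, 0 ≤ C.coeff i) ∧
          ∀ τ ∈ 𝒯, ∀ M : ℕ, 0 < M → ∀ k : ℝ, k = T / M → ∀ n < M,
            ShallowWater.l2Norm (ShallowWater.localError₁ r μ τ η u k n)
                + ShallowWater.l2Norm (ShallowWater.localError₂ r μ τ η u k n)
              ≤ C.eval (k / τ.h) * k * (k ^ 4 + τ.h ^ (r - 1)) := by
  refine ⟨r + 9, fun 𝒯 hqu happ _ T α η₀ u₀ η u hT hα hs hη => ?_⟩
  obtain ⟨K, hK0, hinv⟩ := exists_inverse_inequality r hμ hqu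
  obtain ⟨C, hC⟩ := happ
  have H := hs.timeDerivatives (n := r + 3) hT (by omega)
  obtain ⟨B, hB0, hB⟩ := exists_cBound_exactStage (n := r) StepIndex.step_bounded
    (H.bd_e 0 (by norm_num)) (H.bd_w 0 (by norm_num))
  obtain ⟨D, hD0, hD⟩ := exists_consistency_bound hT hs (by omega)
  set A := (3 + K) * (|C| * B)
  have hA0 : 0 ≤ A := by positivity
  set P := stagePoly A (2 * (1 + K) * (1 + 4 * B))
  have hP : ∀ j, NonnegCoeff (P j) := fun j => nonnegCoeff_stagePoly hA0 (by positivity) j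
  let S : Polynomial ℝ := (P 0 + P 0 * P 0) + ((P 1 + P 1 * P 1) + ((P 2 + P 2 * P 2)
    + (P 3 + P 3 * P 3)))
  have hS : NonnegCoeff S := (((hP 0).add ((hP 0).mul (hP 0)))).add
    (((hP 1).add ((hP 1).mul (hP 1))).add
      (((hP 2).add ((hP 2).mul (hP 2))).add ((hP 3).add ((hP 3).mul (hP 3)))))
  refine ⟨Polynomial.C (2 * D) + Polynomial.C (2 * (1 + 4 * B)) * S,
    (NonnegCoeff.C (by positivity)).add ((NonnegCoeff.C (by positivity)).mul hS),
    fun τ hτ M hM k hk n hn => ?_⟩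
  have hh := τ.h_pos
  have hM' : (0 : ℝ) < M := by exact_mod_cast hM
  have hk0 : 0 < k := by rw [hk]; positivity
  have hnk : n * k + k ≤ T := by
    have h1 : (n : ℝ) + 1 ≤ M := by exact_mod_cast hn
    calc n * k + k = (n + 1) * k := by ring
      _ ≤ M * k := mul_le_mul_of_nonneg_right h1 hk0.le
      _ = T := by rw [hk]; field_simp
  let i : StepIndex T := ⟨(n * k, k), by positivity, hk0, hnk⟩
  set v : ℝ → ℝ := timeDeriv T η 0 i
  set w : ℝ → ℝ := timeDeriv T u 0 i
  have hinv' := hinv τ hτ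
  have hBi : ∀ j ≤ 3, CBound 1 B (exactStage k v w j).1 ∧ CBound 1 B (exactStage k v w j).2 :=
    fun j hj => ⟨(hB j hj i).1.of_le (by omega), (hB j hj i).2.of_le (by omega)⟩
  have hAi : ∀ j ≤ 3,
      h1Norm (l2Proj (Sh r μ τ) (exactStage k v w j).1 - (exactStage k v w j).1)
        ≤ A * τ.h ^ (r - 1) ∧
      h1Norm (l2Proj (Sh0 r μ τ) (exactStage k v w j).2 - (exactStage k v w j).2)
        ≤ A * τ.h ^ (r - 1) := by
    intro j hj
    obtain ⟨hB1, hB2⟩ := hB j hj i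
    exact ⟨h1Norm_l2Proj_sub_le hμ le_rfl (by omega) hK0 hinv'
        (hC τ hτ r (by omega) le_rfl _ hB1.memH).1 hB1,
      h1Norm_l2Proj_sub_le hμ (Sh0_le r μ τ) (by omega) hK0 hinv'
        ((hC τ hτ r (by omega) le_rfl _ hB2.memH).2
          (vanishesAtEnds_exactStage hT hα hs (by omega) hη H i hj)) hB2⟩
  have hE := stage_error_le hμ hK0 hinv' hk0.le hBi hAi
  have hv : C1 v := (hBi 0 (by norm_num)).1.c1
  have hw : C1 w := (hBi 0 (by norm_num)).2.c1
  have hmem := fun j => stage_mem r μ hμ τ k (l2Proj_mem (S := Sh r μ τ) le_rfl hv.memL2)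
    (l2Proj_mem (Sh0_le r μ τ) hw.memL2) j
  have cV := fun j => C1.of_mem_Sh hμ (hmem j).1
  have cW := fun j => C1.of_mem_Sh hμ (Sh0_le _ _ _ (hmem j).2)
  have cη : C1 fun x => η x (n * k + k) := by
    obtain ⟨_, h⟩ := exists_cBound (n := 1) hT (hs.smooth_η.of_le (by exact_mod_cast (by omega)))
    exact (h (n * k + k) ⟨by positivity, hnk⟩).c1
  have cu : C1 fun x => u x (n * k + k) := by
    obtain ⟨_, h⟩ := exists_cBound (n := 1) hT (hs.smooth_u.of_le (by exact_mod_cast (by omega)))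
    exact (h (n * k + k) ⟨by positivity, hnk⟩).c1
  have hcast : ((n + 1 : ℕ) : ℝ) * k = n * k + k := by push_cast; ring
  have hsq : ∀ j, (P j).eval (k / τ.h) * τ.h ^ (r - 1)
      + ((P j).eval (k / τ.h) * τ.h ^ (r - 1)) ^ 2
      ≤ ((P j).eval (k / τ.h) + (P j).eval (k / τ.h) * (P j).eval (k / τ.h)) * τ.h ^ (r - 1) := by
    intro j
    have h1 : (τ.h ^ (r - 1)) ^ 2 ≤ τ.h ^ (r - 1) :=
      pow_le_of_le_one (by positivity) (pow_le_one₀ hh.le τ.h_le_one) two_ne_zero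
    have h2 := mul_le_mul_of_nonneg_left h1 (sq_nonneg ((P j).eval (k / τ.h)))
    nlinarith
  have hsum : ∀ g : ℕ → ℝ → ℝ, (∀ j ≤ 3, h1Norm (g j) ≤ (1 + 4 * B) *
      ((P j).eval (k / τ.h) * τ.h ^ (r - 1) + ((P j).eval (k / τ.h) * τ.h ^ (r - 1)) ^ 2)) →
      ∑ j ∈ Finset.range 4, h1Norm (g j)
        ≤ (1 + 4 * B) * (S.eval (k / τ.h) * τ.h ^ (r - 1)) := by
    intro g hg
    have hg' := fun j hj => (hg j hj).trans (mul_le_mul_of_nonneg_left (hsq j) (by positivity))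
    have g0 := hg' 0 (by norm_num)
    have g1 := hg' 1 (by norm_num)
    have g2 := hg' 2 (by norm_num)
    have g3 := hg' 3 (by norm_num)
    simp only [Finset.sum_range_succ, Finset.sum_range_zero, S, Polynomial.eval_add,
      Polynomial.eval_mul]
    linarith
  have b1 := l2Norm_localError_le (S := Sh r μ τ) le_rfl hk0.le (f₀ := v)
    (f₁ := fun x => η x (n * k + k))
    (q := fun j => flux (exactStage k v w j))
    (Q := fun j => flux (stage r μ τ k (l2Proj (Sh r μ τ) v) (l2Proj (Sh0 r μ τ) w) j)) hv cη
    (fun j hj => (hBi j (by omega)).1.c1.flux (hBi j (by omega)).2.c1)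
    (fun j _ => (cV j).flux (cW j)) (fun _ _ => rfl) (fun x hx => (hD i x hx).1)
  have b2 := l2Norm_localError_le (S := Sh0 r μ τ) (Sh0_le r μ τ) hk0.le (f₀ := w)
    (f₁ := fun x => u x (n * k + k))
    (G := ∑ j ∈ Finset.Icc 1 4,
      rkB j • force (stage r μ τ k (l2Proj (Sh r μ τ) v) (l2Proj (Sh0 r μ τ) w) (j - 1)))
    (q := fun j => potential (exactStage k v w j))
    (Q := fun j => potential (stage r μ τ k (l2Proj (Sh r μ τ) v) (l2Proj (Sh0 r μ τ) w) j)) hw cu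
    (fun j hj => (hBi j (by omega)).1.c1.potential (hBi j (by omega)).2.c1)
    (fun j _ => (cV j).potential (cW j))
    (fun x hx => by
      rw [dx_sum_rkB (g := fun j =>
        potential (stage r μ τ k (l2Proj (Sh r μ τ) v) (l2Proj (Sh0 r μ τ) w) j))
        (fun j _ => (cV j).potential (cW j)) hx]
      simp only [Finset.sum_apply, Pi.smul_apply]
      exact Finset.sum_congr rfl fun j _ =>
        congrArg (rkB j • ·) (force_eqOn (cV (j - 1)) (cW (j - 1)) hx))
    (fun x hx => (hD i x hx).2)
  have s1 := hsum _ fun j hj => h1Norm_flux_sub_le (hBi j hj).1 (hBi j hj).2 (cV j) (cW j)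
    (hE j hj)
  have s2 := hsum _ fun j hj => h1Norm_potential_sub_le (hBi j hj).1 (hBi j hj).2 (cV j) (cW j)
    (hE j hj)
  have t1 : l2Norm (localError₁ r μ τ η u k n)
      ≤ D * k ^ 5 + k * ((1 + 4 * B) * (S.eval (k / τ.h) * τ.h ^ (r - 1))) := by
    refine le_trans (le_of_eq ?_) (b1.trans (add_le_add_right
      (mul_le_mul_of_nonneg_left s1 hk0.le) _))
    simp only [localError₁, projη, projU, hcast]
    rfl
  have t2 : l2Norm (localError₂ r μ τ η u k n)
      ≤ D * k ^ 5 + k * ((1 + 4 * B) * (S.eval (k / τ.h) * τ.h ^ (r - 1))) := by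
    refine le_trans (le_of_eq ?_) (b2.trans (add_le_add_right
      (mul_le_mul_of_nonneg_left s2 hk0.le) _))
    simp only [localError₂, projη, projU, hcast]
    rfl
  have hSn : 0 ≤ S.eval (k / τ.h) := hS.eval_nonneg (by positivity)
  have hc1 : 0 ≤ D * k * τ.h ^ (r - 1) := by positivity
  have hc2 : 0 ≤ (1 + 4 * B) * S.eval (k / τ.h) * k * k ^ 4 := by positivity
  simp only [Polynomial.eval_add, Polynomial.eval_mul, Polynomial.eval_C]
  calc _ ≤ 2 * (D * k ^ 5 + k * ((1 + 4 * B) * (S.eval (k / τ.h) * τ.h ^ (r - 1)))) := by linarith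
    _ ≤ 2 * (D * k ^ 5 + k * ((1 + 4 * B) * (S.eval (k / τ.h) * τ.h ^ (r - 1))))
        + 2 * (D * k * τ.h ^ (r - 1) + (1 + 4 * B) * S.eval (k / τ.h) * k * k ^ 4) := by linarith
    _ = _ := by ring
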